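/- **Setting.** Identify the Heisenberg group $\mathbb H^n$ with $\mathbb R^{2n+1}=H_1\oplus H_2$, $H_1=\mathrm{span}(e_1,\dots,e_{2n})$, $H_2=\mathrm{span}(e_{2n+1})$, with orthonormal basis $(e_j)$, group law $pq=p+q+\tfrac12\omega(p,q)e_{2n+1}$, where $\omega(p,q)=\sum_{i=1}^n(p_iq_{n+i}-p_{n+i}q_i)$, and dilations $\delta_t(h+v)=th+t^2v$ ($h\in H_1$, $v\in H_2$). Let $d$ be a homogeneous distance (left invariant, $d(\delta_tx,\delta_ty)=t\,d(x,y)$ for $t>0$), $\|x\|=d(x,0)$, with closed balls $\mathbb B(x,r)$; let $\mathcal H^p_E$ be the Euclidean Hausdorff measure with $c_p=\mathcal L^p(\{x\in\mathbb R^p:|x|\le1\})/2^p$. Let $1\le k\le n$, and let $\mathbb H^n=\mathbb W\rtimes\mathbb V$ with subgroups $\mathbb W\supset H_2$ and $\mathbb V\subset H_1$ closed under dilations, $\mathbb H^n=\mathbb W\mathbb V$, $\mathbb W\cap\mathbb V=\{0\}$ and $\dim\mathbb V=k$. Choose orthonormal bases $(v_1,\dots,v_k)$ of $\mathbb V$ and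 $(w_{k+1},\dots,w_{2n},e_{2n+1})$ of $\mathbb W$, and put $V=v_1\wedge\dots\wedge v_k$, $N=w_{k+1}\wedge\dots\wedge w_{2n}\wedge e_{2n+1}$. Let $\Omega\subset\mathbb H^n$ be open and let $f\in C^1_h(\Omega,\mathbb R^k)$, i.e. the horizontal derivatives $X_vf(x)=\lim_{t\to0}(f(x(tv))-f(x))/t$, $v\in H_1$, exist and are continuous on $\Omega$. Let $Df(x)$ be the Pansu differential: the linear map with $Df(x)(\delta_tw)=t\,Df(x)(w)$ for $t>0$ and $|f(xw)-f(x)-Df(x)(w)|=o(\|w\|)$ as $w\to 0$. Let $\nabla_Hf_i(x)\in H_1$, $\nabla_{\mathbb V}f_i(x)\in\mathbb V$ be the vectors representing $Df_i(x)$ on $\mathbb H^n$ and on $\mathbb V$, respectively, and put $J_Hf=\|\nabla_Hf_1\wedge\dots\wedge\nabla_Hf_k\|$, $J_{\mathbb V}f=\|\nabla_{\mathbb V}f_1\wedge\dots\wedge\nabla_{\mathbb V}f_k\|$. Fix $x_0\in\Omega$, let $\Sigma=\{x\in\Omega:f(x)=f(x_0)\}$, and assume $J_{\mathbb V}f(x)>0$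 for all $x\in\Sigma$. **Terminology.** A set $S$ is a ($k$-codimensional) *$\mathbb H$-regular surface* if every $x\in S$ has an open neighbourhood $O$ and $g\in C^1_h(O,\mathbb R^k)$ with $S\cap O=\{y\in O:g(y)=0\}$ and $J_Hg\ne0$ on $O$. A *parametrization* of $S$ with respect to $(\mathbb W,\mathbb V)$ is a map $\phi:U\to\mathbb V$, $U$ open in $\mathbb W$, which is uniformly intrinsic differentiable and satisfies $S=\Phi(U)$, where $\Phi(u)=u\phi(u)$. Uniformly intrinsic differentiable means: for every $\bar w\in U$ there is a homogeneous homomorphism $L:\mathbb W\to\mathbb V$ such that $$\lim_{\delta\to0}\ \sup_{w'\in U,\ \|\bar w^{-1}w'\|<\delta}\ \sup_{0<\|w\|<\delta}\frac{d\big(L(w),\phi_{\Phi(w')^{-1}}(w)\big)}{\|w\|}=0 ,$$ where $x=\pi_{\mathbb W}(x)\pi_{\mathbb V}(x)$ with $\pi_{\mathbb W}(x)\in\mathbb W$, $\pi_{\mathbb V}(x)\in\mathbb V$, where $\phi_x(w)=\pi_{\mathbb V}(x)\,\phi(x^{-1}w\pi_{\mathbb V}(x))$, and where $w$ ranges over the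 domain of the translated function. An $\mathbb H$-regular surface that has a parametrization is a *parametrized $\mathbb H$-regular surface with respect to $(\mathbb W,\mathbb V)$*. The homogeneous tangent cone $\mathrm{Tan}(\Sigma,x)$ is the set of all limits $\lim_h\delta_{r_h}(x^{-1}x_h)$ with $r_h>0$, $x_h\in\Sigma$, $x_h\to x$. **Theorem (upper blow-up).** Under these assumptions the following hold. 1. Every $x\in\Sigma$ has an open neighbourhood $\Omega'\subset\Omega$ such that $\Sigma\cap\Omega'$ is a parametrized $\mathbb H$-regular surface with respect to $(\mathbb W,\mathbb V)$. The whole set $\Sigma$ is a parametrized $\mathbb H$-regular surface with respect to $(\mathbb W,\mathbb V)$ if and only if it meets every coset $u\mathbb V$ in at most one point. 2. Let $\Omega'\subset\Omega$ be open (for instance $\Omega'=\Omega$) and let $\phi:U\to\mathbb V$ be a parametrization of $\Sigma\cap\Omega'$ with respect to $(\mathbb W,\mathbb V)$. Then $$\mu(B)=\|V\wedge N\|\int_{\Phi^{-1}(B)}\frac{J_Hf(\Phi(u))}{J_{\mathbb V}f(\Phi(u))}\,d\mathcal H^{2n+1-k}_E(u),\qquad B\subset\mathbb H^n\text{ Borel},$$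 defines a Borel measure, and for every $x\in\Sigma\cap\Omega'$ the cone $\mathrm{Tan}(\Sigma,x)$ is a linear subspace of dimension $2n+1-k$ and $$\theta^{2n+2-k}(\mu,x)=\beta_d(\mathrm{Tan}(\Sigma,x))<\infty .$$ Here $$\theta^{\alpha}(\mu,x)=\inf_{\varepsilon>0}\sup\Big\{\frac{2^\alpha\mu(\mathbb B(y,r))}{\mathrm{diam}(\mathbb B(y,r))^\alpha}:\ x\in\mathbb B(y,r),\ 0<r<\varepsilon\Big\}$$ is the spherical $\alpha$-Federer density and $\beta_d(\Pi)=\max_{z\in\mathbb B(0,1)}\mathcal H^p_E(\Pi\cap\mathbb B(z,1))$ is the spherical factor of a linear subspace $\Pi$ of dimension $p$, the maximum being attained. -/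

import Mathlib

open Filter Topology MeasureTheory Set
open scoped ENNReal

noncomputable section

/-- The `n`-th Heisenberg group `ℍⁿ`, identified with `ℝ²ⁿ⁺¹` through a Heisenberg basis
`e₁, …, e₂ₙ, e₂ₙ₊₁`, which is orthonormal for the fixed scalar product: `Sum.inl i` is the index
of `eᵢ`, `Sum.inr (Sum.inl i)` that of `eₙ₊ᵢ`, and `Sum.inr (Sum.inr ())` that of `e₂ₙ₊₁`.
The norm, the topology and the linear structure are the Euclidean ones. -/
abbrev Heis (n : ℕ) : Type := EuclideanSpace ℝ (Fin n ⊕ Fin n ⊕ Unit)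

namespace Heis

variable {n : ℕ}

/-- The last vector `e₂ₙ₊₁` of the Heisenberg basis, spanning the centre `H₂`. -/
def e (n : ℕ) : Heis n := EuclideanSpace.single (Sum.inr (Sum.inr ())) 1

/-- The coordinate along `e₂ₙ₊₁`. -/
def z (p : Heis n) : ℝ := p (Sum.inr (Sum.inr ()))

/-- The symplectic form `ω(π_{H₁} p, π_{H₁} q)`, with `ω(eᵢ, eₙ₊ⱼ) = δᵢⱼ`. -/
def omega (p q : Heis n) : ℝ :=
  ∑ i : Fin n, (p (Sum.inl i) * q (Sum.inr (Sum.inl i)) - p (Sum.inr (Sum.inl i)) * q (Sum.inl i))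

lemma omega_add_left (p q r : Heis n) : omega (p + q) r = omega p r + omega q r := by
  simp only [omega, PiLp.add_apply, ← Finset.sum_add_distrib]
  exact Finset.sum_congr rfl fun i _ => by ring

lemma omega_add_right (p q r : Heis n) : omega p (q + r) = omega p q + omega p r := by
  simp only [omega, PiLp.add_apply, ← Finset.sum_add_distrib]
  exact Finset.sum_congr rfl fun i _ => by ring

lemma omega_smul_e_left (c : ℝ) (q : Heis n) : omega (c • e n) q = 0 := by
  simp [omega, e]

lemma omega_smul_e_right (c : ℝ) (p : Heis n) : omega p (c • e n) = 0 := by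
  simp [omega, e]

lemma omega_neg_self (p : Heis n) : omega (-p) p = 0 := by
  simp only [omega, PiLp.neg_apply]
  exact Finset.sum_eq_zero fun i _ => by ring

/-- The group law `p q = p + q + [p, q] / 2`, where `[p, q] = ω(p, q) e₂ₙ₊₁`. The unit is the
vector `0` and the inverse of `p` is `-p`. -/
instance instGroup : Group (Heis n) where
  mul p q := p + q + (omega p q / 2) • e n
  one := 0
  inv p := -p
  mul_assoc p q r := by
    change (p + q + (omega p q / 2) • e n) + r
        + (omega (p + q + (omega p q / 2) • e n) r / 2) • e n
      = p + (q + r + (omega q r / 2) • e n)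
        + (omega p (q + r + (omega q r / 2) • e n) / 2) • e n
    simp only [omega_add_left, omega_add_right, omega_smul_e_left, omega_smul_e_right]
    module
  one_mul p := by
    change (0 : Heis n) + p + (omega 0 p / 2) • e n = p
    simp [omega]
  mul_one p := by
    change p + (0 : Heis n) + (omega p 0 / 2) • e n = p
    simp [omega]
  inv_mul_cancel p := by
    change -p + p + (omega (-p) p / 2) • e n = (0 : Heis n)
    simp [omega_neg_self]

lemma mul_def (p q : Heis n) : p * q = p + q + (omega p q / 2) • e n := rfl

lemma one_def : (1 : Heis n) = 0 := rfl

lemma inv_def (p : Heis n) : p⁻¹ = -p := rfl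

/-- The projection onto `H₁ = span (e₁, …, e₂ₙ)`. -/
def projH1 (p : Heis n) : Heis n := p - z p • e n

/-- The projection onto `H₂ = span e₂ₙ₊₁`. -/
def projH2 (p : Heis n) : Heis n := z p • e n

/-- The horizontal layer. -/
def H1 (n : ℕ) : Set (Heis n) := {p | projH2 p = 0}

/-- The vertical layer. -/
def H2 (n : ℕ) : Set (Heis n) := {p | projH1 p = 0}

/-- The intrinsic dilation `δ_t`. -/
def dil (t : ℝ) (p : Heis n) : Heis n := t • projH1 p + t ^ 2 • projH2 p

/-- `d` is a homogeneous distance: a distance, invariant under left translations and homogeneous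
with respect to the dilations. -/
structure IsHomDist (d : Heis n → Heis n → ℝ) : Prop where
  eq_zero_iff : ∀ x y, d x y = 0 ↔ x = y
  symm : ∀ x y, d x y = d y x
  triangle : ∀ x y u, d x u ≤ d x y + d y u
  left_inv : ∀ u x y, d (u * x) (u * y) = d x y
  dil : ∀ t : ℝ, 0 < t → ∀ x y, d (dil t x) (dil t y) = t * d x y

/-- The closed ball `𝔹(x, r)` of `d`. -/
def cball (d : Heis n → Heis n → ℝ) (x : Heis n) (r : ℝ) : Set (Heis n) := {y | d x y ≤ r}

/-- The diameter with respect to `d`. -/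
def diam (d : Heis n → Heis n → ℝ) (S : Set (Heis n)) : ℝ≥0∞ :=
  ⨆ x ∈ S, ⨆ y ∈ S, ENNReal.ofReal (d x y)

/-! ### Subgroups and factorizations -/

/-- Closed under the dilations. (A subgroup with this property is automatically a linear subspace,
hence a Lie subgroup.) -/
def IsHomogeneous (S : Subgroup (Heis n)) : Prop := ∀ t : ℝ, 0 < t → ∀ p ∈ S, dil t p ∈ S

def IsVertical (S : Subgroup (Heis n)) : Prop := IsHomogeneous S ∧ H2 n ⊆ S

def IsHorizontal (S : Subgroup (Heis n)) : Prop := IsHomogeneous S ∧ (S : Set (Heis n)) ⊆ H1 n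

/-- The semidirect factorization `ℍⁿ = W ⋊ V`, with `W` vertical and `V` horizontal. -/
structure IsSemidirect (W V : Subgroup (Heis n)) : Prop where
  vertical : IsVertical W
  horizontal : IsHorizontal V
  mul_eq : ∀ x : Heis n, ∃ w ∈ W, ∃ v ∈ V, x = w * v
  inf_eq : W ⊓ V = ⊥

/-- The projection `π_V` of the factorization: `x = π_W(x) π_V(x)`. -/
def piV (W V : Subgroup (Heis n)) (x : Heis n) : Heis n :=
  Classical.epsilon fun v => v ∈ V ∧ ∃ w ∈ W, x = w * v

/-- `σ_x(w) = x w π_V(x)⁻¹`. -/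
def sigma (W V : Subgroup (Heis n)) (x w : Heis n) : Heis n := x * w * (piV W V x)⁻¹

/-- The translated function `φ_x(w) = π_V(x) φ(x⁻¹ w π_V(x))`, whose domain is `σ_x(U)` if that
of `φ` is `U`. -/
def translate (W V : Subgroup (Heis n)) (φ : Heis n → Heis n) (x w : Heis n) : Heis n :=
  piV W V x * φ (x⁻¹ * w * piV W V x)

/-- The graph map `Φ(w) = w φ(w)`. -/
def graphMap (φ : Heis n → Heis n) (w : Heis n) : Heis n := w * φ w

/-- The restriction of `L` to `W` is an h-homomorphism from `W` to `V`. -/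
structure IsHHom (W V : Subgroup (Heis n)) (L : Heis n → Heis n) : Prop where
  mapsTo : ∀ w ∈ W, L w ∈ V
  map_mul : ∀ w ∈ W, ∀ w' ∈ W, L (w * w') = L w * L w'
  map_dil : ∀ t : ℝ, 0 < t → ∀ w ∈ W, L (dil t w) = dil t (L w)

/-- Uniform intrinsic differentiability of `φ : U → V` (only the values on `U` matter): at each
`w₀ ∈ U` there is an h-homomorphism `L : W → V` such that
`d (L w) (φ_{Φ(w')⁻¹} w) / ‖w‖ → 0` as `w → 0`, `w' → w₀`; here `w' ∈ U`, and `w ≠ 0` ranges over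
the domain `σ_{Φ(w')⁻¹}(U)` of the translated function. -/
def IsUnifIntrinsicDiff (d : Heis n → Heis n → ℝ) (W V : Subgroup (Heis n)) (U : Set (Heis n))
    (φ : Heis n → Heis n) : Prop :=
  ∀ w₀ ∈ U, ∃ L : Heis n → Heis n, IsHHom W V L ∧
    ∀ ε > 0, ∃ δ > 0, ∀ w' ∈ U, d (w₀⁻¹ * w') 0 < δ →
      ∀ w ∈ sigma W V (graphMap φ w')⁻¹ '' U, 0 < d w 0 → d w 0 < δ →
        d (L w) (translate W V φ (graphMap φ w')⁻¹ w) / d w 0 ≤ ε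

/-! ### Horizontal regularity, gradients and Jacobians -/

section Calculus

variable {F : Type*} [NormedAddCommGroup F] [NormedSpace ℝ F]

/-- The horizontal derivative `X_v f(x) = lim_{t → 0} (f(x (t v)) - f(x)) / t`. -/
def horDeriv (f : Heis n → F) (v x : Heis n) : F := deriv (fun t : ℝ => f (x * (t • v))) 0

/-- `f ∈ C¹_h(Ω, F)`: the horizontal derivatives exist in `Ω` and are continuous there. -/
def IsC1h (Ω : Set (Heis n)) (f : Heis n → F) : Prop :=
  ∀ v ∈ H1 n, (∀ x ∈ Ω, DifferentiableAt ℝ (fun t : ℝ => f (x * (t • v))) 0) ∧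
    ContinuousOn (horDeriv f v) Ω

/-- The h-homomorphism `L` is a Pansu differential of `f` at `x`. -/
def IsPansuDiff (d : Heis n → Heis n → ℝ) (f : Heis n → F) (x : Heis n) (L : Heis n →ₗ[ℝ] F) :
    Prop :=
  (∀ t : ℝ, 0 < t → ∀ w, L (dil t w) = t • L w) ∧
    (fun w => f (x * w) - f x - L w) =o[comap (fun w => d w 0) (𝓝 0)] fun w => d w 0

/-- The Pansu differential `Df(x)`. -/
def pansuDiff (d : Heis n → Heis n → ℝ) (f : Heis n → F) (x : Heis n) : Heis n →ₗ[ℝ] F :=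
  Classical.epsilon (IsPansuDiff d f x)

end Calculus

/-- The horizontal gradient `∇_H f(x)` of a real function. -/
def gradH (d : Heis n → Heis n → ℝ) (f : Heis n → ℝ) (x : Heis n) : Heis n :=
  Classical.epsilon fun u => u ∈ H1 n ∧ ∀ y, pansuDiff d f x y = inner ℝ u y

/-- The gradient `∇_V f(x)` of a real function along a horizontal subgroup `V`. -/
def gradV (d : Heis n → Heis n → ℝ) (V : Subgroup (Heis n)) (f : Heis n → ℝ) (x : Heis n) :
    Heis n :=
  Classical.epsilon fun u => u ∈ V ∧ ∀ y ∈ V, pansuDiff d f x y = inner ℝ u y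

/-- The norm `‖u₁ ∧ ⋯ ∧ u_m‖` of a simple multivector: `‖u₁ ∧ ⋯ ∧ u_m‖² = det (⟨uᵢ, uⱼ⟩)`. -/
def wedgeNorm {ι : Type*} [Fintype ι] [DecidableEq ι] (u : ι → Heis n) : ℝ :=
  Real.sqrt (Matrix.det (Matrix.of fun i j => inner ℝ (u i) (u j)))

/-- The horizontal Jacobian `J_H f(x)`. -/
def jacH (d : Heis n → Heis n → ℝ) {k : ℕ} (f : Heis n → EuclideanSpace ℝ (Fin k))
    (x : Heis n) : ℝ :=
  wedgeNorm fun i : Fin k => gradH d (fun y => f y i) x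

/-- The Jacobian `J_V f(x)` with respect to `V`. -/
def jacV (d : Heis n → Heis n → ℝ) (V : Subgroup (Heis n)) {k : ℕ}
    (f : Heis n → EuclideanSpace ℝ (Fin k)) (x : Heis n) : ℝ :=
  wedgeNorm fun i : Fin k => gradV d V (fun y => f y i) x

/-! ### Regular surfaces -/

/-- `S` is a `k`-codimensional `ℍ`-regular surface (of low codimension). -/
def IsHRegular (d : Heis n → Heis n → ℝ) (k : ℕ) (S : Set (Heis n)) : Prop :=
  1 ≤ k ∧ k ≤ n ∧ ∀ x ∈ S, ∃ (Ω : Set (Heis n)) (f : Heis n → EuclideanSpace ℝ (Fin k)),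
    IsOpen Ω ∧ x ∈ Ω ∧ IsC1h Ω f ∧ S ∩ Ω = {y | y ∈ Ω ∧ f y = 0} ∧ ∀ y ∈ Ω, jacH d f y ≠ 0

/-- `φ : U → V`, with `U` open in `W`, is uniformly intrinsic differentiable and its intrinsic
graph is `S`. -/
structure IsParametrization (d : Heis n → Heis n → ℝ) (W V : Subgroup (Heis n))
    (S U : Set (Heis n)) (φ : Heis n → Heis n) : Prop where
  isOpen : ∃ O : Set (Heis n), IsOpen O ∧ U = O ∩ W
  mapsTo : ∀ w ∈ U, φ w ∈ V
  unifDiff : IsUnifIntrinsicDiff d W V U φ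
  graph_eq : S = graphMap φ '' U

/-- `S` is a parametrized (`k`-codimensional) `ℍ`-regular surface with respect to `(W, V)`. -/
def IsParametrizedHRegular (d : Heis n → Heis n → ℝ) (k : ℕ) (W V : Subgroup (Heis n))
    (S : Set (Heis n)) : Prop :=
  IsHRegular d k S ∧ IsSemidirect W V ∧ ∃ U φ, IsParametrization d W V S U φ

/-- The homogeneous tangent cone. -/
def tanCone (A : Set (Heis n)) (x : Heis n) : Set (Heis n) :=
  {ν | ∃ (r : ℕ → ℝ) (y : ℕ → Heis n), (∀ h, 0 < r h) ∧ (∀ h, y h ∈ A) ∧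
    Tendsto y atTop (𝓝 x) ∧ Tendsto (fun h => dil (r h) (x⁻¹ * y h)) atTop (𝓝 ν)}

/-! ### Measures -/

/-- The Euclidean Hausdorff measure `ℋ_E^p`, with normalizing constant
`c_p = ℒ^p({x ∈ ℝ^p : |x| ≤ 1}) / 2^p` (Mathlib's `μH[p]` has constant `1`). -/
def hausE (n p : ℕ) : Measure (Heis n) :=
  (volume (Metric.closedBall (0 : EuclideanSpace ℝ (Fin p)) 1) / 2 ^ p) • μH[(p : ℝ)]

/-- The spherical `α`-Federer density of `μ` at `x`. -/
def federerDensity (d : Heis n → Heis n → ℝ) (α : ℝ) (μ : Measure (Heis n)) (x : Heis n) :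
    ℝ≥0∞ :=
  ⨅ ε : {ε : ℝ // 0 < ε},
    sSup {b | ∃ (y : Heis n) (r : ℝ), 0 < r ∧ r < ε ∧ x ∈ cball d y r ∧
      b = 2 ^ α * μ (cball d y r) / diam d (cball d y r) ^ α}

/-- The spherical factor `β_d(P)` of a linear subspace `P` of dimension `p`: the supremum of
`ℋ_E^p(P ∩ 𝔹(u, 1))` over `u ∈ 𝔹(0, 1)`. -/
def sphericalFactor (d : Heis n → Heis n → ℝ) (P : Submodule ℝ (Heis n)) : ℝ≥0∞ :=
  ⨆ u ∈ cball d 0 1, hausE n (Module.finrank ℝ P) (P ∩ cball d u 1)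

end Heis

end

/-! A point of `Heis n` is a product of a bounded number of horizontal segments whose lengths are
controlled by its gauge. The mean value inequality along each segment turns a `C¹_h` function into a
strictly Pansu differentiable one (`IsC1h.isStrictPansu`), with differential `L = horDiff f x`.
Where `J_V f > 0`, `L` restricted to `V` has an inverse `B`. A displacement `m` between two points
of the level set near `x` has a small defect: `B (L m) = o(‖m‖)` (`exists_defect_le`). Everything
else follows from this estimate.

If `m ∈ V`, the defect is `m` itself, so near `x` the level set meets a coset of `V` at most once. A
perturbation of the identity shows that it meets all nearby cosets (`exists_solution`). Hence the
level set is locally the graph of a continuous `φ`, and the defect estimate is exactly uniform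
intrinsic differentiability with differential `w ↦ -B (L w)`. Globally, the only obstruction is a
coset met twice.

For the blow-up, the tangent space `ker L` is itself the graph `linGraph B L` over `W`. The point of
the level set over `u`, translated by `x⁻¹`, and the point of `ker L` over `x⁻¹ u π_V(x)` differ by
the defect. So the part of `U` over a ball of radius `r` is squeezed between the parts over which
`ker L` meets balls of radii `r` and `r (1 + ε)`, up to rescaling `r` (`exists_linGraph_mem`,
`exists_mem_cball`).

The map `u ↦ x⁻¹ u π_V(x)` is a shear followed by a translation of `W` and preserves measure. The
map `linGraph` is a shear followed by a linear map of determinant `Δ`, and `J_H ‖V ∧ N‖ = J_V |Δ|`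
(`jacH_mul_wedgeNorm`). Thus the weight in `μ` is the one that turns measure on `W` into `ℋ_E^p` on
`ker L`, where `p = 2n + 1 - k`. Since `ker L` contains the centre, dilations scale this measure by
`r ^ (p + 1)`, and balls have diameter `2r`. The density is therefore the supremum of `ℋ_E^p(ker L ∩
𝔹(u, 1))` over `u ∈ 𝔹(0, 1)`, which is attained by upper semicontinuity. -/

namespace Heis

variable {n : ℕ}

/-! ### The group structure in coordinates -/

@[simp] lemma z_add (p q : Heis n) : z (p + q) = z p + z q := rfl
@[simp] lemma z_sub (p q : Heis n) : z (p - q) = z p - z q := rfl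
@[simp] lemma z_neg (p : Heis n) : z (-p) = -z p := rfl
@[simp] lemma z_smul (c : ℝ) (p : Heis n) : z (c • p) = c * z p := rfl
@[simp] lemma z_zero : z (0 : Heis n) = 0 := rfl
@[simp] lemma z_e : z (e n) = 1 := by simp [z, e]

lemma omega_smul_left (c : ℝ) (p q : Heis n) : omega (c • p) q = c * omega p q := by
  simp only [omega, PiLp.smul_apply, smul_eq_mul, Finset.mul_sum]
  exact Finset.sum_congr rfl fun i _ => by ring

lemma omega_smul_right (c : ℝ) (p q : Heis n) : omega p (c • q) = c * omega p q := by
  simp only [omega, PiLp.smul_apply, smul_eq_mul, Finset.mul_sum]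
  exact Finset.sum_congr rfl fun i _ => by ring

lemma omega_neg_left (p q : Heis n) : omega (-p) q = -omega p q := by
  rw [← neg_one_smul ℝ p, omega_smul_left]; ring

lemma omega_sub_left (p q r : Heis n) : omega (p - q) r = omega p r - omega q r := by
  rw [sub_eq_add_neg, omega_add_left, omega_neg_left]; ring

@[simp] lemma omega_self (p : Heis n) : omega p p = 0 := by
  simp only [omega]
  exact Finset.sum_eq_zero fun i _ => by ring

@[simp] lemma omega_zero_left (p : Heis n) : omega 0 p = 0 := by simp [omega]

@[simp] lemma omega_zero_right (p : Heis n) : omega p 0 = 0 := by simp [omega]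

@[simp] lemma omega_e_left (p : Heis n) : omega (e n) p = 0 := by
  simpa using omega_smul_e_left 1 p

@[simp] lemma omega_e_right (p : Heis n) : omega p (e n) = 0 := by
  simpa using omega_smul_e_right 1 p

lemma omega_comm (p q : Heis n) : omega p q = -omega q p := by
  simp only [omega, ← Finset.sum_neg_distrib]
  exact Finset.sum_congr rfl fun i _ => by ring

lemma continuous_z : Continuous (z : Heis n → ℝ) := by unfold z; fun_prop

lemma continuous_omega : Continuous fun x : Heis n × Heis n => omega x.1 x.2 := by
  unfold omega; fun_prop

instance instContinuousMul : ContinuousMul (Heis n) where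
  continuous_mul := by
    have := continuous_omega (n := n)
    simp only [mul_def]
    fun_prop

instance instContinuousInv : ContinuousInv (Heis n) where
  continuous_inv := by
    simp only [inv_def]
    fun_prop

lemma mul_of_omega_eq_zero {p q : Heis n} (h : omega p q = 0) : p * q = p + q := by
  simp [mul_def, h]

lemma e_ne_zero : e n ≠ 0 := fun h => by simpa using congrArg z h

/-! ### Layers and dilations -/

lemma mem_H1 {p : Heis n} : p ∈ H1 n ↔ z p = 0 := by
  simp [H1, projH2, e_ne_zero]

lemma projH1_of_mem {p : Heis n} (h : p ∈ H1 n) : projH1 p = p := by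
  simp [projH1, mem_H1.1 h]

@[simp] lemma z_projH1 (p : Heis n) : z (projH1 p) = 0 := by simp [projH1]

lemma projH1_add_projH2 (p : Heis n) : projH1 p + z p • e n = p := by simp [projH1]

lemma dil_eq (t : ℝ) (p : Heis n) : dil t p = t • p + (t ^ 2 - t) • (z p • e n) := by
  simp only [dil, projH1, projH2]; module

@[simp] lemma z_dil (t : ℝ) (p : Heis n) : z (dil t p) = t ^ 2 * z p := by
  simp [dil, projH2]

@[simp] lemma projH1_dil (t : ℝ) (p : Heis n) : projH1 (dil t p) = t • projH1 p := by
  rw [projH1, z_dil, dil_eq, projH1]; module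

lemma omega_dil (t : ℝ) (p q : Heis n) : omega (dil t p) (dil t q) = t ^ 2 * omega p q := by
  simp only [dil_eq, omega_add_left, omega_add_right, omega_smul_left, omega_smul_right,
    omega_e_left, omega_e_right]
  ring

lemma dil_mul (t : ℝ) (p q : Heis n) : dil t (p * q) = dil t p * dil t q := by
  simp only [mul_def (dil t p), omega_dil]
  simp only [dil_eq, mul_def, z_add, z_smul, z_e]
  module

lemma dil_dil (s t : ℝ) (p : Heis n) : dil s (dil t p) = dil (s * t) p := by
  rw [dil_eq, z_dil, dil_eq, dil_eq]; module

@[simp] lemma dil_one (p : Heis n) : dil 1 p = p := by simp [dil_eq]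

@[simp] lemma dil_zero_right (t : ℝ) : dil t (0 : Heis n) = 0 := by simp [dil_eq]

lemma dil_inv_dil {t : ℝ} (ht : 0 < t) (p : Heis n) : dil t⁻¹ (dil t p) = p := by
  rw [dil_dil, inv_mul_cancel₀ ht.ne', dil_one]

lemma dil_dil_inv {t : ℝ} (ht : 0 < t) (p : Heis n) : dil t (dil t⁻¹ p) = p := by
  rw [dil_dil, mul_inv_cancel₀ ht.ne', dil_one]

lemma dil_of_mem {p : Heis n} (h : p ∈ H1 n) (t : ℝ) : dil t p = t • p := by
  simp [dil_eq, mem_H1.1 h]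

lemma dil_inv (t : ℝ) (p : Heis n) : dil t p⁻¹ = (dil t p)⁻¹ := by
  simp only [inv_def, dil_eq, z_neg]; module

/-- The homogeneous Euclidean gauge. -/
noncomputable def gauge (p : Heis n) : ℝ := ‖projH1 p‖ + Real.sqrt |z p|

lemma continuous_gauge : Continuous (gauge : Heis n → ℝ) := by
  have := continuous_z (n := n)
  unfold gauge projH1
  fun_prop

lemma gauge_nonneg (p : Heis n) : 0 ≤ gauge p := by unfold gauge; positivity

lemma gauge_pos {p : Heis n} (hp : p ≠ 0) : 0 < gauge p := by
  rcases (gauge_nonneg p).eq_or_lt with h | h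
  · exfalso
    have h1 : ‖projH1 p‖ = 0 := by
      have := Real.sqrt_nonneg |z p|
      have := norm_nonneg (projH1 p)
      unfold gauge at h; linarith
    have h2 : Real.sqrt |z p| = 0 := by unfold gauge at h; linarith
    have h3 : z p = 0 := by simpa using (Real.sqrt_eq_zero (abs_nonneg _)).1 h2
    apply hp
    rw [← projH1_add_projH2 p, norm_eq_zero.1 h1, h3]; simp
  · exact h

@[simp] lemma gauge_zero : gauge (0 : Heis n) = 0 := by simp [gauge, projH1]

lemma gauge_dil {t : ℝ} (ht : 0 < t) (p : Heis n) : gauge (dil t p) = t * gauge p := by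
  simp only [gauge, projH1_dil, z_dil, norm_smul, Real.norm_eq_abs, abs_mul, abs_pow, abs_of_pos ht]
  rw [Real.sqrt_mul (by positivity), Real.sqrt_sq ht.le]; ring

lemma isCompact_gauge_le (R : ℝ) : IsCompact {p : Heis n | gauge p ≤ R} := by
  refine Metric.isCompact_of_isClosed_isBounded (isClosed_le continuous_gauge continuous_const) ?_
  refine (Metric.isBounded_closedBall (x := (0 : Heis n)) (r := R + R ^ 2)).subset fun p hp => ?_
  have hp : gauge p ≤ R := hp
  have h1 : ‖projH1 p‖ ≤ R := by
    have := Real.sqrt_nonneg |z p|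
    unfold gauge at hp; linarith
  have h2 : Real.sqrt |z p| ≤ R := by
    have := norm_nonneg (projH1 p)
    unfold gauge at hp; linarith
  have h3 : |z p| ≤ R ^ 2 := (Real.sqrt_le_left ((Real.sqrt_nonneg _).trans h2)).1 h2
  rw [mem_closedBall_zero_iff, ← projH1_add_projH2 p]
  refine (norm_add_le _ _).trans (add_le_add h1 ?_)
  simpa [norm_smul, e] using h3

/-! ### Decomposition into horizontal pieces -/

/-- The horizontal vector `e_i`. -/
noncomputable def eX (i : Fin n) : Heis n := EuclideanSpace.single (Sum.inl i) 1

/-- The horizontal vector `e_{n+i}`. -/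
noncomputable def eY (i : Fin n) : Heis n := EuclideanSpace.single (Sum.inr (Sum.inl i)) 1

lemma eX_mem (i : Fin n) : eX i ∈ H1 n := mem_H1.2 (by simp [z, eX])

lemma eY_mem (i : Fin n) : eY i ∈ H1 n := mem_H1.2 (by simp [z, eY])

lemma smul_mem_H1 (c : ℝ) {p : Heis n} (h : p ∈ H1 n) : c • p ∈ H1 n := by
  rw [mem_H1] at *; simp [h]

lemma omega_eX_eX (i j : Fin n) : omega (eX i) (eX j) = 0 := by simp [omega, eX]

lemma omega_eY_eY (i j : Fin n) : omega (eY i) (eY j) = 0 := by simp [omega, eY]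

lemma omega_eX_eY (i : Fin n) : omega (eX i) (eY i) = 1 := by
  simp [omega, eX, eY]

/-- Vertical displacements are commutators of horizontal ones: a vertical coordinate of size `c`
costs horizontal steps of size `√|c|`, which is the order of the gauge. -/
lemma commutator_eX_eY (i : Fin n) (s t : ℝ) :
    (s • eX i) * (t • eY i) * (-s • eX i) * (-t • eY i) = (s * t) • e n := by
  have h : omega (eY i) (eX i) = -1 := by rw [omega_comm, omega_eX_eY]
  simp only [mul_def, omega_add_left, omega_smul_left, omega_smul_right, omega_eX_eY, omega_eX_eX,
    omega_eY_eY, h, omega_e_left]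
  module

/-- The product of the two horizontal factors creates half their symplectic pairing in the centre,
and the last factor removes it. -/
lemma exists_decomposition (p : Heis n) :
    p = (∑ i, p (Sum.inl i) • eX i) * (∑ i, p (Sum.inr (Sum.inl i)) • eY i) *
      ((z p - (∑ i, p (Sum.inl i) * p (Sum.inr (Sum.inl i))) / 2) • e n) := by
  have h : omega (∑ i, p (Sum.inl i) • eX i) (∑ i, p (Sum.inr (Sum.inl i)) • eY i)
      = ∑ i, p (Sum.inl i) * p (Sum.inr (Sum.inl i)) := by
    simp [omega, eX, eY, Pi.single_apply, Finset.sum_apply]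
  simp only [mul_def, h, omega_smul_e_right]
  ext j
  rcases j with j | j | j <;> simp [eX, eY, e, z, Pi.single_apply]

lemma abs_apply_inl_le_gauge (p : Heis n) (i : Fin n) : |p (Sum.inl i)| ≤ gauge p := by
  have h : p (Sum.inl i) = projH1 p (Sum.inl i) := by simp [projH1, e]
  rw [h, ← Real.norm_eq_abs]
  exact (PiLp.norm_apply_le _ _).trans (le_add_of_nonneg_right (Real.sqrt_nonneg _))

lemma abs_apply_inr_le_gauge (p : Heis n) (i : Fin n) :
    |p (Sum.inr (Sum.inl i))| ≤ gauge p := by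
  have h : p (Sum.inr (Sum.inl i)) = projH1 p (Sum.inr (Sum.inl i)) := by simp [projH1, e]
  rw [h, ← Real.norm_eq_abs]
  exact (PiLp.norm_apply_le _ _).trans (le_add_of_nonneg_right (Real.sqrt_nonneg _))

lemma abs_z_le_gauge_sq (p : Heis n) : |z p| ≤ gauge p ^ 2 := by
  rw [← Real.sq_sqrt (abs_nonneg (z p))]
  have : Real.sqrt |z p| ≤ gauge p := le_add_of_nonneg_left (norm_nonneg _)
  gcongr

lemma mem_H1_of_mem_range {v : Heis n} (hv : v ∈ range (eX (n := n)) ∪ range eY) : v ∈ H1 n := by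
  rcases hv with ⟨i, rfl⟩ | ⟨i, rfl⟩
  exacts [eX_mem i, eY_mem i]

/-- The identity is a finite product of maps `p ↦ c(p) • v`, with `v` a horizontal basis vector and
`c` bounded by the gauge; hence a property of maps that is stable under products, and holds for such maps,
holds for the identity. -/
lemma horizontal_induction (hn : 0 < n) {C : (Heis n → Heis n) → Prop}
    (hmul : ∀ g h, C g → C h → C fun p => g p * h p)
    (hbase : ∀ (c : Heis n → ℝ) (K : ℝ), (∀ p, |c p| ≤ K * gauge p) →
      ∀ v ∈ range (eX (n := n)) ∪ range eY, C fun p => c p • v) : C fun p => p := by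
  have h0 : C fun _ => 0 := by
    simpa using hbase (fun _ => 0) 0 (by simp) (eX ⟨0, hn⟩) (Or.inl ⟨_, rfl⟩)
  have hX : ∀ s : Finset (Fin n), C fun p => ∑ i ∈ s, p (Sum.inl i) • eX i := by
    intro s
    induction s using Finset.induction_on with
    | empty => simpa using h0
    | insert a s ha ih =>
      have := hmul _ _ (hbase (fun p => p (Sum.inl a)) 1
        (fun p => by simpa using abs_apply_inl_le_gauge p a) (eX a) (Or.inl ⟨_, rfl⟩)) ih
      convert this using 2 with p
      rw [Finset.sum_insert ha, mul_of_omega_eq_zero]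
      refine Finset.induction_on s (by simp) fun b s hb hs => ?_
      rw [Finset.sum_insert hb, omega_add_right, hs, omega_smul_left, omega_smul_right,
        omega_eX_eX]
      simp
  have hY : ∀ s : Finset (Fin n), C fun p => ∑ i ∈ s, p (Sum.inr (Sum.inl i)) • eY i := by
    intro s
    induction s using Finset.induction_on with
    | empty => simpa using h0
    | insert a s ha ih =>
      have := hmul _ _ (hbase (fun p => p (Sum.inr (Sum.inl a))) 1
        (fun p => by simpa using abs_apply_inr_le_gauge p a) (eY a) (Or.inr ⟨_, rfl⟩)) ih
      convert this using 2 with p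
      rw [Finset.sum_insert ha, mul_of_omega_eq_zero]
      refine Finset.induction_on s (by simp) fun b s hb hs => ?_
      rw [Finset.sum_insert hb, omega_add_right, hs, omega_smul_left, omega_smul_right,
        omega_eY_eY]
      simp
  have hE : ∀ (c : Heis n → ℝ) (K : ℝ), 0 ≤ K → (∀ p, |c p| ≤ K * gauge p ^ 2) →
      C fun p => c p • e n := by
    intro c K hK hc
    let i : Fin n := ⟨0, hn⟩
    have hs : ∀ p, Real.sqrt |c p| ≤ Real.sqrt K * gauge p := fun p => by
      rw [← Real.sqrt_sq (gauge_nonneg p), ← Real.sqrt_mul hK]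
      exact Real.sqrt_le_sqrt (hc p)
    -- The sign of `c` is put into one of the two coefficients, so that `√|c| * t = c` in the
    -- commutator.
    let t : Heis n → ℝ := fun p => (SignType.sign (c p) : ℝ) * Real.sqrt (abs (c p))
    have ht : ∀ p, |t p| ≤ Real.sqrt K * gauge p := fun p => by
      refine le_trans ?_ (hs p)
      simp only [t]
      rw [abs_mul, abs_of_nonneg (Real.sqrt_nonneg _)]
      refine mul_le_of_le_one_left (Real.sqrt_nonneg _) ?_
      rcases SignType.sign (c p) <;> simp
    have := hmul _ _ (hmul _ _ (hmul _ _
      (hbase (fun p => Real.sqrt |c p|) _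
        (fun p => by rw [abs_of_nonneg (Real.sqrt_nonneg _)]; exact hs p) (eX i) (Or.inl ⟨_, rfl⟩))
      (hbase t _ ht (eY i) (Or.inr ⟨_, rfl⟩)))
      (hbase (fun p => -Real.sqrt |c p|) _
        (fun p => by rw [abs_neg, abs_of_nonneg (Real.sqrt_nonneg _)]; exact hs p) (eX i) (Or.inl ⟨_, rfl⟩)))
      (hbase (fun p => -t p) _
        (fun p => by rw [abs_neg]; exact ht p) (eY i) (Or.inr ⟨_, rfl⟩))
    convert this using 2 with p
    rw [commutator_eX_eY]
    congr 1
    simp only [t]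
    rw [mul_left_comm, Real.mul_self_sqrt (abs_nonneg _), sign_mul_abs]
  have := hmul _ _ (hmul _ _ (hX Finset.univ) (hY Finset.univ))
    (hE (fun p => z p - (∑ i, p (Sum.inl i) * p (Sum.inr (Sum.inl i))) / 2) (1 + n)
      (by positivity) fun p => ?_)
  · convert this using 2 with p
    exact exists_decomposition p
  · have h1 : |∑ i, p (Sum.inl i) * p (Sum.inr (Sum.inl i))| ≤ n * gauge p ^ 2 := by
      refine (Finset.abs_sum_le_sum_abs _ _).trans ?_
      refine (Finset.sum_le_card_nsmul _ _ (gauge p ^ 2) fun i _ => ?_).trans (by simp)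
      rw [abs_mul, sq]
      exact mul_le_mul (abs_apply_inl_le_gauge p i) (abs_apply_inr_le_gauge p i) (abs_nonneg _)
        (gauge_nonneg p)
    refine (abs_sub _ _).trans ?_
    rw [abs_div, abs_two]
    have := abs_z_le_gauge_sq p
    have := abs_nonneg (∑ i, p (Sum.inl i) * p (Sum.inr (Sum.inl i)))
    nlinarith

/-! ### Homogeneous distances -/

namespace IsHomDist

variable {d : Heis n → Heis n → ℝ} (hd : IsHomDist d)
include hd

lemma self (x : Heis n) : d x x = 0 := (hd.eq_zero_iff x x).2 rfl

lemma nonneg (x y : Heis n) : 0 ≤ d x y := by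
  have := hd.triangle x y x
  rw [hd.self, hd.symm y x] at this
  linarith

lemma eq_inv_mul (x y : Heis n) : d x y = d (x⁻¹ * y) 0 := by
  rw [← hd.left_inv x⁻¹ x y, inv_mul_cancel, hd.symm]; rfl

lemma eq_inv_mul' (x y : Heis n) : d x y = d (y⁻¹ * x) 0 := by
  rw [hd.symm, hd.eq_inv_mul]

lemma mul_right (x m : Heis n) : d x (x * m) = d m 0 := by
  rw [hd.eq_inv_mul, inv_mul_cancel_left]

lemma mul_le (p q : Heis n) : d (p * q) 0 ≤ d p 0 + d q 0 := by
  have := hd.triangle (p * q) p 0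
  rw [hd.symm (p * q) p, hd.mul_right] at this
  linarith

lemma inv_zero (p : Heis n) : d p⁻¹ 0 = d p 0 := by
  rw [hd.symm p, hd.eq_inv_mul 0 p, hd.eq_inv_mul p⁻¹ 0, inv_inv, ← one_def]; simp

lemma dil_zero {t : ℝ} (ht : 0 < t) (p : Heis n) : d (Heis.dil t p) 0 = t * d p 0 := by
  have := hd.dil t ht p 0
  rwa [dil_zero_right] at this

lemma pos {p : Heis n} (hp : p ≠ 0) : 0 < d p 0 :=
  (hd.nonneg p 0).lt_of_ne fun h => hp ((hd.eq_zero_iff p 0).1 h.symm)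

lemma smul_le {v : Heis n} (hv : v ∈ H1 n) (c : ℝ) : d (c • v) 0 = |c| * d v 0 := by
  rcases lt_trichotomy c 0 with h | h | h
  · have : c • v = (Heis.dil (-c) v)⁻¹ := by rw [dil_of_mem hv, inv_def]; simp
    rw [this, hd.inv_zero, hd.dil_zero (by linarith), abs_of_neg h]
  · simp [h, hd.self]
  · rw [← dil_of_mem hv, hd.dil_zero h, abs_of_pos h]

/-- The axioms of `d` say nothing about the Euclidean topology. On horizontal lines `d` is a
multiple of the norm by homogeneity, and `horizontal_induction` with the triangle inequality extends
the control to all directions. -/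
lemma tendsto_zero (hn : 0 < n) : Tendsto (fun p : Heis n => d p 0) (𝓝 0) (𝓝 0) := by
  refine horizontal_induction hn (C := fun g => Tendsto (fun p => d (g p) 0) (𝓝 0) (𝓝 0)) ?_ ?_
  · intro g h hg hh
    refine squeeze_zero (fun p => hd.nonneg _ _) (fun p => hd.mul_le _ _) ?_
    simpa using hg.add hh
  · intro c K hc v hv
    have h1 : Tendsto (fun p : Heis n => K * gauge p * d v 0) (𝓝 0) (𝓝 0) := by
      have := ((continuous_gauge (n := n)).const_mul K).mul_const (d v 0)
      simpa using this.tendsto 0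
    refine squeeze_zero (fun p => hd.nonneg _ _) (fun p => ?_) h1
    rw [hd.smul_le (mem_H1_of_mem_range hv)]
    exact mul_le_mul_of_nonneg_right (hc p) (hd.nonneg _ _)

lemma continuous (hn : 0 < n) : Continuous fun x : Heis n × Heis n => d x.1 x.2 := by
  rw [continuous_iff_continuousAt]
  rintro ⟨x, y⟩
  have key : ∀ a : Heis n, Tendsto (fun b => d a b) (𝓝 a) (𝓝 0) := fun a => by
    have : Tendsto (fun b : Heis n => a⁻¹ * b) (𝓝 a) (𝓝 0) := by
      have h := (continuous_const_mul a⁻¹).tendsto a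
      rwa [inv_mul_cancel] at h
    refine ((hd.tendsto_zero hn).comp this).congr fun b => ?_
    simp [hd.eq_inv_mul a b]
  have h1 : Tendsto (fun q : Heis n × Heis n => d x q.1 + d y q.2) (𝓝 (x, y)) (𝓝 0) := by
    have := ((key x).comp (continuous_fst.tendsto (x, y))).add
      ((key y).comp (continuous_snd.tendsto (x, y)))
    simpa using this
  refine tendsto_iff_dist_tendsto_zero.2 (squeeze_zero (fun _ => dist_nonneg) (fun q => ?_) h1)
  rw [Real.dist_eq, abs_le]
  have a1 := hd.triangle x q.1 y
  have a2 := hd.triangle q.1 q.2 y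
  have a3 := hd.triangle q.1 x q.2
  have a4 := hd.triangle x y q.2
  have a5 := hd.symm x q.1
  have a6 := hd.symm y q.2
  constructor <;> simp only <;> linarith

lemma continuous_left (hn : 0 < n) (y : Heis n) : Continuous fun x : Heis n => d x y :=
  (hd.continuous hn).comp (by fun_prop : Continuous fun x : Heis n => (x, y))

lemma continuous_right (hn : 0 < n) (x : Heis n) : Continuous fun y : Heis n => d x y :=
  (hd.continuous hn).comp (by fun_prop : Continuous fun y : Heis n => (x, y))

/-- The gauge and the norm of a homogeneous distance are equivalent. -/
lemma exists_gauge_bounds (hn : 0 < n) :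
    ∃ C > 0, ∀ p : Heis n, gauge p ≤ C * d p 0 ∧ d p 0 ≤ C * gauge p := by
  set K : Set (Heis n) := {p | gauge p ≤ 1} ∩ {p | gauge p = 1} with hK
  have hKc : IsCompact K :=
    (isCompact_gauge_le 1).inter_right (isClosed_eq continuous_gauge continuous_const)
  have hne : K.Nonempty := by
    have h := gauge_pos (e_ne_zero (n := n))
    refine ⟨Heis.dil (gauge (e n))⁻¹ (e n), ?_, ?_⟩ <;>
    simp [gauge_dil (inv_pos.2 h), inv_mul_cancel₀ h.ne']
  have hc := (hd.continuous_left hn 0).continuousOn (s := K)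
  obtain ⟨a, ha, hmin⟩ := hKc.exists_isMinOn hne hc
  obtain ⟨b, hb, hmax⟩ := hKc.exists_isMaxOn hne hc
  have ha0 : 0 < d a 0 := hd.pos fun h => by
    have h2 : gauge a = 1 := ha.2
    rw [h, gauge_zero] at h2; norm_num at h2
  have hscale : ∀ p : Heis n, d a 0 * gauge p ≤ d p 0 ∧ d p 0 ≤ d b 0 * gauge p := by
    intro p
    by_cases hp : p = 0
    · simp [hp, hd.self]
    have hg := gauge_pos hp
    have hm : Heis.dil (gauge p)⁻¹ p ∈ K := by
      constructor <;> simp [gauge_dil (inv_pos.2 hg), inv_mul_cancel₀ hg.ne']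
    have e1 : d (Heis.dil (gauge p)⁻¹ p) 0 = d p 0 / gauge p := by
      rw [hd.dil_zero (inv_pos.2 hg), inv_mul_eq_div]
    have h1 := isMinOn_iff.1 hmin _ hm
    have h2 := isMaxOn_iff.1 hmax _ hm
    rw [e1] at h1 h2
    exact ⟨(le_div_iff₀ hg).1 h1, (div_le_iff₀ hg).1 h2⟩
  have hb0 : 0 ≤ d b 0 := hd.nonneg _ _
  refine ⟨(d a 0)⁻¹ + d b 0, by positivity, fun p => ⟨?_, ?_⟩⟩
  · have h1 : gauge p ≤ (d a 0)⁻¹ * d p 0 := by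
      rw [inv_mul_eq_div, le_div_iff₀ ha0, mul_comm]; exact (hscale p).1
    have := mul_nonneg hb0 (hd.nonneg p 0)
    linarith
  · have := mul_nonneg (inv_pos.2 ha0).le (gauge_nonneg p)
    linarith [(hscale p).2]

/-- On the horizontal layer the gauge is the Euclidean norm. -/
lemma exists_norm_le (hn : 0 < n) : ∃ C > 0, ∀ v ∈ H1 n, ‖v‖ ≤ C * d v 0 ∧ d v 0 ≤ C * ‖v‖ := by
  obtain ⟨C, hC, h⟩ := hd.exists_gauge_bounds hn
  refine ⟨C, hC, fun v hv => ?_⟩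
  have : gauge v = ‖v‖ := by simp [gauge, projH1_of_mem hv, mem_H1.1 hv]
  rw [← this]
  exact h v

/-- The topology of `d` is the Euclidean one. At the origin, the gauge has a positive minimum on the
compact set left after removing an open neighbourhood from its unit ball; left translations carry
this to `x`. -/
lemma comap_nhds (hn : 0 < n) (x : Heis n) : comap (fun y => d x y) (𝓝 0) = 𝓝 x := by
  apply le_antisymm
  · obtain ⟨C, hC, hg⟩ := hd.exists_gauge_bounds hn
    have h0 : comap (fun p : Heis n => d p 0) (𝓝 0) ≤ 𝓝 0 := by
      have hg0 : comap (gauge : Heis n → ℝ) (𝓝 0) ≤ 𝓝 0 := by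
        intro s hs
        obtain ⟨o, hos, ho, h0o⟩ := mem_nhds_iff.1 hs
        have hk : IsCompact ({p : Heis n | gauge p ≤ 1} \ o) := (isCompact_gauge_le 1).diff ho
        rcases ({p : Heis n | gauge p ≤ 1} \ o).eq_empty_or_nonempty with hemp | hne
        · refine ⟨Iio 1, Iio_mem_nhds one_pos, fun p hp => hos ?_⟩
          by_contra hpo
          have : p ∈ {p : Heis n | gauge p ≤ 1} \ o := ⟨(show gauge p < 1 from hp).le, hpo⟩
          rw [hemp] at this; exact this
        · obtain ⟨a, ha, hmin⟩ := hk.exists_isMinOn hne continuous_gauge.continuousOn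
          have ha0 : 0 < gauge a := gauge_pos fun h => ha.2 (h ▸ h0o)
          refine ⟨Iio (gauge a), Iio_mem_nhds ha0, fun p hp => hos ?_⟩
          by_contra hpo
          have hp' : gauge p < gauge a := hp
          have := isMinOn_iff.1 hmin p ⟨(hp'.trans_le ha.1).le, hpo⟩
          linarith
      refine le_trans ?_ hg0
      rw [← tendsto_iff_comap]
      refine squeeze_zero (fun p => gauge_nonneg p) (fun p => (hg p).1) ?_
      simpa using (tendsto_comap (f := fun p : Heis n => d p 0) (x := 𝓝 0)).const_mul C
    have h2 : Tendsto (fun y => x⁻¹ * y) (comap (fun y => d x y) (𝓝 0)) (𝓝 0) := by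
      refine Tendsto.mono_right ?_ h0
      rw [tendsto_comap_iff]
      refine (tendsto_comap (f := fun y => d x y) (x := 𝓝 0)).congr fun y => ?_
      simp [hd.eq_inv_mul x y]
    have h3 := ((continuous_const_mul x).tendsto 0).comp h2
    rw [← one_def, mul_one] at h3
    refine le_trans (le_of_eq ?_) h3
    conv_lhs => rw [← map_id (f := comap (fun y => d x y) (𝓝 0))]
    congr 1
    funext y
    simp
  · rw [← tendsto_iff_comap]
    have := (hd.continuous_right hn x).tendsto x
    rwa [hd.self] at this

lemma nhds_basis (hn : 0 < n) (x : Heis n) :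
    (𝓝 x).HasBasis (fun ε : ℝ => 0 < ε) fun ε => {y | d x y < ε} := by
  rw [← hd.comap_nhds hn x]
  have h := (nhds_basis_Ioo_pos (0 : ℝ)).comap fun y => d x y
  refine h.to_hasBasis (fun ε hε => ⟨ε, hε, fun y hy => ?_⟩) fun ε hε => ⟨ε, hε, fun y hy => ?_⟩
  · have := hd.nonneg x y
    have hy : d x y < ε := hy
    exact ⟨by linarith, by linarith⟩
  · have := hy.2
    simpa using this

lemma isOpen_ball (hn : 0 < n) (x : Heis n) (r : ℝ) : IsOpen {y | d x y < r} :=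
  isOpen_lt (hd.continuous_right hn x) continuous_const

lemma isClosed_cball (hn : 0 < n) (x : Heis n) (r : ℝ) : IsClosed (cball d x r) :=
  isClosed_le (hd.continuous_right hn x) continuous_const

lemma isCompact_cball (hn : 0 < n) (x : Heis n) (r : ℝ) : IsCompact (cball d x r) := by
  obtain ⟨C, hC, h⟩ := hd.exists_gauge_bounds hn
  have hk := (isCompact_gauge_le (n := n) (C * r)).image (continuous_const_mul x)
  refine hk.of_isClosed_subset (hd.isClosed_cball hn x r) fun y hy => ?_
  refine ⟨x⁻¹ * y, ?_, by simp⟩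
  have hy : d x y ≤ r := hy
  rw [hd.eq_inv_mul] at hy
  exact (h _).1.trans (mul_le_mul_of_nonneg_left hy hC.le)

lemma mem_cball_dil {t : ℝ} (ht : 0 < t) (x y : Heis n) (r : ℝ) :
    Heis.dil t y ∈ cball d (Heis.dil t x) (t * r) ↔ y ∈ cball d x r := by
  simp only [cball, mem_ofPred_eq, hd.dil t ht]
  exact mul_le_mul_iff_right₀ ht

/-- For horizontal `v` of length `r`, the points `x v` and `x v⁻¹` are at distance `2r`, because `d`
is additive along a horizontal line. -/
lemma diam_cball (hn : 0 < n) (x : Heis n) {r : ℝ} (hr : 0 < r) :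
    diam d (cball d x r) = ENNReal.ofReal (2 * r) := by
  apply le_antisymm
  · refine iSup₂_le fun a ha => iSup₂_le fun b hb => ENNReal.ofReal_le_ofReal ?_
    have h1 := hd.triangle a x b
    have ha : d x a ≤ r := ha
    have hb : d x b ≤ r := hb
    rw [hd.symm a x] at h1
    linarith
  · obtain ⟨v, hv, hv1⟩ : ∃ v ∈ H1 n, d v 0 = r := by
      have h0 : eX (⟨0, hn⟩ : Fin n) ≠ 0 := fun h => by
        simpa [eX] using congrArg (fun p : Heis n => p (Sum.inl ⟨0, hn⟩)) h
      have h1 := hd.pos h0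
      refine ⟨(r / d (eX ⟨0, hn⟩) 0) • eX ⟨0, hn⟩, smul_mem_H1 _ (eX_mem _), ?_⟩
      rw [hd.smul_le (eX_mem _), abs_of_pos (by positivity)]
      field_simp
    have hm1 : x * v ∈ cball d x r := by
      change d x (x * v) ≤ r
      rw [hd.mul_right, hv1]
    have hm2 : x * v⁻¹ ∈ cball d x r := by
      change d x (x * v⁻¹) ≤ r
      rw [hd.mul_right, hd.inv_zero, hv1]
    have h3 : d (x * v⁻¹) (x * v) = 2 * r := by
      rw [hd.left_inv, hd.eq_inv_mul, inv_inv, mul_of_omega_eq_zero (omega_self v), ← two_smul ℝ v,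
        hd.smul_le hv, hv1]
      norm_num
    rw [← h3]
    exact le_iSup₂_of_le _ hm2 (le_iSup₂_of_le _ hm1 le_rfl)

end IsHomDist

/-! ### Pansu differentiability of `C¹` functions -/

section Pansu

variable {F : Type*} [NormedAddCommGroup F] [NormedSpace ℝ F]

/-- The linear map `p ↦ ∑ pᵢ Xᵢ f(x)`, which is the Pansu differential of a `C¹` function. -/
noncomputable def horDiff (f : Heis n → F) (x : Heis n) : Heis n →ₗ[ℝ] F where
  toFun p := ∑ i, p (Sum.inl i) • horDeriv f (eX i) x +
    ∑ i, p (Sum.inr (Sum.inl i)) • horDeriv f (eY i) x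
  map_add' p q := by
    simp only [PiLp.add_apply, add_smul, Finset.sum_add_distrib]; abel
  map_smul' c p := by
    simp [mul_smul, Finset.smul_sum]

lemma horDiff_apply (f : Heis n → F) (x p : Heis n) : horDiff f x p =
    ∑ i, p (Sum.inl i) • horDeriv f (eX i) x +
      ∑ i, p (Sum.inr (Sum.inl i)) • horDeriv f (eY i) x := rfl

@[simp] lemma horDiff_e (f : Heis n → F) (x : Heis n) : horDiff f x (e n) = 0 := by
  simp [horDiff_apply, e]

lemma horDiff_of_mem_range (f : Heis n → F) (x : Heis n) {v : Heis n}
    (hv : v ∈ range (eX (n := n)) ∪ range eY) : horDiff f x v = horDeriv f v x := by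
  rcases hv with ⟨i, rfl⟩ | ⟨i, rfl⟩
  · rw [horDiff_apply, Finset.sum_eq_single i] <;> simp +contextual [eX]
  · rw [horDiff_apply, add_comm, Finset.sum_eq_single i] <;>
      simp +contextual [eY]

lemma map_mul_of_map_e {L : Heis n →ₗ[ℝ] F} (hL : L (e n) = 0) (p q : Heis n) :
    L (p * q) = L p + L q := by
  simp [mul_def, hL]

lemma map_inv' (L : Heis n →ₗ[ℝ] F) (p : Heis n) : L p⁻¹ = -L p := by
  rw [inv_def, map_neg]

lemma map_dil_of_map_e {L : Heis n →ₗ[ℝ] F} (hL : L (e n) = 0) (t : ℝ) (p : Heis n) :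
    L (dil t p) = t • L p := by
  simp [dil_eq, hL]

/-- `f` is strictly Pansu differentiable at `x`, with differential `L`. -/
def IsStrictPansu (d : Heis n → Heis n → ℝ) (f : Heis n → F) (x : Heis n) (L : Heis n →ₗ[ℝ] F) :
    Prop :=
  L (e n) = 0 ∧ ∀ ε > 0, ∃ δ > 0, ∀ y, d x y < δ → ∀ m, d m 0 < δ →
    ‖f (y * m) - f y - L m‖ ≤ ε * d m 0

lemma smul_mul_smul_self (s t : ℝ) (v : Heis n) : (s • v) * (t • v) = (s + t) • v := by
  rw [mul_of_omega_eq_zero (by simp [omega_smul_left, omega_smul_right]), add_smul]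

/-- Mean value inequality for `s ↦ f (y (s v)) - s X_v f(x)`, whose derivative is the oscillation of
`X_v f` between `y (s v)` and `x`. -/
lemma norm_sub_horDeriv_le {f : Heis n → F} {v x y : Heis n} {c η : ℝ}
    (hdiff : ∀ s : ℝ, |s| ≤ |c| →
      DifferentiableAt ℝ (fun t : ℝ => f (y * (s • v) * (t • v))) 0)
    (hη : ∀ s : ℝ, |s| ≤ |c| → ‖horDeriv f v (y * (s • v)) - horDeriv f v x‖ ≤ η) :
    ‖f (y * (c • v)) - f y - c • horDeriv f v x‖ ≤ η * |c| := by
  have hs : ∀ s ∈ uIcc 0 c, |s| ≤ |c| := fun s hs => by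
    have := abs_sub_left_of_mem_uIcc hs
    simpa using this
  have h := Convex.norm_image_sub_le_of_norm_hasDerivWithin_le (𝕜 := ℝ) (s := uIcc 0 c)
    (f := fun s : ℝ => f (y * (s • v)) - s • horDeriv f v x)
    (f' := fun s => horDeriv f v (y * (s • v)) - horDeriv f v x) (C := η) (x := 0) (y := c)
    (fun s hsc => ?_) (fun s hsc => hη s (hs s hsc)) (convex_uIcc 0 c) left_mem_uIcc right_mem_uIcc
  · have e0 : y * (0 : Heis n) = y := by rw [← one_def, mul_one]
    simpa [e0, sub_right_comm] using h
  · refine HasDerivAt.hasDerivWithinAt (HasDerivAt.sub ?_ ?_)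
    · have h1 := (hdiff s (hs s hsc)).hasDerivAt
      have h2 : HasDerivAt (fun t : ℝ => f (y * (s • v) * ((t - s) • v)))
          (horDeriv f v (y * (s • v))) s := by
        have h1' : HasDerivAt (fun t : ℝ => f (y * (s • v) * (t • v)))
          (horDeriv f v (y * (s • v))) (s - s) := by rw [sub_self]; exact h1
        exact h1'.comp_sub_const s s
      refine h2.congr_of_eventuallyEq (Eventually.of_forall fun t => ?_)
      simp only
      rw [mul_assoc, smul_mul_smul_self]
      simp
    · simpa using (hasDerivAt_id s).smul_const (horDeriv f v x)

variable {d : Heis n → Heis n → ℝ} {f : Heis n → F} {Ω : Set (Heis n)}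

/-- The displacement is split into horizontal pieces by `horizontal_induction`. Errors add up under
products because `horDiff` is a homomorphism, and each single piece is handled by
`norm_sub_horDeriv_le` and the continuity of `X_v f`. -/
lemma IsC1h.isStrictPansu (hn : 0 < n) (hd : IsHomDist d) (hΩ : IsOpen Ω) (hf : IsC1h Ω f)
    {x : Heis n} (hx : x ∈ Ω) : IsStrictPansu d f x (horDiff f x) := by
  refine ⟨horDiff_e f x, ?_⟩
  obtain ⟨C, hC, hg⟩ := hd.exists_gauge_bounds hn
  -- The linear bound on `g` is carried along so that the intermediate point `y * g m`, from which
  -- the next piece starts, stays near `x`.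
  have hind := horizontal_induction hn (C := fun g => (∃ K ≥ 0, ∀ p, d (g p) 0 ≤ K * d p 0) ∧
    ∀ ε > 0, ∃ δ > 0, ∀ y, d x y < δ → ∀ m, d m 0 < δ →
      ‖f (y * g m) - f y - horDiff f x (g m)‖ ≤ ε * d m 0) ?_ ?_
  · exact hind.2
  · rintro g h ⟨⟨K, hK, hgK⟩, hg⟩ ⟨⟨K', hK', hhK⟩, hh⟩
    refine ⟨⟨K + K', by positivity, fun p => (hd.mul_le _ _).trans ?_⟩, fun ε hε => ?_⟩
    · linarith [hgK p, hhK p]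
    · obtain ⟨δ₁, h₁, H₁⟩ := hg (ε / 2) (by positivity)
      obtain ⟨δ₂, h₂, H₂⟩ := hh (ε / 2) (by positivity)
      refine ⟨min δ₁ (min (δ₂ / 2) (δ₂ / (2 * (K + 1)))), by positivity, fun y hy m hm => ?_⟩
      simp only [lt_min_iff] at hy hm
      have hy' : d x (y * g m) < δ₂ := by
        have h3 := hd.triangle x y (y * g m)
        rw [hd.mul_right] at h3
        have h4 := hm.2.2
        rw [lt_div_iff₀ (by positivity)] at h4
        nlinarith [hgK m, hd.nonneg m 0]
      have hm₂ : d m 0 < δ₂ := by linarith [hm.2.1]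
      have a1 := H₁ y hy.1 m hm.1
      have a2 := H₂ _ hy' m hm₂
      rw [map_mul_of_map_e (horDiff_e f x), ← mul_assoc]
      have : f (y * g m * h m) - f y - (horDiff f x (g m) + horDiff f x (h m)) =
        (f (y * g m * h m) - f (y * g m) - horDiff f x (h m)) +
          (f (y * g m) - f y - horDiff f x (g m)) := by abel
      rw [this]
      refine (norm_add_le _ _).trans ?_
      linarith
  · intro c K hc v hv
    have hv1 := mem_H1_of_mem_range hv
    have hc' : ∀ p, |c p| ≤ |K| * C * d p 0 := fun p => by
      refine (hc p).trans ?_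
      rw [mul_assoc]
      exact mul_le_mul (le_abs_self K) (hg p).1 (gauge_nonneg p) (abs_nonneg K)
    refine ⟨⟨|K| * C * d v 0, mul_nonneg (by positivity) (hd.nonneg _ _), fun p => ?_⟩,
      fun ε hε => ?_⟩
    · rw [hd.smul_le hv1, mul_right_comm]
      exact mul_le_mul_of_nonneg_right (hc' p) (hd.nonneg _ _)
    · set M := |K| * C with hM
      have hM0 : 0 ≤ M := by positivity
      set η := ε / (M + 1) with hη
      have hη0 : 0 < η := by positivity
      have hcont : ∀ᶠ y in 𝓝 x, y ∈ Ω ∧ ‖horDeriv f v y - horDeriv f v x‖ < η := by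
        refine (hΩ.eventually_mem hx).and ?_
        have := ((hf v hv1).2.continuousAt (hΩ.mem_nhds hx)).eventually
          (Metric.ball_mem_nhds _ hη0)
        simpa [dist_eq_norm] using this
      obtain ⟨δ, hδ, H⟩ := (hd.nhds_basis hn x).eventually_iff.1 hcont
      have hv0 := hd.nonneg v 0
      refine ⟨min (δ / 2) (δ / (2 * (M * d v 0 + 1))), by positivity, fun y hy m hm => ?_⟩
      simp only [lt_min_iff] at hy hm
      have hin : ∀ s : ℝ, |s| ≤ |c m| → d x (y * (s • v)) < δ := fun s hs => by
        have h3 := hd.triangle x y (y * (s • v))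
        rw [hd.mul_right, hd.smul_le hv1] at h3
        have h4 := hm.2
        rw [lt_div_iff₀ (by positivity)] at h4
        have h5 : |s| * d v 0 ≤ M * d m 0 * d v 0 :=
          mul_le_mul_of_nonneg_right (hs.trans (hc' m)) hv0
        nlinarith [hd.nonneg m 0]
      rw [map_smul, horDiff_of_mem_range f x hv]
      refine (norm_sub_horDeriv_le (fun s hs => (hf v hv1).1 _ (H (hin s hs)).1)
        fun s hs => (H (hin s hs)).2.le).trans ?_
      calc η * |c m| ≤ η * (M * d m 0) := mul_le_mul_of_nonneg_left (hc' m) hη0.le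
        _ ≤ η * ((M + 1) * d m 0) := by
          have := hd.nonneg m 0
          gcongr; linarith
        _ = ε * d m 0 := by rw [hη]; field_simp

namespace IsStrictPansu

variable {x : Heis n} {L : Heis n →ₗ[ℝ] F}

lemma exists_le (h : IsStrictPansu d f x L) {ε : ℝ} (hε : 0 < ε) :
    ∃ δ > 0, ∀ p q, d x p < δ → d (p⁻¹ * q) 0 < δ →
      ‖f q - f p - L (p⁻¹ * q)‖ ≤ ε * d (p⁻¹ * q) 0 := by
  obtain ⟨δ, hδ, H⟩ := h.2 ε hε
  refine ⟨δ, hδ, fun p q hp hq => ?_⟩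
  simpa using H p hp (p⁻¹ * q) hq

lemma continuousAt (hn : 0 < n) (hd : IsHomDist d) (h : IsStrictPansu d f x L) :
    ContinuousAt f x := by
  obtain ⟨δ, hδ, H⟩ := h.exists_le one_pos
  rw [ContinuousAt, tendsto_iff_norm_sub_tendsto_zero]
  have h1 : Tendsto (fun y => ‖L (x⁻¹ * y)‖ + 1 * d (x⁻¹ * y) 0) (𝓝 x) (𝓝 0) := by
    have hc : Continuous fun y => ‖L (x⁻¹ * y)‖ + 1 * d (x⁻¹ * y) 0 :=
      ((LinearMap.continuous_of_finiteDimensional L).comp (continuous_const_mul x⁻¹)).norm.add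
        (((hd.continuous_left hn 0).comp (continuous_const_mul x⁻¹)).const_mul 1)
    have := hc.tendsto x
    rw [inv_mul_cancel, one_def] at this
    simpa [hd.self] using this
  refine squeeze_zero' (Eventually.of_forall fun _ => norm_nonneg _) ?_ h1
  filter_upwards [(hd.nhds_basis hn x).mem_of_mem hδ] with y hy
  have hy' : d x y < δ := hy
  have := H x y (by rwa [hd.self]) (by rwa [← hd.eq_inv_mul])
  calc ‖f y - f x‖ = ‖L (x⁻¹ * y) + (f y - f x - L (x⁻¹ * y))‖ := by congr 1; abel
    _ ≤ _ := (norm_add_le _ _).trans (by gcongr)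

lemma isPansuDiff (hd : IsHomDist d) (h : IsStrictPansu d f x L) : IsPansuDiff d f x L := by
  refine ⟨fun t _ w => map_dil_of_map_e h.1 t w, ?_⟩
  rw [Asymptotics.isLittleO_iff]
  intro ε hε
  obtain ⟨δ, hδ, H⟩ := h.2 ε hε
  refine ⟨Iio δ, Iio_mem_nhds hδ, fun m hm => ?_⟩
  have := H x (by rwa [hd.self]) m hm
  change ‖f (x * m) - f x - L m‖ ≤ ε * ‖d m 0‖
  rwa [Real.norm_of_nonneg (hd.nonneg _ _)]

end IsStrictPansu

/-- Along `δ_t w` the difference of two differentials is both `o(t)` and linear in `t`. Uniqueness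
is what gives access to `pansuDiff`, which is an arbitrary choice among differentials. -/
lemma IsPansuDiff.unique (hd : IsHomDist d) {x : Heis n} {L L' : Heis n →ₗ[ℝ] F}
    (h : IsPansuDiff d f x L) (h' : IsPansuDiff d f x L') : L = L' := by
  have ho := h'.2.sub h.2
  rw [Asymptotics.isLittleO_iff] at ho
  ext1 w
  rw [← sub_eq_zero, ← norm_eq_zero]
  by_contra hne
  have hpos : 0 < ‖L w - L' w‖ := lt_of_le_of_ne (norm_nonneg _) (Ne.symm hne)
  have hw0 := hd.nonneg w 0
  have hε : 0 < ‖L w - L' w‖ / (2 * (d w 0 + 1)) := by positivity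
  obtain ⟨s, hs, hsub⟩ := ho hε
  obtain ⟨δ, hδ, hδs⟩ := Metric.mem_nhds_iff.1 hs
  set t := δ / (2 * (d w 0 + 1)) with ht
  have ht0 : 0 < t := by positivity
  have hmem : dil t w ∈ (fun w => d w 0) ⁻¹' s := by
    apply hδs
    rw [mem_ball_zero_iff, Real.norm_of_nonneg (hd.nonneg _ _), hd.dil_zero ht0, ht, div_mul_eq_mul_div,
      div_lt_iff₀ (by positivity)]
    nlinarith
  have hle := hsub hmem
  simp only [mem_ofPred_eq] at hle
  have e1 : f (x * dil t w) - f x - L' (dil t w) - (f (x * dil t w) - f x - L (dil t w)) =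
      t • (L w - L' w) := by
    rw [h.1 t ht0, h'.1 t ht0, smul_sub]; abel
  rw [e1, norm_smul, Real.norm_of_nonneg ht0.le, Real.norm_of_nonneg (hd.nonneg _ _),
    hd.dil_zero ht0, mul_left_comm, mul_le_mul_iff_right₀ ht0, div_mul_eq_mul_div,
    le_div_iff₀ (by positivity)] at hle
  nlinarith

lemma IsStrictPansu.pansuDiff_eq (hd : IsHomDist d) {x : Heis n} {L : Heis n →ₗ[ℝ] F}
    (h : IsStrictPansu d f x L) : pansuDiff d f x = L :=
  IsPansuDiff.unique hd (Classical.epsilon_spec (p := IsPansuDiff d f x) ⟨L, h.isPansuDiff hd⟩)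
    (h.isPansuDiff hd)

lemma IsC1h.continuousOn_horDiff (hf : IsC1h Ω f) (p : Heis n) :
    ContinuousOn (fun x => horDiff f x p) Ω := by
  simp only [horDiff_apply]
  refine ContinuousOn.add (continuousOn_finsetSum _ fun i _ => ?_)
    (continuousOn_finsetSum _ fun i _ => ?_)
  · exact continuousOn_const.smul (hf _ (eX_mem i)).2
  · exact continuousOn_const.smul (hf _ (eY_mem i)).2

lemma IsC1h.mono {Ω' : Set (Heis n)} (hf : IsC1h Ω f) (h : Ω' ⊆ Ω) : IsC1h Ω' f :=
  fun v hv => ⟨fun x hx => (hf v hv).1 x (h hx), (hf v hv).2.mono h⟩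

lemma IsC1h.sub_const (hf : IsC1h Ω f) (c : F) : IsC1h Ω fun x => f x - c := by
  intro v hv
  refine ⟨fun x hx => ((hf v hv).1 x hx).sub_const c, (hf v hv).2.congr fun x _ => ?_⟩
  simp [horDeriv]

lemma IsStrictPansu.sub_const {x : Heis n} {L : Heis n →ₗ[ℝ] F} (h : IsStrictPansu d f x L)
    (c : F) : IsStrictPansu d (fun x => f x - c) x L := by
  refine ⟨h.1, fun ε hε => ?_⟩
  simpa using h.2 ε hε

end Pansu

/-! ### Jacobians -/

section Jacobian

variable {k : ℕ} {d : Heis n → Heis n → ℝ} {f : Heis n → EuclideanSpace ℝ (Fin k)}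
  {x : Heis n} {L : Heis n →ₗ[ℝ] EuclideanSpace ℝ (Fin k)}

/-- The `i`-th component of a linear map to `ℝᵏ`. -/
noncomputable def comp (L : Heis n →ₗ[ℝ] EuclideanSpace ℝ (Fin k)) (i : Fin k) : Heis n →ₗ[ℝ] ℝ :=
  (EuclideanSpace.proj i : EuclideanSpace ℝ (Fin k) →L[ℝ] ℝ).toLinearMap ∘ₗ L

@[simp] lemma comp_apply (i : Fin k) (p : Heis n) : comp L i p = L p i := rfl

lemma IsStrictPansu.comp (h : IsStrictPansu d f x L) (i : Fin k) :
    IsStrictPansu d (fun y => f y i) x (comp L i) := by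
  refine ⟨by simp [h.1], fun ε hε => ?_⟩
  obtain ⟨δ, hδ, H⟩ := h.2 ε hε
  refine ⟨δ, hδ, fun y hy m hm => le_trans ?_ (H y hy m hm)⟩
  exact PiLp.norm_apply_le (f (y * m) - f y - L m) i

/-- The Riesz vector of a component of `L` is horizontal because `L` kills `e n`; so the choice in
`gradH` is not vacuous. -/
lemma inner_gradH (hd : IsHomDist d) (h : IsStrictPansu d f x L) (i : Fin k) (y : Heis n) :
    inner ℝ (gradH d (fun y => f y i) x) y = L y i := by
  have hex : ∃ u, u ∈ H1 n ∧ ∀ y, pansuDiff d (fun y => f y i) x y = inner ℝ u y := by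
    rw [(h.comp i).pansuDiff_eq hd]
    have hu : ∀ y, Heis.comp L i y = inner ℝ ((InnerProductSpace.toDual ℝ (Heis n)).symm
        (LinearMap.toContinuousLinearMap (Heis.comp L i))) y := fun y => by
      rw [InnerProductSpace.toDual_symm_apply]; rfl
    refine ⟨_, ?_, hu⟩
    have he := hu (e n)
    rw [comp_apply, h.1, e, EuclideanSpace.inner_single_right] at he
    rw [mem_H1]
    simpa [z] using he.symm
  have : pansuDiff d (fun y => f y i) x y = inner ℝ (gradH d (fun y => f y i) x) y :=
    (Classical.epsilon_spec hex).2 y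
  rw [(h.comp i).pansuDiff_eq hd] at this
  exact this.symm

lemma wedgeNorm_eq_gram {ι : Type*} [Fintype ι] [DecidableEq ι] (u : ι → Heis n) :
    wedgeNorm u = Real.sqrt (Matrix.gram ℝ u).det := rfl

lemma gram_det_nonneg {ι : Type*} [Fintype ι] [DecidableEq ι] (u : ι → Heis n) :
    0 ≤ (Matrix.gram ℝ u).det := (Matrix.posSemidef_gram ℝ u).det_nonneg

/-- Writing the Gram matrix in coordinates makes the Jacobian a continuous expression in the values
of `L`. -/
lemma jacH_eq (hd : IsHomDist d) (h : IsStrictPansu d f x L) :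
    jacH d f x = Real.sqrt (Matrix.det (Matrix.of fun i j : Fin k =>
      ∑ c, L (EuclideanSpace.single c 1) i * L (EuclideanSpace.single c 1) j)) := by
  rw [jacH, wedgeNorm]
  congr 3
  ext i j
  simp only [← inner_gradH hd h, PiLp.inner_apply]
  refine Finset.sum_congr rfl fun c _ => ?_
  simp [mul_comm]

/-- Pairing a linear relation among the gradients with a preimage of the `i`-th basis vector
isolates its `i`-th coefficient. -/
lemma jacH_pos (hd : IsHomDist d) (h : IsStrictPansu d f x L) (hL : Function.Surjective L) :
    0 < jacH d f x := by
  rw [jacH, wedgeNorm_eq_gram, Real.sqrt_pos]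
  refine (Matrix.posDef_gram_iff_linearIndependent.2 ?_).det_pos
  rw [Fintype.linearIndependent_iff]
  intro c hc i
  obtain ⟨y, hy⟩ := hL (EuclideanSpace.single i 1)
  have := congrArg (fun u => inner ℝ u y) hc
  simp only [sum_inner, inner_smul_left, inner_gradH hd h, hy] at this
  simpa [Pi.single_apply] using this

variable {V : Subgroup (Heis n)} {v : Fin k → Heis n}

lemma inner_gradV (hd : IsHomDist d) (h : IsStrictPansu d f x L) (hv : Orthonormal ℝ v)
    (hvV : (Submodule.span ℝ (Set.range v) : Set (Heis n)) = V) (i : Fin k) :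
    gradV d V (fun y => f y i) x = ∑ j, L (v j) i • v j := by
  have hmem : ∀ y, y ∈ V ↔ y ∈ Submodule.span ℝ (Set.range v) := fun y => by
    rw [← SetLike.mem_coe, ← hvV, SetLike.mem_coe]
  set u := ∑ j, L (v j) i • v j with hu
  have huV : u ∈ Submodule.span ℝ (Set.range v) :=
    Submodule.sum_mem _ fun j _ => Submodule.smul_mem _ _ (Submodule.subset_span ⟨j, rfl⟩)
  have hinner : ∀ y ∈ Submodule.span ℝ (Set.range v), L y i = inner ℝ u y := by
    intro y hy
    induction hy using Submodule.span_induction with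
    | mem y hy =>
      obtain ⟨j, rfl⟩ := hy
      rw [hu, hv.inner_left_fintype]; simp
    | zero => simp
    | add a b _ _ ha hb => simp [inner_add_right, ← ha, ← hb]
    | smul c a _ ha => simp [inner_smul_right, ← ha]
  have hex : ∃ u, u ∈ V ∧ ∀ y ∈ V, pansuDiff d (fun y => f y i) x y = inner ℝ u y := by
    rw [(h.comp i).pansuDiff_eq hd]
    exact ⟨u, (hmem u).2 huV, fun y hy => hinner y ((hmem y).1 hy)⟩
  set g := gradV d V (fun y => f y i) x with hg
  have hsp : g ∈ V ∧ ∀ y ∈ V, pansuDiff d (fun y => f y i) x y = inner ℝ g y :=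
    Classical.epsilon_spec hex
  rw [(h.comp i).pansuDiff_eq hd] at hsp
  have hgu : g - u ∈ Submodule.span ℝ (Set.range v) :=
    Submodule.sub_mem _ ((hmem g).1 hsp.1) huV
  rw [← sub_eq_zero, ← inner_self_eq_zero (𝕜 := ℝ), inner_sub_left, ← hinner _ hgu,
    ← hsp.2 _ ((hmem _).2 hgu), comp_apply, sub_self]

/-- In the orthonormal basis `v` the gradients along `V` are the rows of the matrix `A` of `L` on
`V`, so their Gram matrix is `A Aᵀ`. -/
lemma jacV_eq (hd : IsHomDist d) (h : IsStrictPansu d f x L) (hv : Orthonormal ℝ v)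
    (hvV : (Submodule.span ℝ (Set.range v) : Set (Heis n)) = V) :
    jacV d V f x = |Matrix.det (Matrix.of fun i j : Fin k => L (v j) i)| := by
  have hsq : ∀ A : Matrix (Fin k) (Fin k) ℝ, A.det ^ 2 = (A * A.transpose).det := fun A => by
    rw [Matrix.det_mul, Matrix.det_transpose, sq]
  rw [jacV, wedgeNorm, ← Real.sqrt_sq_eq_abs, hsq]
  congr 2
  ext i j
  simp only [inner_gradV hd h hv hvV, Matrix.of_apply, Matrix.mul_apply, Matrix.transpose_apply]
  rw [hv.inner_sum]
  simp

variable {Ω : Set (Heis n)}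

lemma IsC1h.continuousOn_horDiff_apply (hf : IsC1h Ω f) (p : Heis n) (i : Fin k) :
    ContinuousOn (fun x => horDiff f x p i) Ω :=
  (EuclideanSpace.proj i : EuclideanSpace ℝ (Fin k) →L[ℝ] ℝ).continuous.comp_continuousOn
    (hf.continuousOn_horDiff p)

lemma IsC1h.continuousOn_jacH (hn : 0 < n) (hd : IsHomDist d) (hΩ : IsOpen Ω) (hf : IsC1h Ω f) :
    ContinuousOn (jacH d f) Ω := by
  refine ContinuousOn.congr ?_ fun x hx => jacH_eq hd (hf.isStrictPansu hn hd hΩ hx)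
  refine Real.continuous_sqrt.comp_continuousOn (Continuous.comp_continuousOn
    (g := fun A : Matrix (Fin k) (Fin k) ℝ => A.det) (by fun_prop) ?_)
  refine continuousOn_pi.2 fun i => continuousOn_pi.2 fun j => ?_
  simp only [Matrix.of_apply]
  exact continuousOn_finsetSum _ fun c _ =>
    (hf.continuousOn_horDiff_apply _ i).mul (hf.continuousOn_horDiff_apply _ j)

lemma IsC1h.continuousOn_jacV (hn : 0 < n) (hd : IsHomDist d) (hΩ : IsOpen Ω) (hf : IsC1h Ω f)
    (hv : Orthonormal ℝ v) (hvV : (Submodule.span ℝ (Set.range v) : Set (Heis n)) = V) :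
    ContinuousOn (jacV d V f) Ω := by
  refine ContinuousOn.congr ?_ fun x hx => jacV_eq hd (hf.isStrictPansu hn hd hΩ hx) hv hvV
  refine continuous_abs.comp_continuousOn (Continuous.comp_continuousOn
    (g := fun A : Matrix (Fin k) (Fin k) ℝ => A.det) (by fun_prop) ?_)
  refine continuousOn_pi.2 fun i => continuousOn_pi.2 fun j => ?_
  exact hf.continuousOn_horDiff_apply _ i

/-- Where `J_V f ≠ 0`, the differential restricted to `V` is invertible. -/
lemma exists_inverse_of_jacV_pos (hd : IsHomDist d) (h : IsStrictPansu d f x L)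
    (hv : Orthonormal ℝ v) (hvV : (Submodule.span ℝ (Set.range v) : Set (Heis n)) = V)
    (hJ : 0 < jacV d V f x) :
    ∃ B : EuclideanSpace ℝ (Fin k) →ₗ[ℝ] Heis n, (∀ y, B y ∈ V) ∧ (∀ y, L (B y) = y) ∧
      ∀ u ∈ V, B (L u) = u := by
  have hmem : ∀ y, y ∈ V ↔ y ∈ Submodule.span ℝ (Set.range v) := fun y => by
    rw [← SetLike.mem_coe, ← hvV, SetLike.mem_coe]
  set A : Matrix (Fin k) (Fin k) ℝ := Matrix.of fun i j => L (v j) i with hA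
  have hdet : IsUnit A.det := by
    rw [jacV_eq hd h hv hvV, abs_pos] at hJ
    exact hJ.isUnit
  let T : EuclideanSpace ℝ (Fin k) →ₗ[ℝ] Heis n :=
    { toFun := fun y => ∑ j, y j • v j
      map_add' := fun a b => by simp [add_smul, Finset.sum_add_distrib]
      map_smul' := fun c a => by simp [mul_smul, Finset.smul_sum] }
  have hLT : ∀ y, L (T y) = Matrix.toEuclideanLin A y := fun y => by
    ext i
    simp [T, Matrix.toLpLin_apply, Matrix.mulVec, dotProduct, hA, mul_comm]
  let B := T ∘ₗ Matrix.toEuclideanLin A⁻¹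
  have hLB : ∀ y, L (B y) = y := fun y => by
    change L (T _) = y
    rw [hLT]
    simp [Matrix.toLpLin_apply, Matrix.mulVec_mulVec, Matrix.mul_nonsing_inv _ hdet]
  have hBL : ∀ y, B (L (T y)) = T y := fun y => by
    rw [hLT]
    change T _ = T y
    simp [Matrix.toLpLin_apply, Matrix.mulVec_mulVec, Matrix.nonsing_inv_mul _ hdet]
  refine ⟨B, fun y => (hmem _).2 ?_, hLB, fun u hu => ?_⟩
  · change ∑ j, _ • v j ∈ _
    exact Submodule.sum_mem _ fun j _ => Submodule.smul_mem _ _ (Submodule.subset_span ⟨j, rfl⟩)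
  · obtain ⟨c, rfl⟩ := (Submodule.mem_span_range_iff_exists_fun ℝ).1 ((hmem u).1 hu)
    exact hBL (WithLp.toLp 2 c)

end Jacobian

/-! ### Linear splittings -/

/-- `Q` is the linear projection of a semidirect factorization onto the horizontal factor. -/
structure IsSplit (W V : Subgroup (Heis n)) (Q : Heis n →ₗ[ℝ] Heis n) : Prop where
  horizontal : ∀ v ∈ V, v ∈ H1 n
  map_e : Q (e n) = 0
  mem_W : ∀ x, x ∈ W ↔ Q x = 0
  mem_V : ∀ x, x ∈ V ↔ Q x = x
  proj : ∀ x, Q (Q x) = Q x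

/-- Since `w v` and `w + v` differ by a multiple of `e n ∈ W`, the group factorization is also a
linear one; `π_V` is then the linear projection onto `V` along `W`. -/
lemma exists_isSplit {W V : Subgroup (Heis n)} (hWV : IsSemidirect W V)
    (W' V' : Submodule ℝ (Heis n)) (hW : (W' : Set (Heis n)) = W) (hV : (V' : Set (Heis n)) = V) :
    ∃ Q, IsSplit W V Q := by
  have hmW : ∀ y, y ∈ W ↔ y ∈ W' := fun y => by rw [← SetLike.mem_coe, ← hW, SetLike.mem_coe]
  have hmV : ∀ y, y ∈ V ↔ y ∈ V' := fun y => by rw [← SetLike.mem_coe, ← hV, SetLike.mem_coe]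
  have he : e n ∈ W' := (hmW _).1 (hWV.vertical.2 (by simp [H2, projH1]))
  have hc : IsCompl V' W' := by
    refine IsCompl.of_le (fun x hx => ?_) fun x _ => ?_
    · have hx' : x ∈ W ⊓ V := ⟨(hmW x).2 hx.2, (hmV x).2 hx.1⟩
      rw [hWV.inf_eq, Subgroup.mem_bot] at hx'
      exact hx'
    · obtain ⟨w, hw, v, hv, rfl⟩ := hWV.mul_eq x
      rw [mul_def]
      refine Submodule.add_mem _ (Submodule.add_mem _ ?_ ?_) ?_
      · exact Submodule.mem_sup_right ((hmW w).1 hw)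
      · exact Submodule.mem_sup_left ((hmV v).1 hv)
      · exact Submodule.mem_sup_right (Submodule.smul_mem _ _ he)
  refine ⟨V'.projection W' hc, fun v hv => hWV.horizontal.2 hv, ?_, fun x => ?_, fun x => ?_,
    fun x => ?_⟩
  · exact (Submodule.projection_apply_eq_zero_iff hc).2 he
  · rw [hmW, Submodule.projection_apply_eq_zero_iff hc]
  · rw [hmV, Submodule.projection_eq_self_iff hc]
  · rw [Submodule.projection_eq_self_iff hc]
    exact Submodule.projection_apply_mem hc x

namespace IsSplit

variable {W V : Subgroup (Heis n)} {Q : Heis n →ₗ[ℝ] Heis n} (hQ : IsSplit W V Q)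
include hQ

lemma Q_mem (x : Heis n) : Q x ∈ V := (hQ.mem_V _).2 (hQ.proj x)

lemma Q_mul (p q : Heis n) : Q (p * q) = Q p + Q q := map_mul_of_map_e hQ.map_e p q

lemma Q_W {w : Heis n} (hw : w ∈ W) : Q w = 0 := (hQ.mem_W w).1 hw

lemma Q_V {v : Heis n} (hv : v ∈ V) : Q v = v := (hQ.mem_V v).1 hv

lemma mul_inv_mem (x : Heis n) : x * (Q x)⁻¹ ∈ W := by
  rw [hQ.mem_W, hQ.Q_mul, map_inv', hQ.proj, add_neg_cancel]

lemma add_mem {p q : Heis n} (hp : p ∈ V) (hq : q ∈ V) : p + q ∈ V := by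
  rw [hQ.mem_V, map_add, hQ.Q_V hp, hQ.Q_V hq]

/-- A horizontal subgroup is isotropic: the vertical coordinate `ω(p, q) / 2` of a product must
vanish. -/
lemma omega_eq_zero {p q : Heis n} (hp : p ∈ V) (hq : q ∈ V) : omega p q = 0 := by
  have h1 := mem_H1.1 (hQ.horizontal _ (V.mul_mem hp hq))
  rw [mul_def, z_add, z_add, z_smul, z_e, mem_H1.1 (hQ.horizontal p hp),
    mem_H1.1 (hQ.horizontal q hq)] at h1
  linarith

lemma mul_eq_add {p q : Heis n} (hp : p ∈ V) (hq : q ∈ V) : p * q = p + q :=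
  mul_of_omega_eq_zero (hQ.omega_eq_zero hp hq)

lemma inv_mul_eq_sub {p q : Heis n} (hp : p ∈ V) (hq : q ∈ V) : p⁻¹ * q = q - p := by
  rw [hQ.mul_eq_add (V.inv_mem hp) hq, inv_def]; abel

lemma piV_eq (x : Heis n) : piV W V x = Q x := by
  have hex : ∃ v, v ∈ V ∧ ∃ w ∈ W, x = w * v :=
    ⟨Q x, hQ.Q_mem x, _, hQ.mul_inv_mem x, by simp⟩
  obtain ⟨hv, w, hw, hx⟩ := Classical.epsilon_spec hex
  change piV W V x ∈ V at hv
  change x = w * piV W V x at hx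
  have := congrArg Q hx
  rw [hQ.Q_mul, hQ.Q_W hw, zero_add, hQ.Q_V hv] at this
  exact this.symm

end IsSplit

/-! ### Level sets of strictly Pansu differentiable maps -/

section LevelSet

variable {W V : Subgroup (Heis n)} {Q : Heis n →ₗ[ℝ] Heis n} {d : Heis n → Heis n → ℝ} {k : ℕ}
  {f : Heis n → EuclideanSpace ℝ (Fin k)} {x : Heis n} {L : Heis n →ₗ[ℝ] EuclideanSpace ℝ (Fin k)}
  {B : EuclideanSpace ℝ (Fin k) →ₗ[ℝ] Heis n}

lemma exists_dist_le_norm (hn : 0 < n) (hd : IsHomDist d) (hB : ∀ y, B y ∈ H1 n) :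
    ∃ K > 0, ∀ y, d (B y) 0 ≤ K * ‖y‖ := by
  obtain ⟨C, hC, h⟩ := hd.exists_norm_le hn
  refine ⟨C * (‖LinearMap.toContinuousLinearMap B‖ + 1), by positivity, fun y => ?_⟩
  refine (h _ (hB y)).2.trans ?_
  rw [mul_assoc]
  refine mul_le_mul_of_nonneg_left ?_ hC.le
  refine ((LinearMap.toContinuousLinearMap B).le_opNorm y).trans ?_
  gcongr; linarith

lemma exists_norm_le_dist (hn : 0 < n) (hd : IsHomDist d) (hL : L (e n) = 0) :
    ∃ K > 0, ∀ p, ‖L p‖ ≤ K * d p 0 := by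
  obtain ⟨C, hC, h⟩ := hd.exists_gauge_bounds hn
  refine ⟨(‖LinearMap.toContinuousLinearMap L‖ + 1) * C, by positivity, fun p => ?_⟩
  have h1 : L p = L (projH1 p) := by simp [projH1, hL]
  have h2 : ‖projH1 p‖ ≤ gauge p := le_add_of_nonneg_right (Real.sqrt_nonneg _)
  rw [h1, mul_assoc]
  refine ((LinearMap.toContinuousLinearMap L).le_opNorm _).trans ?_
  exact mul_le_mul (by linarith) (h2.trans (h p).1) (norm_nonneg _) (by positivity)

/-- `B ∘ L`, the linearized defect of a displacement along a level set, is small. -/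
lemma IsStrictPansu.exists_defect_le (hn : 0 < n) (hd : IsHomDist d) (h : IsStrictPansu d f x L)
    (hB : ∀ y, B y ∈ H1 n) {ε : ℝ} (hε : 0 < ε) :
    ∃ δ > 0, ∀ p q, d x p < δ → d (p⁻¹ * q) 0 < δ → f p = f q →
      d (B (L (p⁻¹ * q))) 0 ≤ ε * d (p⁻¹ * q) 0 := by
  obtain ⟨K, hK, hBK⟩ := exists_dist_le_norm hn hd hB
  obtain ⟨δ, hδ, H⟩ := h.exists_le (div_pos hε hK)
  refine ⟨δ, hδ, fun p q hp hq hpq => (hBK _).trans ?_⟩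
  have := H p q hp hq
  rw [hpq, sub_self, zero_sub, norm_neg, div_mul_eq_mul_div, le_div_iff₀ hK] at this
  linarith

/-- A displacement in `V` equals its own defect, which is at most half of it. -/
lemma IsStrictPansu.exists_injective (hn : 0 < n) (hd : IsHomDist d) (h : IsStrictPansu d f x L)
    (hB : ∀ y, B y ∈ H1 n) (hBL : ∀ u ∈ V, B (L u) = u) :
    ∃ δ > 0, ∀ p q, d x p < δ → d (p⁻¹ * q) 0 < δ → f p = f q → p⁻¹ * q ∈ V → p = q := by
  obtain ⟨δ, hδ, H⟩ := h.exists_defect_le hn hd hB (ε := 1 / 2) (by norm_num)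
  refine ⟨δ, hδ, fun p q hp hq hpq hV => ?_⟩
  have h1 := H p q hp hq hpq
  rw [hBL _ hV] at h1
  have h2 := hd.nonneg (p⁻¹ * q) 0
  rw [← hd.eq_zero_iff, hd.eq_inv_mul]
  linarith

/-- Level sets are locally met by the cosets of `V`. -/
lemma IsStrictPansu.exists_solution (hn : 0 < n) (hd : IsHomDist d) (hQ : IsSplit W V Q)
    (h : IsStrictPansu d f x L) (hB : ∀ y, B y ∈ V) (hLB : ∀ y, L (B y) = y) {ρ : ℝ} (hρ : 0 < ρ) :
    ∃ δ > 0, ∀ p, d x p < δ → ∃ u ∈ V, d u 0 < ρ ∧ f (p * u) = f x := by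
  obtain ⟨K, hK, hBK⟩ := exists_dist_le_norm hn hd fun y => hQ.horizontal _ (hB y)
  obtain ⟨δ, hδ, H⟩ := h.2 (1 / (2 * K)) (by positivity)
  -- On the ball of radius `r`, both `B y` and differences `B (y' - y)` have length below `δ`, so
  -- strict differentiability applies; `B y` is also shorter than `ρ`.
  set r := min ρ δ / (4 * K) with hr
  have hr0 : 0 < r := by positivity
  have hrK : K * r ≤ ρ / 4 ∧ K * r ≤ δ / 4 := by
    have : K * r = min ρ δ / 4 := by rw [hr]; field_simp
    rw [this]
    exact ⟨by linarith [min_le_left ρ δ], by linarith [min_le_right ρ δ]⟩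
  obtain ⟨η, hη, Hη⟩ := (hd.nhds_basis hn x).eventually_iff.1
    ((h.continuousAt hn hd).eventually (Metric.closedBall_mem_nhds _ (half_pos hr0)))
  refine ⟨min η (δ / 4), by positivity, fun p hp => ?_⟩
  simp only [lt_min_iff] at hp
  have happ : ApproximatesLinearOn (fun y => f (p * B y))
      (ContinuousLinearMap.id ℝ (EuclideanSpace ℝ (Fin k))) (Metric.closedBall 0 r) (1 / 2) := by
    intro y' hy' y hy
    rw [mem_closedBall_zero_iff] at hy hy'
    have hm : p * B y' = p * B y * B (y' - y) := by
      rw [mul_assoc, hQ.mul_eq_add (hB _) (hB _), ← map_add, add_sub_cancel]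
    have h1 : d x (p * B y) < δ := by
      have h2 := hd.triangle x p (p * B y)
      rw [hd.mul_right] at h2
      have h3 := (hBK y).trans (mul_le_mul_of_nonneg_left hy hK.le)
      linarith [hp.2, hrK.2]
    have hle : ‖y' - y‖ ≤ 2 * r := (norm_sub_le _ _).trans (by linarith)
    have h4 : d (B (y' - y)) 0 < δ := by
      have h3 := (hBK (y' - y)).trans (mul_le_mul_of_nonneg_left hle hK.le)
      linarith [hrK.2]
    have h5 := H _ h1 _ h4
    simp only [ContinuousLinearMap.id_apply]
    rw [hm]
    rw [hLB] at h5
    refine h5.trans ?_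
    have h6 : 1 / (2 * K) * d (B (y' - y)) 0 ≤ 1 / (2 * K) * (K * ‖y' - y‖) :=
      mul_le_mul_of_nonneg_left (hBK _) (by positivity)
    refine h6.trans (le_of_eq ?_)
    push_cast
    field_simp
  -- The map `y ↦ f (p * B y)` is `1/2`-close to the identity, so its image contains the ball of
  -- radius `(1 - 1/2) r` around `f p`, where `f x` lies.
  have hsurj := happ.surjOn_closedBall_of_nonlinearRightInverse
    ⟨id, 1, by simp, by simp⟩ hr0.le subset_rfl
  have hx : f x ∈ Metric.closedBall (f (p * B 0)) ((((1 : NNReal) : ℝ)⁻¹ - ((1 / 2 : NNReal) : ℝ)) * r) := by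
    have e1 : p * B 0 = p := by rw [map_zero, ← one_def, mul_one]
    have : dist (f p) (f x) ≤ r / 2 := Hη hp.1
    rw [dist_comm] at this
    rw [e1, Metric.mem_closedBall]
    refine this.trans (le_of_eq ?_)
    push_cast; ring
  obtain ⟨y, hy, hfy⟩ := hsurj hx
  rw [mem_closedBall_zero_iff] at hy
  refine ⟨B y, hB y, ?_, hfy⟩
  have := (hBK y).trans (mul_le_mul_of_nonneg_left hy hK.le)
  linarith [hrK.1]

/-- The intrinsic differential `w ↦ -(L|_V)⁻¹ (L w)` of the implicit function. -/
lemma isHHom_neg_comp (hQ : IsSplit W V Q) (hL : L (e n) = 0) (hB : ∀ y, B y ∈ V) :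
    IsHHom W V fun w => -B (L w) where
  mapsTo w _ := by rw [← inv_def]; exact V.inv_mem (hB _)
  map_mul w _ w' _ := by
    rw [← inv_def, ← inv_def, ← inv_def, hQ.mul_eq_add (V.inv_mem (hB _)) (V.inv_mem (hB _)),
      map_mul_of_map_e hL, map_add]
    simp only [inv_def]; abel
  map_dil t _ w _ := by
    rw [map_dil_of_map_e hL, map_smul, ← smul_neg, dil_of_mem]
    rw [← inv_def]
    exact hQ.horizontal _ (V.inv_mem (hB _))

/-- When `w * u` is the displacement between two graph points, the numerator in uniform intrinsic
differentiability is the defect of that displacement. -/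
lemma dist_neg_comp (hd : IsHomDist d) (hQ : IsSplit W V Q) (hL : L (e n) = 0)
    (hB : ∀ y, B y ∈ V) (hBL : ∀ u ∈ V, B (L u) = u) (w : Heis n) {u : Heis n} (hu : u ∈ V) :
    d (-B (L w)) u = d (B (L (w * u))) 0 := by
  rw [hd.eq_inv_mul, ← inv_def, inv_inv, hQ.mul_eq_add (hB _) hu, map_mul_of_map_e hL, map_add,
    hBL u hu]

variable {Ω : Set (Heis n)} {v : Fin k → Heis n}

/-- The translated function at `w` compares the graph points over `w'` and `u`. Their displacement
`m` has `W`-part `w`, so the defect bound in terms of `m` only has to be converted into one in terms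
of `w`. -/
lemma isUnifIntrinsicDiff_of_continuousOn (hn : 0 < n) (hd : IsHomDist d) (hQ : IsSplit W V Q)
    (hΩ : IsOpen Ω) (hf : IsC1h Ω f) (hv : Orthonormal ℝ v)
    (hvV : (Submodule.span ℝ (Set.range v) : Set (Heis n)) = V) {c : EuclideanSpace ℝ (Fin k)}
    {U : Set (Heis n)} {φ : Heis n → Heis n} (hUW : U ⊆ W) (hφV : ∀ u ∈ U, φ u ∈ V)
    (hφΩ : ∀ u ∈ U, graphMap φ u ∈ Ω) (hφf : ∀ u ∈ U, f (graphMap φ u) = c)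
    (hJ : ∀ u ∈ U, 0 < jacV d V f (graphMap φ u)) (hφ : ContinuousOn φ U) :
    IsUnifIntrinsicDiff d W V U φ := by
  intro w₀ hw₀
  have hst := hf.isStrictPansu hn hd hΩ (hφΩ w₀ hw₀)
  set L := horDiff f (graphMap φ w₀)
  obtain ⟨B, hB, hLB, hBL⟩ := exists_inverse_of_jacV_pos hd hst hv hvV (hJ w₀ hw₀)
  refine ⟨fun w => -B (L w), isHHom_neg_comp hQ hst.1 hB, fun ε hε => ?_⟩
  have hBH : ∀ y, B y ∈ H1 n := fun y => hQ.horizontal _ (hB y)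
  obtain ⟨K, hK, hBK⟩ := exists_dist_le_norm hn hd hBH
  obtain ⟨K', hK', hLK⟩ := exists_norm_le_dist hn hd hst.1
  set M := K * K' with hM
  have hBL' : ∀ p, d (B (L p)) 0 ≤ M * d p 0 := fun p => by
    refine (hBK _).trans ?_
    rw [hM, mul_assoc]
    exact mul_le_mul_of_nonneg_left (hLK p) hK.le
  have hM0 : 0 < M := by positivity
  -- The bound `1/2` absorbs the defect into the left-hand side and gives `d m 0 ≤ 2 (1 + M) d w 0`;
  -- the other bound is `ε` divided by this constant.
  obtain ⟨δ₁, hδ₁, H⟩ := hst.exists_defect_le hn hd hBH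
    (ε := min (1 / 2) (ε / (2 * (1 + M)))) (by positivity)
  have hΦ : ContinuousOn (graphMap φ) U := continuousOn_id.mul hφ
  obtain ⟨η, hη, Hη⟩ := ((nhdsWithin_hasBasis (hd.nhds_basis hn w₀) U).eventually_iff).1
    ((hΦ w₀ hw₀).eventually ((hd.nhds_basis hn _).mem_of_mem (half_pos hδ₁)))
  -- This map inverts `sigma`: it recovers the base point `u` from `w'` and `w`, and shows that `u`
  -- is near `w₀`, uniformly in both variables.
  have htend : Tendsto (fun q : Heis n × Heis n => graphMap φ q.1 * q.2 * (φ q.1)⁻¹)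
      (𝓝[U] w₀ ×ˢ 𝓝 0) (𝓝 w₀) := by
    have h1 := (((hΦ w₀ hw₀).tendsto.comp tendsto_fst).mul
      (tendsto_snd (f := 𝓝[U] w₀) (g := 𝓝 (0 : Heis n)))).mul
      ((hφ w₀ hw₀).tendsto.comp (tendsto_fst (g := 𝓝 (0 : Heis n)))).inv
    have e1 : graphMap φ w₀ * 0 * (φ w₀)⁻¹ = w₀ := by
      rw [← one_def, mul_one, graphMap, mul_inv_cancel_right]
    rwa [e1] at h1
  have hb := ((nhdsWithin_hasBasis (hd.nhds_basis hn w₀) U).prod (hd.nhds_basis hn (0 : Heis n)))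
  obtain ⟨⟨a, b⟩, ⟨ha, hb0⟩, Hab⟩ := hb.eventually_iff.1
    (htend.eventually ((hd.nhds_basis hn w₀).mem_of_mem hη))
  refine ⟨min a (min b η), by positivity, fun w' hw' hw'd w hw hw0 hwd => ?_⟩
  simp only [lt_min_iff] at hw'd hwd
  obtain ⟨u, hu, rfl⟩ := hw
  have hpi : piV W V (graphMap φ w')⁻¹ = (φ w')⁻¹ := by
    rw [hQ.piV_eq, map_inv', graphMap, hQ.Q_mul, hQ.Q_W (hUW hw'), hQ.Q_V (hφV _ hw'), zero_add,
      inv_def]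
  set w := sigma W V (graphMap φ w')⁻¹ u with hwdef
  have hw : w = (graphMap φ w')⁻¹ * u * φ w' := by rw [hwdef, sigma, hpi, inv_inv]
  have hu' : graphMap φ w' * w * (φ w')⁻¹ = u := by rw [hw]; group
  have hm : (graphMap φ w')⁻¹ * graphMap φ u = w * ((φ w')⁻¹ * φ u) := by
    rw [hw, graphMap, graphMap]; group
  have htr : translate W V φ (graphMap φ w')⁻¹ w = (φ w')⁻¹ * φ u := by
    rw [translate, hpi, inv_inv, hu']
  have hud : d w₀ u < η := by
    have := Hab (x := (w', w))
      ⟨⟨by change d w₀ w' < a; rw [hd.eq_inv_mul]; exact hw'd.1, hw'⟩,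
        by change d 0 w < b; rw [hd.symm]; exact hwd.2.1⟩
    simpa [hu'] using this
  have h1 : d (graphMap φ w₀) (graphMap φ w') < δ₁ / 2 :=
    Hη ⟨by change d w₀ w' < η; rw [hd.eq_inv_mul]; exact hw'd.2.2, hw'⟩
  have h2 : d (graphMap φ w₀) (graphMap φ u) < δ₁ / 2 := Hη ⟨hud, hu⟩
  have h3 : d ((graphMap φ w')⁻¹ * graphMap φ u) 0 < δ₁ := by
    rw [← hd.eq_inv_mul]
    have := hd.triangle (graphMap φ w') (graphMap φ w₀) (graphMap φ u)
    rw [hd.symm (graphMap φ w') (graphMap φ w₀)] at this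
    linarith
  have h4 := H _ _ (by linarith) h3 ((hφf _ hw').trans (hφf _ hu).symm)
  have hvV' : (φ w')⁻¹ * φ u ∈ V := V.mul_mem (V.inv_mem (hφV _ hw')) (hφV _ hu)
  rw [div_le_iff₀ hw0, htr, dist_neg_comp hd hQ hst.1 hB hBL w hvV', ← hm]
  set m := (graphMap φ w')⁻¹ * graphMap φ u with hmdef
  have h5 : d m 0 ≤ d w 0 + d (B (L w)) 0 + d (B (L m)) 0 := by
    have e1 : m = w * ((B (L w))⁻¹ * B (L m)) := by
      rw [hm, map_mul_of_map_e hst.1, map_add, hBL _ hvV', hQ.inv_mul_eq_sub (hB _)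
        (hQ.add_mem (hB _) hvV'), add_sub_cancel_left]
    have h6 := hd.mul_le w ((B (L w))⁻¹ * B (L m))
    have h7 := hd.mul_le (B (L w))⁻¹ (B (L m))
    rw [hd.inv_zero] at h7
    rw [← e1] at h6
    linarith
  have h8 := hd.nonneg m 0
  have h9 : d (B (L m)) 0 ≤ 1 / 2 * d m 0 :=
    h4.trans (mul_le_mul_of_nonneg_right (min_le_left _ _) h8)
  have h10 : d m 0 ≤ 2 * (1 + M) * d w 0 := by linarith [hBL' w]
  have h11 : d (B (L m)) 0 ≤ ε / (2 * (1 + M)) * d m 0 :=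
    h4.trans (mul_le_mul_of_nonneg_right (min_le_right _ _) h8)
  calc d (B (L m)) 0 ≤ ε / (2 * (1 + M)) * (2 * (1 + M) * d w 0) :=
        h11.trans (mul_le_mul_of_nonneg_left h10 (by positivity))
    _ = ε * d w 0 := by field_simp

/-- `J_V f > 0` makes the differential surjective, so `J_H f > 0` at each point of the set, and
nearby by continuity. -/
lemma isHRegular_levelSet (hk : 1 ≤ k) (hkn : k ≤ n) (hd : IsHomDist d)
    (hΩ : IsOpen Ω) (hf : IsC1h Ω f) (hv : Orthonormal ℝ v)
    (hvV : (Submodule.span ℝ (Set.range v) : Set (Heis n)) = V) {c : EuclideanSpace ℝ (Fin k)}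
    {S : Set (Heis n)} (hS : S = {x | x ∈ Ω ∧ f x = c}) (hJ : ∀ x ∈ S, 0 < jacV d V f x) :
    IsHRegular d k S := by
  have hn : 0 < n := by omega
  refine ⟨hk, hkn, fun x hx => ?_⟩
  have hxΩ : x ∈ Ω := by rw [hS] at hx; exact hx.1
  have hst := hf.isStrictPansu hn hd hΩ hxΩ
  obtain ⟨B, -, hLB, -⟩ := exists_inverse_of_jacV_pos hd hst hv hvV (hJ x hx)
  have hpos := jacH_pos hd hst fun y => ⟨B y, hLB y⟩
  have hf' := hf.sub_const c
  have hc := hf'.continuousOn_jacH hn hd hΩ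
  have hjac : jacH d (fun x => f x - c) x = jacH d f x := by
    rw [jacH_eq hd hst, jacH_eq hd (hst.sub_const c)]
  refine ⟨Ω ∩ jacH d (fun x => f x - c) ⁻¹' Ioi 0, fun x => f x - c,
    hc.isOpen_inter_preimage hΩ isOpen_Ioi, ⟨hxΩ, ?_⟩, hf'.mono inter_subset_left, ?_,
    fun y hy => ne_of_gt hy.2⟩
  · change 0 < jacH d (fun x => f x - c) x
    rwa [hjac]
  · ext y
    simp only [hS, mem_inter_iff, mem_ofPred_eq, sub_eq_zero]
    tauto

/-- Near a point `u₀ y₀` of a level set, the level set meets the cosets `u V` close to `y₀`. -/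
lemma eventually_exists_mem_levelSet (hn : 0 < n) (hd : IsHomDist d) (hQ : IsSplit W V Q)
    (hΩ : IsOpen Ω) (hf : IsC1h Ω f) (hv : Orthonormal ℝ v)
    (hvV : (Submodule.span ℝ (Set.range v) : Set (Heis n)) = V) {c : EuclideanSpace ℝ (Fin k)}
    {S : Set (Heis n)} (hS : S = {x | x ∈ Ω ∧ f x = c}) {u₀ y₀ : Heis n} (hy₀ : y₀ ∈ V)
    (hxS : u₀ * y₀ ∈ S) (hJ : 0 < jacV d V f (u₀ * y₀)) {ρ : ℝ} (hρ : 0 < ρ) :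
    ∀ᶠ u in 𝓝 u₀, ∃ y ∈ V, d y₀ y < ρ ∧ u * y ∈ S := by
  rw [hS] at hxS
  have hst := hf.isStrictPansu hn hd hΩ hxS.1
  obtain ⟨B, hB, hLB, hBL⟩ := exists_inverse_of_jacV_pos hd hst hv hvV hJ
  obtain ⟨r, hr, Hr⟩ := (hd.nhds_basis hn _).eventually_iff.1 (hΩ.eventually_mem hxS.1)
  -- The bound `r / 2` keeps the solution in `Ω`, so that it belongs to the level set.
  obtain ⟨δ, hδ, H⟩ := hst.exists_solution hn hd hQ hB hLB (ρ := min ρ (r / 2)) (by positivity)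
  have hc : ContinuousAt (fun u => u * y₀) u₀ := (continuous_mul_const y₀).continuousAt
  filter_upwards [hc.eventually ((hd.nhds_basis hn _).mem_of_mem
    (show 0 < min δ (r / 2) by positivity))] with u hu
  have hu : d (u₀ * y₀) (u * y₀) < min δ (r / 2) := hu
  rw [lt_min_iff] at hu
  obtain ⟨y, hyV, hyd, hyf⟩ := H _ hu.1
  rw [lt_min_iff] at hyd
  refine ⟨y₀ * y, V.mul_mem hy₀ hyV, by rw [hd.mul_right]; exact hyd.1, ?_⟩
  rw [hS]
  refine ⟨Hr ?_, ?_⟩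
  · have h1 := hd.triangle (u₀ * y₀) (u * y₀) (u * y₀ * y)
    rw [hd.mul_right, mul_assoc u] at h1
    change d (u₀ * y₀) (u * (y₀ * y)) < r
    linarith
  · rw [← mul_assoc, hyf]; exact hxS.2

/-- Continuity is forced by the graph property: a graph meets `u V` only at `u φ(u)`, so the
solution found there near `φ u₀` must be `φ u`. -/
lemma continuousOn_of_graph_eq (hn : 0 < n) (hd : IsHomDist d) (hQ : IsSplit W V Q)
    (hΩ : IsOpen Ω) (hf : IsC1h Ω f) (hv : Orthonormal ℝ v)
    (hvV : (Submodule.span ℝ (Set.range v) : Set (Heis n)) = V) {c : EuclideanSpace ℝ (Fin k)}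
    {S : Set (Heis n)} (hS : S = {x | x ∈ Ω ∧ f x = c}) (hJ : ∀ x ∈ S, 0 < jacV d V f x)
    {U : Set (Heis n)} {φ : Heis n → Heis n} (hUW : U ⊆ W) (hφV : ∀ u ∈ U, φ u ∈ V)
    (hφS : S = graphMap φ '' U) : ContinuousOn φ U := by
  intro u₀ hu₀
  have hx : u₀ * φ u₀ ∈ S := by rw [hφS]; exact ⟨u₀, hu₀, rfl⟩
  refine ((hd.nhds_basis hn (φ u₀)).tendsto_right_iff).2 fun ρ hρ => ?_
  filter_upwards [mem_nhdsWithin_of_mem_nhds (eventually_exists_mem_levelSet hn hd hQ hΩ hf hv hvV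
    hS (hφV u₀ hu₀) hx (hJ _ hx) hρ), self_mem_nhdsWithin] with u h1 h2
  obtain ⟨y, hyV, hyd, hyS⟩ := h1
  rw [hφS] at hyS
  obtain ⟨u', hu', h⟩ := hyS
  have hy : φ u' = y := by
    have h' := congrArg Q h
    rwa [graphMap, hQ.Q_mul, hQ.Q_mul, hQ.Q_W (hUW hu'), hQ.Q_W (hUW h2), hQ.Q_V (hφV _ hu'),
      hQ.Q_V hyV, zero_add, zero_add] at h'
  rw [graphMap, hy, mul_left_inj] at h
  rw [h] at hy
  rw [hy]
  exact hyd

/-- Injectivity along cosets makes `S` the graph of a function on its projection `U` to `W`.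
Solvability on nearby cosets then yields at once that `U` is open in `W` and that `φ` is continuous.
-/
theorem isParametrizedHRegular_of_injective (hk : 1 ≤ k) (hkn : k ≤ n) (hd : IsHomDist d)
    (hWV : IsSemidirect W V) (hQ : IsSplit W V Q) (hΩ : IsOpen Ω) (hf : IsC1h Ω f)
    (hv : Orthonormal ℝ v)
    (hvV : (Submodule.span ℝ (Set.range v) : Set (Heis n)) = V) {c : EuclideanSpace ℝ (Fin k)}
    {S : Set (Heis n)} (hS : S = {x | x ∈ Ω ∧ f x = c}) (hJ : ∀ x ∈ S, 0 < jacV d V f x)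
    (hinj : ∀ x ∈ S, ∀ y ∈ S, x⁻¹ * y ∈ V → x = y) :
    IsParametrizedHRegular d k W V S := by
  classical
  have hn : 0 < n := by omega
  refine ⟨isHRegular_levelSet hk hkn hd hΩ hf hv hvV hS hJ, hWV, ?_⟩
  set U : Set (Heis n) := {u | u ∈ W ∧ ∃ y ∈ V, u * y ∈ S} with hU
  have hex : ∀ u, ∃ y, u ∈ U → y ∈ V ∧ u * y ∈ S := fun u => by
    by_cases hu : u ∈ U
    · obtain ⟨y, hy⟩ := hu.2
      exact ⟨y, fun _ => hy⟩
    · exact ⟨0, fun h => absurd h hu⟩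
  choose φ hφ using hex
  have huniq : ∀ u ∈ U, ∀ y ∈ V, u * y ∈ S → φ u = y := fun u hu y hy hyS => by
    have := hinj _ (hφ u hu).2 _ hyS
      (by rw [mul_inv_rev, mul_assoc, inv_mul_cancel_left]
          exact V.mul_mem (V.inv_mem (hφ u hu).1) hy)
    exact mul_left_cancel this
  have hUW : U ⊆ W := fun u hu => hu.1
  have key : ∀ u₀ ∈ U, ∀ ρ > 0, ∀ᶠ u in 𝓝 u₀, u ∈ W → u ∈ U ∧ d (φ u₀) (φ u) < ρ := by
    intro u₀ hu₀ ρ hρ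
    obtain ⟨hφV, hφS⟩ := hφ u₀ hu₀
    filter_upwards [eventually_exists_mem_levelSet hn hd hQ hΩ hf hv hvV hS hφV hφS (hJ _ hφS) hρ]
      with u hu huW
    obtain ⟨y, hyV, hyd, hyS⟩ := hu
    have huU : u ∈ U := ⟨huW, y, hyV, hyS⟩
    exact ⟨huU, by rwa [huniq u huU y hyV hyS]⟩
  have hcont : ContinuousOn φ U := by
    intro u₀ hu₀
    refine ((hd.nhds_basis hn (φ u₀)).tendsto_right_iff).2 fun ρ hρ => ?_
    filter_upwards [mem_nhdsWithin_of_mem_nhds (key u₀ hu₀ ρ hρ), self_mem_nhdsWithin] with u h1 h2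
    exact (h1 (hUW h2)).2
  have hmap : ∀ u ∈ U, graphMap φ u ∈ S := fun u hu => (hφ u hu).2
  -- Adding the complement of `W` thickens the relatively open set `U` to a neighbourhood of each of
  -- its points without changing its trace on `W`.
  refine ⟨U, φ, ⟨interior (U ∪ (W : Set (Heis n))ᶜ), isOpen_interior, ?_⟩, fun u hu => (hφ u hu).1,
    ?_, ?_⟩
  · ext u
    constructor
    · intro hu
      refine ⟨mem_interior_iff_mem_nhds.2 ?_, hUW hu⟩
      filter_upwards [key u hu 1 one_pos] with y hy
      by_cases hyW : y ∈ W
      · exact Or.inl (hy hyW).1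
      · exact Or.inr hyW
    · rintro ⟨h1, h2⟩
      exact (interior_subset h1).resolve_right fun h => h h2
  · refine isUnifIntrinsicDiff_of_continuousOn hn hd hQ hΩ hf hv hvV (c := c) hUW
      (fun u hu => (hφ u hu).1) (fun u hu => ?_) (fun u hu => ?_) (fun u hu => hJ _ (hmap u hu)) hcont
    · have := hmap u hu
      rw [hS] at this; exact this.1
    · have := hmap u hu
      rw [hS] at this; exact this.2
  · ext y
    constructor
    · intro hy
      have hu : y * (Q y)⁻¹ ∈ U := ⟨hQ.mul_inv_mem y, Q y, hQ.Q_mem y, by simpa using hy⟩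
      refine ⟨_, hu, ?_⟩
      rw [graphMap, huniq _ hu (Q y) (hQ.Q_mem y) (by simpa using hy)]
      simp
    · rintro ⟨u, hu, rfl⟩
      exact hmap u hu

end LevelSet

/-! ### Hausdorff measures of subspaces -/

/-- The inverse `w ↦ w - q(w) a` has derivative a transvection, of determinant `1` because `q` is
constant along `a`; change of variables applies. The group law differs from addition by such shears
along the centre. -/
lemma measure_preimage_shear {E : Type*} [NormedAddCommGroup E] [NormedSpace ℝ E]
    [FiniteDimensional ℝ E] [MeasurableSpace E] [BorelSpace E] (μ : Measure E) [μ.IsAddHaarMeasure]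
    {q : E → ℝ} (hq : Differentiable ℝ q) {a : E} (hqa : ∀ w (t : ℝ), q (w + t • a) = q w)
    {X : Set E} (hX : MeasurableSet X) : μ ((fun w => w + q w • a) ⁻¹' X) = μ X := by
  have hl : ∀ w, (w + q w • a) - q (w + q w • a) • a = w := fun w => by rw [hqa]; abel
  have hr : ∀ w, (w - q w • a) + q (w - q w • a) • a = w := fun w => by
    have := hqa w (-q w)
    rw [neg_smul, ← sub_eq_add_neg] at this
    rw [this]; abel
  have himg : (fun w => w + q w • a) ⁻¹' X = (fun w => w - q w • a) '' X := by
    ext w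
    constructor
    · exact fun hw => ⟨_, hw, hl w⟩
    · rintro ⟨y, hy, rfl⟩
      simpa only [mem_preimage, hr] using hy
  have hderiv : ∀ w, HasFDerivAt (fun w => w - q w • a)
      (ContinuousLinearMap.id ℝ E - (fderiv ℝ q w).smulRight a) w := fun w =>
    (hasFDerivAt_id w).sub ((hq w).hasFDerivAt.smul_const a)
  have hzero : ∀ w, fderiv ℝ q w a = 0 := fun w => by
    have h1 : HasDerivAt (fun t : ℝ => q (w + t • a)) (fderiv ℝ q w a) 0 := by
      have h2 : HasFDerivAt q (fderiv ℝ q w) (w + (0 : ℝ) • a) := by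
        simpa using (hq w).hasFDerivAt
      have h3 : HasDerivAt (fun t : ℝ => w + t • a) a 0 := by
        simpa using ((hasDerivAt_id (0 : ℝ)).smul_const a).const_add w
      exact h2.comp_hasDerivAt 0 h3
    simp only [hqa] at h1
    exact h1.unique (hasDerivAt_const _ _)
  have hdet : ∀ w, (ContinuousLinearMap.id ℝ E - (fderiv ℝ q w).smulRight a).det = 1 := fun w => by
    have : ((ContinuousLinearMap.id ℝ E - (fderiv ℝ q w).smulRight a : E →L[ℝ] E) : E →ₗ[ℝ] E) =
        LinearMap.transvection (-(fderiv ℝ q w).toLinearMap) a := by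
      ext y
      simp [LinearMap.transvection.apply, sub_eq_add_neg]
    rw [ContinuousLinearMap.det, this, LinearMap.transvection.det]
    simp [hzero]
  have hinj : InjOn (fun w => w - q w • a) X := fun w _ w' _ h => by
    have h' : w - q w • a = w' - q w' • a := h
    rw [← hr w, h', hr w']
  rw [himg, ← lintegral_abs_det_fderiv_eq_addHaar_image μ hX
    (fun w _ => (hderiv w).hasFDerivWithinAt) hinj]
  simp [hdet]

lemma differentiable_omega {E : Type*} [NormedAddCommGroup E] [NormedSpace ℝ E] {a b : E → Heis n}
    (ha : Differentiable ℝ a) (hb : Differentiable ℝ b) :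
    Differentiable ℝ fun y => omega (a y) (b y) := by
  rw [differentiable_euclidean] at ha hb
  unfold omega
  exact Differentiable.fun_sum fun i _ => ((ha _).mul (hb _)).sub ((ha _).mul (hb _))

section Subspaces

variable {ι : Type*} [Fintype ι]

lemma exists_linearIsometry [DecidableEq ι] {u : ι → Heis n} (hu : Orthonormal ℝ u) :
    ∃ T : EuclideanSpace ℝ ι →ₗᵢ[ℝ] Heis n, (∀ i, T (EuclideanSpace.single i 1) = u i) ∧
      range T = Submodule.span ℝ (range u) := by
  set b := (EuclideanSpace.basisFun ι ℝ).toBasis with hb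
  have hbo : Orthonormal ℝ b := by
    rw [hb, OrthonormalBasis.coe_toBasis]; exact (EuclideanSpace.basisFun ι ℝ).orthonormal
  have hfb : ⇑(b.constr ℝ u) ∘ b = u := by
    funext i; simp
  let T := (b.constr ℝ u).isometryOfOrthonormal hbo (by rw [hfb]; exact hu)
  have hT : ⇑T = b.constr ℝ u := rfl
  refine ⟨T, fun i => ?_, ?_⟩
  · rw [hT]
    simp [hb]
  · rw [hT, ← LinearMap.coe_range, Module.Basis.constr_range]

/-- The constant of the Euclidean Hausdorff measure. -/
noncomputable def hausConst (p : ℕ) : ℝ≥0∞ :=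
  volume (Metric.closedBall (0 : EuclideanSpace ℝ (Fin p)) 1) / 2 ^ p

lemma hausConst_ne_top (p : ℕ) : hausConst p ≠ ∞ :=
  ENNReal.div_ne_top (isCompact_closedBall _ _).measure_ne_top (by positivity)

/-- Isometric coordinates turn the Hausdorff measure on a subspace into a Haar measure on `ℝᵖ`,
where determinants compute volumes. -/
lemma hausE_apply {p : ℕ} (T : EuclideanSpace ℝ ι →ₗᵢ[ℝ] Heis n) (A : Set (Heis n)) :
    hausE n p (range T ∩ A) = hausConst p * μH[p] (T ⁻¹' A) := by
  rw [T.isometry.hausdorffMeasure_preimage (Or.inl (by positivity)), inter_comm]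
  rfl

lemma isAddHaarMeasure_hausdorff {p : ℕ} (hp : Fintype.card ι = p) :
    (μH[p] : Measure (EuclideanSpace ℝ ι)).IsAddHaarMeasure := by
  have := isAddHaarMeasure_hausdorffMeasure (E := EuclideanSpace ℝ ι)
  rwa [finrank_euclideanSpace, hp] at this

lemma hausE_inter_lt_top {p : ℕ} (hp : Fintype.card ι = p) (T : EuclideanSpace ℝ ι →ₗᵢ[ℝ] Heis n)
    {A : Set (Heis n)} (hA : IsCompact A) : hausE n p (range T ∩ A) < ∞ := by
  have := isAddHaarMeasure_hausdorff hp
  rw [hausE_apply]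
  exact ENNReal.mul_lt_top (hausConst_ne_top p).lt_top
    (T.isometry.isClosedEmbedding.isCompact_preimage hA).measure_lt_top

variable {d : Heis n → Heis n → ℝ}

lemma preimage_apply_det {p : ℕ} (hp : Fintype.card ι = p)
    {D : EuclideanSpace ℝ ι →ₗ[ℝ] EuclideanSpace ℝ ι} (hD : LinearMap.det D ≠ 0)
    (X : Set (EuclideanSpace ℝ ι)) :
    μH[p] X = ENNReal.ofReal |LinearMap.det D| * μH[p] (D ⁻¹' X) := by
  have := isAddHaarMeasure_hausdorff hp
  rw [Measure.addHaar_preimage_linearMap _ hD, ← mul_assoc, ← ENNReal.ofReal_mul (abs_nonneg _),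
    ← abs_mul, mul_inv_cancel₀ hD]
  simp

/-- In the coordinates of `T`, `δ_r` is `r` times a transvection that stretches the central
direction `a` by `r` once more, so its determinant is `r ^ p * r`. This is where `e n` being in the
subspace matters. -/
lemma hausE_inter_cball_dil {p : ℕ} (hd : IsHomDist d) (hp : Fintype.card ι = p)
    (T : EuclideanSpace ℝ ι →ₗᵢ[ℝ] Heis n) {a : EuclideanSpace ℝ ι} (ha : T a = e n) {r : ℝ}
    (hr : 0 < r) (u : Heis n) (s : ℝ) :
    hausE n p (range T ∩ cball d (dil r u) (r * s)) =
      ENNReal.ofReal (r ^ (p + 1)) * hausE n p (range T ∩ cball d u s) := by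
  let ζ : EuclideanSpace ℝ ι →ₗ[ℝ] ℝ :=
    { toFun := fun y => z (T y)
      map_add' := fun x y => by simp
      map_smul' := fun c y => by simp }
  let D := r • LinearMap.transvection ((r - 1) • ζ) a
  have hdet : LinearMap.det D = r ^ (p + 1) := by
    have hζ : ζ a = 1 := by change z (T a) = 1; rw [ha, z_e]
    rw [LinearMap.det_smul, LinearMap.transvection.det, finrank_euclideanSpace, hp]
    simp [hζ, pow_succ]
  have hD : ∀ y, T (D y) = dil r (T y) := fun y => by
    have : D y = r • (y + ((r - 1) * z (T y)) • a) := rfl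
    rw [this, map_smul, map_add, map_smul, ha, dil_eq]
    module
  have hpre : D ⁻¹' (T ⁻¹' cball d (dil r u) (r * s)) = T ⁻¹' cball d u s := by
    ext y
    rw [mem_preimage, mem_preimage, hD, hd.mem_cball_dil hr, mem_preimage]
  rw [hausE_apply, hausE_apply, preimage_apply_det hp (D := D) (by rw [hdet]; positivity), hpre,
    hdet, abs_of_pos (by positivity)]
  ring

variable {W V : Subgroup (Heis n)} {Q : Heis n →ₗ[ℝ] Heis n}

/-- The conjugated translation `u ↦ x⁻¹ u π_V(x)` of `W` preserves the Hausdorff measure. -/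
lemma hausE_preimage_translation {p : ℕ} (hp : Fintype.card ι = p) (hQ : IsSplit W V Q)
    (T : EuclideanSpace ℝ ι →ₗᵢ[ℝ] Heis n) (hT : range T = W) {a : EuclideanSpace ℝ ι}
    (ha : T a = e n) (x : Heis n) {A : Set (Heis n)} (hA : MeasurableSet A) :
    hausE n p (W ∩ (fun u => x⁻¹ * u * Q x) ⁻¹' A) = hausE n p (W ∩ A) := by
  have := isAddHaarMeasure_hausdorff hp
  obtain ⟨b, hb⟩ : Q x - x ∈ range T := by
    rw [hT, SetLike.mem_coe, hQ.mem_W, map_sub, hQ.proj, sub_self]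
  -- Expanding `x⁻¹ (T y) Q(x)` gives `T y`, the constant `Q x - x ∈ W`, and `q y` times the centre:
  -- a shear followed by a translation.
  let q : EuclideanSpace ℝ ι → ℝ := fun y => (-omega x (T y) + omega (T y - x) (Q x)) / 2
  have hq : Differentiable ℝ q := by
    have h1 : Differentiable ℝ T := T.toContinuousLinearMap.differentiable
    simpa only [q, div_eq_mul_inv] using
      ((differentiable_omega (differentiable_const x) h1).fun_neg.fun_add
        (differentiable_omega (h1.sub_const x) (differentiable_const (Q x)))).mul_const (2 : ℝ)⁻¹
  have hqa : ∀ w (t : ℝ), q (w + t • a) = q w := fun w t => by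
    simp only [q, map_add, map_smul, ha, omega_add_right, omega_sub_left, omega_add_left,
      omega_smul_e_left, omega_smul_e_right]
    ring
  have hτ : ∀ y, x⁻¹ * T y * Q x = T (y + q y • a + b) := fun y => by
    rw [map_add, map_add, map_smul, ha, hb]
    simp only [q, mul_def, inv_def, omega_add_left, omega_neg_left, omega_smul_left, omega_e_left,
      omega_sub_left]
    module
  rw [← hT, hausE_apply, hausE_apply]
  congr 1
  have hpre : T ⁻¹' ((fun u => x⁻¹ * u * Q x) ⁻¹' A) =
      (fun w => w + q w • a) ⁻¹' ((fun w => w + b) ⁻¹' (T ⁻¹' A)) := by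
    ext y
    simp only [mem_preimage, hτ]
  have hm : MeasurableSet (T ⁻¹' A) := T.continuous.measurable hA
  rw [hpre, measure_preimage_shear _ hq hqa (hm.preimage (measurable_add_const b)),
    measure_preimage_add_right]

/-- The graph map of the linear map `ℓ` from the range of `T` to that of `T'` multiplies the
Hausdorff measure by a determinant. -/
lemma hausE_eq_det_mul [DecidableEq ι] {p : ℕ} (hp : Fintype.card ι = p)
    (T T' : EuclideanSpace ℝ ι →ₗᵢ[ℝ] Heis n) {a : EuclideanSpace ℝ ι} (ha : T a = e n)
    (ℓ : Heis n →ₗ[ℝ] Heis n) (hℓ : ℓ (e n) = 0) (hT' : ∀ y, T y + ℓ (T y) ∈ range T')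
    {Δ : ℝ} (hΔ : Δ = Matrix.det (Matrix.of fun i j : ι =>
      inner ℝ (T' (EuclideanSpace.single i 1))
        (T (EuclideanSpace.single j 1) + ℓ (T (EuclideanSpace.single j 1)))))
    (hΔ0 : Δ ≠ 0) {A : Set (Heis n)} (hA : MeasurableSet A) :
    hausE n p (range T' ∩ A) =
      ENNReal.ofReal |Δ| * hausE n p (range T ∩ (fun w => w * ℓ w) ⁻¹' A) := by
  have := isAddHaarMeasure_hausdorff hp
  -- `D` is the linear map `w ↦ w + ℓ w` read in the coordinates `T` and `T'`. The remaining term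
  -- `ω(w, ℓ w) / 2` of the product is a shear along the centre.
  let D : EuclideanSpace ℝ ι →ₗ[ℝ] EuclideanSpace ℝ ι :=
    { toFun := fun y => WithLp.toLp 2 fun i =>
        inner ℝ (T' (EuclideanSpace.single i 1)) (T y + ℓ (T y))
      map_add' := fun x y => by
        ext i
        simp only [map_add, inner_add_right, PiLp.add_apply]
        ring
      map_smul' := fun c y => by
        ext i
        simp only [map_smul, ← smul_add, inner_smul_right, PiLp.smul_apply, smul_eq_mul,
          RingHom.id_apply] }
  have hD : ∀ y, T' (D y) = T y + ℓ (T y) := fun y => by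
    obtain ⟨x, hx⟩ := hT' y
    rw [← hx]
    congr 1
    ext i
    change inner ℝ (T' (EuclideanSpace.single i 1)) (T y + ℓ (T y)) = x i
    rw [← hx, LinearIsometry.inner_map_map, EuclideanSpace.inner_single_left]
    simp
  have hdet : LinearMap.det D = Δ := by
    rw [hΔ, ← LinearMap.det_toMatrix (EuclideanSpace.basisFun ι ℝ).toBasis]
    congr 1
  let q : EuclideanSpace ℝ ι → ℝ := fun y => omega (T y) (ℓ (T y)) / 2
  have hq : Differentiable ℝ q := by
    have h1 : Differentiable ℝ T := T.toContinuousLinearMap.differentiable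
    have h2 : Differentiable ℝ fun y => ℓ (T y) :=
      (LinearMap.toContinuousLinearMap ℓ).differentiable.comp h1
    simpa only [q, div_eq_mul_inv] using (differentiable_omega h1 h2).mul_const (2 : ℝ)⁻¹
  have hqa : ∀ w (t : ℝ), q (w + t • a) = q w := fun w t => by
    simp only [q, map_add, map_smul, ha, hℓ, omega_add_left, omega_smul_e_left, smul_zero,
      add_zero]
  have hΓ : ∀ y, T y * ℓ (T y) = T' (D (y + q y • a)) := fun y => by
    rw [hD, map_add, map_smul, ha, map_add, map_smul, hℓ, mul_def]
    simp only [q]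
    module
  rw [hausE_apply, hausE_apply, preimage_apply_det hp (D := D) (by rwa [hdet]), hdet]
  have hpre : T ⁻¹' ((fun w => w * ℓ w) ⁻¹' A) =
      (fun w => w + q w • a) ⁻¹' (D ⁻¹' (T' ⁻¹' A)) := by
    ext y
    simp only [mem_preimage, hΓ]
  have hm : MeasurableSet (T' ⁻¹' A) := T'.continuous.measurable hA
  rw [hpre, measure_preimage_shear _ hq hqa
    (hm.preimage (LinearMap.continuous_of_finiteDimensional D).measurable)]
  ring

end Subspaces

/-! ### The determinant identity -/

section Determinant

/-- The families have as many vectors as the ambient dimension, so their coordinate matrices are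
square and all three determinants are products of the same two. -/
lemma det_inner_sq {ι : Type*} [Fintype ι] [DecidableEq ι]
    (hι : Fintype.card ι = Fintype.card (Fin n ⊕ Fin n ⊕ Unit)) (a b : ι → Heis n) :
    Matrix.det (Matrix.of fun i j => inner ℝ (a i) (b j)) ^ 2 =
      (Matrix.gram ℝ a).det * (Matrix.gram ℝ b).det := by
  let σ := Fintype.equivOfCardEq hι
  have key : ∀ a b : ι → Heis n, (Matrix.of fun i j => inner ℝ (a i) (b j)) =
      (Matrix.of fun i c => a i (σ c)) * (Matrix.of fun i c => b i (σ c)).transpose := by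
    intro a b
    ext i j
    simp only [Matrix.of_apply, Matrix.mul_apply, Matrix.transpose_apply]
    rw [Equiv.sum_comp σ fun c => a i c * b j c, PiLp.inner_apply]
    exact Finset.sum_congr rfl fun c _ => by simp [mul_comm]
  have hgram : ∀ a : ι → Heis n, Matrix.gram ℝ a = Matrix.of fun i j => inner ℝ (a i) (a j) :=
    fun a => rfl
  rw [hgram, hgram, key, key, key]
  simp only [Matrix.det_mul, Matrix.det_transpose]
  ring

variable {k : ℕ} {d : Heis n → Heis n → ℝ} {f : Heis n → EuclideanSpace ℝ (Fin k)}
  {x : Heis n} {L : Heis n →ₗ[ℝ] EuclideanSpace ℝ (Fin k)} {V : Subgroup (Heis n)}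
  {v : Fin k → Heis n} {B : EuclideanSpace ℝ (Fin k) →ₗ[ℝ] Heis n}

/-- Consider the matrix of inner products of `(∇_H f, p)` with `(v, u)`. Replacing each `u j` by `u
j - B (L (u j)) ∈ ker L` is a column operation of determinant `1`. The result is block triangular,
with determinant `± J_V` times the last factor. By `det_inner_sq`, its square is also the product of
two Gram determinants. The first is `J_H²`, since `p` is orthonormal and orthogonal to the
gradients. -/
lemma jacH_mul_wedgeNorm {ι : Type*} [Fintype ι] [DecidableEq ι] (hd : IsHomDist d)
    (h : IsStrictPansu d f x L) (hv : Orthonormal ℝ v)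
    (hvV : (Submodule.span ℝ (Set.range v) : Set (Heis n)) = V) (hB : ∀ y, B y ∈ V)
    (hLB : ∀ y, L (B y) = y)
    (hι : Fintype.card (Fin k ⊕ ι) = Fintype.card (Fin n ⊕ Fin n ⊕ Unit))
    (u p : ι → Heis n) (hp : Orthonormal ℝ p) (hLp : ∀ i, L (p i) = 0) :
    jacH d f x * wedgeNorm (Sum.elim v u) = jacV d V f x *
      |Matrix.det (Matrix.of fun i j : ι => inner ℝ (p i) (u j - B (L (u j))))| := by
  set g : Fin k → Heis n := fun i => gradH d (fun y => f y i) x with hg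
  have hgi : ∀ i y, inner ℝ (g i) y = L y i := fun i y => inner_gradH hd h i y
  set a : Fin k ⊕ ι → Heis n := Sum.elim g p with ha
  have hspan : ∀ y, ∃ c : Fin k → ℝ, ∑ l, c l • v l = B y := fun y => by
    have := hB y
    rw [← SetLike.mem_coe, ← hvV, SetLike.mem_coe] at this
    exact (Submodule.mem_span_range_iff_exists_fun ℝ).1 this
  choose c hc using fun j => hspan (L (u j))
  have hX : (Matrix.of fun i j => inner ℝ (a i) (Sum.elim v (fun j => u j - B (L (u j))) j)) =
      (Matrix.of fun i j => inner ℝ (a i) (Sum.elim v u j)) *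
        Matrix.fromBlocks 1 (Matrix.of fun l j => -c j l) 0 1 := by
    ext i j
    rcases j with j | j
    · simp [Matrix.mul_apply, Fintype.sum_sum_type, Matrix.one_apply]
    · simp [Matrix.mul_apply, Fintype.sum_sum_type, Matrix.one_apply, ← hc, inner_sub_right,
        inner_sum, inner_smul_right, mul_comm]
      ring
  have hX' : (Matrix.of fun i j => inner ℝ (a i) (Sum.elim v (fun j => u j - B (L (u j))) j)) =
      Matrix.fromBlocks (Matrix.of fun i j => L (v j) i) 0
        (Matrix.of fun i j => inner ℝ (p i) (v j))
        (Matrix.of fun i j : ι => inner ℝ (p i) (u j - B (L (u j)))) := by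
    ext i j
    rcases i with i | i <;> rcases j with j | j <;> simp [ha, hgi, hLB]
  have hgram : Matrix.gram ℝ a = Matrix.fromBlocks (Matrix.gram ℝ g) 0 0 1 := by
    ext i j
    rcases i with i | i <;> rcases j with j | j
    · simp [ha, Matrix.gram]
    · simp [ha, Matrix.gram, hgi, hLp]
    · simp only [ha, Matrix.gram, Matrix.of_apply, Sum.elim_inr, Sum.elim_inl,
        Matrix.fromBlocks_apply₂₁, Matrix.zero_apply]
      rw [real_inner_comm, hgi, hLp]; rfl
    · simp [ha, Matrix.gram, orthonormal_iff_ite.1 hp, Matrix.one_apply]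
  have hdetX := congrArg Matrix.det hX
  rw [Matrix.det_mul, Matrix.det_fromBlocks_zero₂₁, Matrix.det_one, Matrix.det_one, mul_one,
    mul_one, hX', Matrix.det_fromBlocks_zero₁₂] at hdetX
  have hsq := det_inner_sq hι a (Sum.elim v u)
  rw [hgram, Matrix.det_fromBlocks_zero₂₁, Matrix.det_one, mul_one, ← hdetX] at hsq
  rw [jacV_eq hd h hv hvV, ← abs_mul, ← Real.sqrt_sq_eq_abs, hsq,
    Real.sqrt_mul (gram_det_nonneg g)]
  rfl

end Determinant

/-! ### Comparison of a level set with its tangent space -/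

section Tangent

variable {W V : Subgroup (Heis n)} {Q : Heis n →ₗ[ℝ] Heis n} {d : Heis n → Heis n → ℝ} {k : ℕ}
  {f : Heis n → EuclideanSpace ℝ (Fin k)} {x : Heis n} {L : Heis n →ₗ[ℝ] EuclideanSpace ℝ (Fin k)}
  {B : EuclideanSpace ℝ (Fin k) →ₗ[ℝ] Heis n}

/-- The graph map of the intrinsic differential `w ↦ -B (L w)`, whose image is the kernel of `L`. -/
noncomputable def linGraph (B : EuclideanSpace ℝ (Fin k) →ₗ[ℝ] Heis n)
    (L : Heis n →ₗ[ℝ] EuclideanSpace ℝ (Fin k)) (w : Heis n) : Heis n :=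
  w * (-(B ∘ₗ L)) w

lemma linGraph_eq (w : Heis n) : linGraph B L w = w * (B (L w))⁻¹ := rfl

/-- The tangent point depends only on the coset `w V`: from any point of the coset it is reached by
undoing the defect. Applied to a displacement of the level set, this measures its distance from `ker
L`. -/
lemma linGraph_eq_mul_inv (hQ : IsSplit W V Q) (hL : L (e n) = 0) (hB : ∀ y, B y ∈ V)
    (hBL : ∀ u ∈ V, B (L u) = u) (w : Heis n) {u : Heis n} (hu : u ∈ V) :
    linGraph B L w = w * u * (B (L (w * u)))⁻¹ := by
  rw [linGraph_eq, map_mul_of_map_e hL, map_add, hBL u hu, mul_assoc, ← hQ.mul_eq_add (hB _) hu]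
  group

lemma linGraph_dil (hQ : IsSplit W V Q) (hL : L (e n) = 0) (hB : ∀ y, B y ∈ V) (t : ℝ)
    (w : Heis n) : linGraph B L (dil t w) = dil t (linGraph B L w) := by
  rw [linGraph_eq, linGraph_eq, dil_mul, dil_inv, map_dil_of_map_e hL, map_smul,
    dil_of_mem (hQ.horizontal _ (hB _))]

lemma linGraph_of_mem_ker (hL : L (e n) = 0) {ν : Heis n} (hν : L ν = 0)
    (hBL : ∀ u ∈ V, B (L u) = u) (hQ : IsSplit W V Q) : linGraph B L (ν * (Q ν)⁻¹) = ν := by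
  rw [linGraph_eq, map_mul_of_map_e hL, hν, zero_add, map_inv', map_neg, hBL _ (hQ.Q_mem ν),
    ← inv_def, inv_inv, inv_mul_cancel_right]

lemma exists_dist_map_le (hn : 0 < n) (hd : IsHomDist d) {M : Heis n →ₗ[ℝ] Heis n}
    (hM : M (e n) = 0) (hMH : ∀ p, M p ∈ H1 n) : ∃ K > 0, ∀ p, d (M p) 0 ≤ K * d p 0 := by
  obtain ⟨C, hC, h⟩ := hd.exists_norm_le hn
  obtain ⟨C', hC', h'⟩ := hd.exists_gauge_bounds hn
  refine ⟨C * ((‖LinearMap.toContinuousLinearMap M‖ + 1) * C'), by positivity, fun p => ?_⟩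
  have h1 : M p = M (projH1 p) := by simp [projH1, hM]
  have h2 : ‖projH1 p‖ ≤ gauge p := le_add_of_nonneg_right (Real.sqrt_nonneg _)
  refine (h _ (hMH p)).2.trans ?_
  rw [mul_assoc, mul_assoc]
  refine mul_le_mul_of_nonneg_left ?_ hC.le
  rw [h1]
  refine ((LinearMap.toContinuousLinearMap M).le_opNorm _).trans ?_
  exact mul_le_mul (by linarith) (h2.trans (h' p).1) (norm_nonneg _) (by positivity)

variable {U : Set (Heis n)} {φ : Heis n → Heis n} {u₀ : Heis n}

/-- In a small ball, the level set lies over the slightly larger piece of the tangent space. -/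
lemma exists_linGraph_mem (hn : 0 < n) (hd : IsHomDist d) (hQ : IsSplit W V Q)
    (h : IsStrictPansu d f x L) (hB : ∀ y, B y ∈ V) (hBL : ∀ u ∈ V, B (L u) = u)
    (hφV : ∀ u ∈ U, φ u ∈ V) (hf : ∀ u ∈ U, f (graphMap φ u) = f x) {ε : ℝ} (hε : 0 < ε) :
    ∃ δ > 0, ∀ r < δ, ∀ y, d y x ≤ r → ∀ u ∈ U, graphMap φ u ∈ cball d y r →
      linGraph B L (x⁻¹ * u * Q x) ∈ cball d (x⁻¹ * y) (r * (1 + ε)) := by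
  obtain ⟨δ, hδ, H⟩ := h.exists_defect_le hn hd (fun y => hQ.horizontal _ (hB y)) (half_pos hε)
  refine ⟨δ / 2, half_pos hδ, fun r hr y hy u hu hur => ?_⟩
  have hur : d y (graphMap φ u) ≤ r := hur
  have h1 : d (x⁻¹ * graphMap φ u) 0 ≤ 2 * r := by
    rw [← hd.eq_inv_mul]
    have := hd.triangle x y (graphMap φ u)
    rw [hd.symm x y] at this
    linarith
  have h2 := H x (graphMap φ u) (by rwa [hd.self]) (by linarith) (hf u hu).symm
  -- The displacement from `x` has `W`-part `x⁻¹ u π_V(x)`, so it lies in the coset of the tangent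
  -- point.
  have hm : x⁻¹ * u * Q x * ((Q x)⁻¹ * φ u) = x⁻¹ * graphMap φ u := by rw [graphMap]; group
  have hv : (Q x)⁻¹ * φ u ∈ V := V.mul_mem (V.inv_mem (hQ.Q_mem x)) (hφV u hu)
  change d (x⁻¹ * y) _ ≤ _
  rw [linGraph_eq_mul_inv hQ h.1 hB hBL _ hv, hm]
  set m := x⁻¹ * graphMap φ u with hmdef
  have h3 := hd.triangle (x⁻¹ * y) m (m * (B (L m))⁻¹)
  rw [hd.mul_right, hd.inv_zero, hmdef, hd.left_inv, ← hmdef] at h3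
  nlinarith

/-- The tangent space is approximated by the level set. -/
lemma exists_dist_linGraph_le (hn : 0 < n) (hd : IsHomDist d) (hQ : IsSplit W V Q)
    (h : IsStrictPansu d f x L) (hB : ∀ y, B y ∈ V) (hBL : ∀ u ∈ V, B (L u) = u)
    (hU : ∃ O : Set (Heis n), IsOpen O ∧ U = O ∩ W)
    (hφV : ∀ u ∈ U, φ u ∈ V) (hφ : ContinuousOn φ U) (hf : ∀ u ∈ U, f (graphMap φ u) = f x)
    (hu₀ : u₀ ∈ U) (hx : x = graphMap φ u₀) {ε : ℝ} (hε : 0 < ε) :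
    ∃ δ > 0, ∀ u ∈ W, d (linGraph B L (x⁻¹ * u * Q x)) 0 < δ → u ∈ U ∧
      d (linGraph B L (x⁻¹ * u * Q x)) (x⁻¹ * graphMap φ u) ≤
        ε * d (linGraph B L (x⁻¹ * u * Q x)) 0 := by
  obtain ⟨O, hO, rfl⟩ := hU
  obtain ⟨δ, hδ, H⟩ := h.exists_defect_le hn hd (fun y => hQ.horizontal _ (hB y))
    (ε := min (1 / 2) (ε / 2)) (by positivity)
  obtain ⟨K, hK, hQK⟩ := exists_dist_map_le hn hd hQ.map_e fun p => hQ.horizontal _ (hQ.Q_mem p)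
  have hQx : Q x = φ u₀ := by
    rw [hx, graphMap, hQ.Q_mul, hQ.Q_W hu₀.2, hQ.Q_V (hφV _ hu₀), zero_add]
  have hΦ : ContinuousOn (graphMap φ) (O ∩ W) := continuousOn_id.mul hφ
  have hev : ∀ᶠ u in 𝓝[(W : Set (Heis n))] u₀, u ∈ O ∩ W ∧ d x (graphMap φ u) < δ := by
    have h1 : O ∩ (W : Set (Heis n)) ∈ 𝓝[(W : Set (Heis n))] u₀ :=
      inter_mem (mem_nhdsWithin_of_mem_nhds (hO.mem_nhds hu₀.1)) self_mem_nhdsWithin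
    have h2 : 𝓝[O ∩ (W : Set (Heis n))] u₀ = 𝓝[(W : Set (Heis n))] u₀ := by
      rw [inter_comm, nhdsWithin_inter_of_mem' (mem_nhdsWithin_of_mem_nhds (hO.mem_nhds hu₀.1))]
    have h3 := (hΦ u₀ hu₀).eventually ((hd.nhds_basis hn _).mem_of_mem hδ)
    rw [h2, ← hx] at h3
    exact Filter.Eventually.and h1 h3
  rw [eventually_nhdsWithin_iff] at hev
  have ht : Tendsto (fun w : Heis n => x * w * (Q x)⁻¹) (𝓝 0) (𝓝 u₀) := by
    have hc : Continuous fun w : Heis n => x * w * (Q x)⁻¹ := by fun_prop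
    have h0 : x * 0 * (Q x)⁻¹ = u₀ := by
      rw [← one_def, mul_one, hQx, hx, graphMap, mul_inv_cancel_right]
    simpa only [h0] using hc.tendsto 0
  obtain ⟨η, hη, Hη⟩ := (hd.nhds_basis hn (0 : Heis n)).eventually_iff.1 (ht.eventually hev)
  refine ⟨η / (1 + K), by positivity, fun u hu hlt => ?_⟩
  set w := x⁻¹ * u * Q x with hw
  have hQw : Q w = 0 := by
    rw [hw, hQ.Q_mul, hQ.Q_mul, hQ.Q_W hu, map_inv', hQ.proj]; abel
  have hwη : d 0 w < η := by
    -- Stripping the `V`-part recovers `w`, so a small tangent point has a small base point, and `u`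
    -- is close to `u₀`.
    have h1 : w = linGraph B L w * (Q (linGraph B L w))⁻¹ := by
      rw [linGraph_eq, hQ.Q_mul, hQw, zero_add, hQ.Q_V (V.inv_mem (hB _)), inv_inv,
        inv_mul_cancel_right]
    have h2 := hd.mul_le (linGraph B L w) (Q (linGraph B L w))⁻¹
    rw [← h1, hd.inv_zero] at h2
    rw [lt_div_iff₀ (by positivity)] at hlt
    rw [hd.symm]
    linarith [hQK (linGraph B L w)]
  have huw : x * w * (Q x)⁻¹ = u := by rw [hw]; group
  have hmem := Hη hwη
  rw [huw] at hmem
  obtain ⟨huU, hud⟩ := hmem hu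
  refine ⟨huU, ?_⟩
  have h2 := H x (graphMap φ u) (by rwa [hd.self]) (by rwa [← hd.eq_inv_mul]) (hf u huU).symm
  have hm : w * ((Q x)⁻¹ * φ u) = x⁻¹ * graphMap φ u := by rw [hw, graphMap]; group
  have hv : (Q x)⁻¹ * φ u ∈ V := V.mul_mem (V.inv_mem (hQ.Q_mem x)) (hφV u huU)
  have hg := linGraph_eq_mul_inv hQ h.1 hB hBL w hv
  rw [hm] at hg
  set m := x⁻¹ * graphMap φ u with hmdef
  have h3 : d (linGraph B L w) m = d (B (L m)) 0 := by
    rw [hg, hd.symm, hd.mul_right, hd.inv_zero]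
  have h4 : d m 0 ≤ d (linGraph B L w) 0 + d (B (L m)) 0 := by
    have := hd.mul_le (linGraph B L w) (B (L m))
    rwa [hg, inv_mul_cancel_right, ← hg] at this
  have h5 := hd.nonneg m 0
  have h6 := h2.trans (mul_le_mul_of_nonneg_right (min_le_left _ _) h5)
  have h7 := h2.trans (mul_le_mul_of_nonneg_right (min_le_right _ _) h5)
  rw [h3]
  nlinarith

/-- The inclusion converse to `exists_linGraph_mem`. The ball lies within `2r` of the origin, so an
error of relative size `ε / 2` is at most `ε r`. -/
lemma exists_mem_cball (hn : 0 < n) (hd : IsHomDist d) (hQ : IsSplit W V Q)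
    (h : IsStrictPansu d f x L) (hB : ∀ y, B y ∈ V) (hBL : ∀ u ∈ V, B (L u) = u)
    (hU : ∃ O : Set (Heis n), IsOpen O ∧ U = O ∩ W)
    (hφV : ∀ u ∈ U, φ u ∈ V) (hφ : ContinuousOn φ U) (hf : ∀ u ∈ U, f (graphMap φ u) = f x)
    (hu₀ : u₀ ∈ U) (hx : x = graphMap φ u₀) {ε : ℝ} (hε : 0 < ε) :
    ∃ δ > 0, ∀ r < δ, ∀ y, d y x ≤ r → ∀ u ∈ W,
      linGraph B L (x⁻¹ * u * Q x) ∈ cball d (x⁻¹ * y) r →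
        u ∈ U ∧ graphMap φ u ∈ cball d y (r * (1 + ε)) := by
  obtain ⟨δ, hδ, H⟩ := exists_dist_linGraph_le hn hd hQ h hB hBL hU hφV hφ hf hu₀ hx (half_pos hε)
  refine ⟨δ / 2, half_pos hδ, fun r hr y hy u hu hur => ?_⟩
  set w := x⁻¹ * u * Q x
  have hur : d (x⁻¹ * y) (linGraph B L w) ≤ r := hur
  have h1 : d (linGraph B L w) 0 ≤ 2 * r := by
    have h2 := hd.triangle (linGraph B L w) (x⁻¹ * y) 0
    rw [hd.symm (linGraph B L w) (x⁻¹ * y), ← hd.eq_inv_mul, hd.symm x y] at h2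
    linarith
  obtain ⟨hu', h3⟩ := H u hu (by linarith)
  refine ⟨hu', ?_⟩
  change d y _ ≤ _
  have h4 := hd.triangle (x⁻¹ * y) (linGraph B L w) (x⁻¹ * graphMap φ u)
  rw [hd.left_inv] at h4
  nlinarith

/-- The homogeneous tangent cone of the level set is the kernel of the differential. -/
lemma tanCone_eq_ker (hn : 0 < n) (hd : IsHomDist d) (hQ : IsSplit W V Q)
    (h : IsStrictPansu d f x L) (hB : ∀ y, B y ∈ V) (hLB : ∀ y, L (B y) = y)
    (hBL : ∀ u ∈ V, B (L u) = u) (hU : ∃ O : Set (Heis n), IsOpen O ∧ U = O ∩ W)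
    (hφV : ∀ u ∈ U, φ u ∈ V) (hφ : ContinuousOn φ U) {S : Set (Heis n)}
    (hfS : ∀ y ∈ S, f y = f x) (hφS : ∀ u ∈ U, graphMap φ u ∈ S)
    (hu₀ : u₀ ∈ U) (hx : x = graphMap φ u₀) : tanCone S x = LinearMap.ker L := by
  ext ν
  constructor
  · rintro ⟨r, y, hr, hyS, hyx, hν⟩
    -- Both sides of the defect estimate are homogeneous under dilations, so it passes to the limit
    -- of the rescaled displacements.
    have hle : ∀ ε > 0, d (B (L ν)) 0 ≤ ε * d ν 0 := by
      intro ε hε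
      obtain ⟨δ, hδ, H⟩ := h.exists_defect_le hn hd (fun y => hQ.horizontal _ (hB y)) hε
      have hc1 : Continuous fun p => d (B (L p)) 0 :=
        (hd.continuous_left hn 0).comp (LinearMap.continuous_of_finiteDimensional (B ∘ₗ L))
      have hc2 : Continuous fun p => ε * d p 0 := (hd.continuous_left hn 0).const_mul ε
      refine le_of_tendsto_of_tendsto ((hc1.tendsto ν).comp hν) ((hc2.tendsto ν).comp hν) ?_
      filter_upwards [hyx.eventually ((hd.nhds_basis hn x).mem_of_mem hδ)] with j hj
      have hj : d x (y j) < δ := hj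
      have := H x (y j) (by rwa [hd.self]) (by rwa [← hd.eq_inv_mul]) (hfS _ (hyS j)).symm
      simp only [Function.comp_apply]
      rw [map_dil_of_map_e h.1, map_smul, hd.smul_le (hQ.horizontal _ (hB _)),
        abs_of_pos (hr j), hd.dil_zero (hr j), mul_left_comm]
      exact mul_le_mul_of_nonneg_left this (hr j).le
    have h0 : d (B (L ν)) 0 ≤ 0 := by
      have ht : Tendsto (fun ε : ℝ => ε * d ν 0) (𝓝[>] 0) (𝓝 0) := by
        have := ((continuous_mul_const (d ν 0)).tendsto (0 : ℝ)).mono_left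
          (nhdsWithin_le_nhds (s := Ioi 0))
        simpa using this
      exact ge_of_tendsto ht (eventually_mem_nhdsWithin.mono fun ε hε => hle ε hε)
    have h1 := (hd.eq_zero_iff _ _).1 (le_antisymm h0 (hd.nonneg _ _))
    have h2 := congrArg L h1
    rwa [hLB, map_zero] at h2
  · intro hν
    have hν : L ν = 0 := hν
    have hd0 := hd.nonneg ν 0
    -- For small `t`, the level set has a point within `ε t` of `δ_t ν` after translation by `x⁻¹`;
    -- dilating by `r = t⁻¹` gives the approximation of `ν`.
    have key : ∀ ε > 0, ∃ r > 0, ∃ y ∈ S, d x y ≤ ε ∧ d ν (dil r (x⁻¹ * y)) ≤ ε := by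
      intro ε hε
      obtain ⟨δ, hδ, H⟩ := exists_dist_linGraph_le hn hd hQ h hB hBL hU hφV hφ
        (fun u hu => hfS _ (hφS u hu)) hu₀ hx (ε := min 1 (ε / (d ν 0 + 1))) (by positivity)
      set t := min (δ / (d ν 0 + 1)) (ε / (2 * (d ν 0 + 1))) with ht
      have ht0 : 0 < t := by positivity
      set w := ν * (Q ν)⁻¹ with hw
      have hgw : linGraph B L (dil t w) = dil t ν := by
        rw [linGraph_dil hQ h.1 hB, linGraph_of_mem_ker h.1 hν hBL hQ]
      have huW : x * dil t w * (Q x)⁻¹ ∈ W := by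
        rw [hQ.mem_W, hQ.Q_mul, hQ.Q_mul, map_inv', hQ.proj, map_dil_of_map_e hQ.map_e,
          hQ.Q_W (hQ.mul_inv_mem ν)]
        simp
      have hw' : x⁻¹ * (x * dil t w * (Q x)⁻¹) * Q x = dil t w := by group
      have h1 : t * (d ν 0 + 1) ≤ δ :=
        (le_div_iff₀ (by positivity)).1 (min_le_left (δ / (d ν 0 + 1)) _)
      have h2 : t * (2 * (d ν 0 + 1)) ≤ ε :=
        (le_div_iff₀ (by positivity)).1 (min_le_right _ (ε / (2 * (d ν 0 + 1))))
      have hH := H _ huW (by rw [hw', hgw, hd.dil_zero ht0]; linarith)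
      rw [hw', hgw, hd.dil_zero ht0] at hH
      obtain ⟨huU, hle⟩ := hH
      set y := graphMap φ (x * dil t w * (Q x)⁻¹)
      have htd : 0 ≤ t * d ν 0 := mul_nonneg ht0.le hd0
      refine ⟨t⁻¹, inv_pos.2 ht0, y, hφS _ huU, ?_, ?_⟩
      · have h3 := hd.triangle (x⁻¹ * y) (dil t ν) 0
        rw [hd.symm (x⁻¹ * y) (dil t ν), hd.dil_zero ht0, ← hd.eq_inv_mul] at h3
        have h4 := hle.trans (mul_le_mul_of_nonneg_right (min_le_left _ _) htd)
        linarith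
      · have h3 := hd.dil t⁻¹ (inv_pos.2 ht0) (dil t ν) (x⁻¹ * y)
        rw [dil_inv_dil ht0] at h3
        rw [h3, inv_mul_le_iff₀ ht0]
        refine hle.trans ?_
        have h4 := mul_le_mul_of_nonneg_right (min_le_right 1 (ε / (d ν 0 + 1))) htd
        refine h4.trans ?_
        rw [div_mul_eq_mul_div, div_le_iff₀ (by positivity)]
        have : 0 ≤ ε * t := by positivity
        nlinarith
    choose! r hr y hyS hyx hyν using key
    have hε : ∀ j : ℕ, 0 < 1 / ((j : ℝ) + 1) := fun j => by positivity
    have ht := tendsto_one_div_add_atTop_nhds_zero_nat (𝕜 := ℝ)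
    refine ⟨fun j => r (1 / ((j : ℝ) + 1)), fun j => y (1 / ((j : ℝ) + 1)), fun j => hr _ (hε j),
      fun j => hyS _ (hε j), ?_, ?_⟩
    · rw [← hd.comap_nhds hn, tendsto_comap_iff]
      exact squeeze_zero (fun j => hd.nonneg _ _) (fun j => hyx _ (hε j)) ht
    · rw [← hd.comap_nhds hn, tendsto_comap_iff]
      exact squeeze_zero (fun j => hd.nonneg _ _) (fun j => hyν _ (hε j)) ht

lemma finrank_ker (hLB : ∀ y, L (B y) = y) :
    Module.finrank ℝ (LinearMap.ker L) = 2 * n + 1 - k := by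
  have h1 := LinearMap.finrank_range_add_finrank_ker L
  have h2 : LinearMap.range L = ⊤ := LinearMap.range_eq_top.2 fun y => ⟨B y, hLB y⟩
  rw [h2, finrank_top, finrank_euclideanSpace, finrank_euclideanSpace] at h1
  simp only [Fintype.card_fin, Fintype.card_sum, Fintype.card_unit] at h1
  omega

end Tangent

/-! ### The Federer density -/

section Density

variable {d : Heis n → Heis n → ℝ}

lemma le_of_forall_le_pow_mul {a b : ℝ≥0∞} (m : ℕ)
    (h : ∀ ε : ℝ, 0 < ε → a ≤ ENNReal.ofReal ((1 + ε) ^ m) * b) : a ≤ b := by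
  have h1 : Tendsto (fun ε : ℝ => ENNReal.ofReal ((1 + ε) ^ m)) (𝓝[>] 0) (𝓝 1) := by
    have hc : Continuous fun ε : ℝ => ENNReal.ofReal ((1 + ε) ^ m) :=
      ENNReal.continuous_ofReal.comp (by fun_prop)
    have := (hc.tendsto 0).mono_left (nhdsWithin_le_nhds (s := Ioi 0))
    simpa using this
  have h2 := ENNReal.Tendsto.mul_const (b := b) h1 (Or.inl one_ne_zero)
  rw [one_mul] at h2
  exact ge_of_tendsto h2 (eventually_mem_nhdsWithin.mono fun ε hε => h ε hε)

lemma density_quotient (hn : 0 < n) (hd : IsHomDist d) (α : ℕ) (y : Heis n) {r : ℝ} (hr : 0 < r)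
    (m : ℝ≥0∞) : 2 ^ (α : ℝ) * m / diam d (cball d y r) ^ (α : ℝ) =
      m / ENNReal.ofReal (r ^ α) := by
  rw [hd.diam_cball hn y hr, ENNReal.rpow_natCast, ENNReal.rpow_natCast,
    ENNReal.ofReal_mul two_pos.le, mul_pow, ENNReal.ofReal_pow hr.le]
  have h2 : ENNReal.ofReal 2 = 2 := by simp
  rw [h2]
  exact ENNReal.mul_div_mul_left _ _ (by positivity) (ENNReal.pow_ne_top (by simp))

/-- The upper estimate must be uniform over all balls containing `x`. For the lower one it suffices
to follow, for each `u`, the balls centred at `x δ_r(u)`. -/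
lemma federerDensity_eq (hn : 0 < n) (hd : IsHomDist d) {α : ℕ} {μ : Measure (Heis n)}
    {x : Heis n} {a : Heis n → ℝ≥0∞}
    (hub : ∀ ε : ℝ, 0 < ε → ∃ δ > 0, ∀ r y, 0 < r → r < δ → d y x ≤ r →
      μ (cball d y r) ≤ ENNReal.ofReal ((1 + ε) ^ (α + 1)) *
        (ENNReal.ofReal (r ^ α) * ⨆ u ∈ cball d 0 1, a u))
    (hlb : ∀ u ∈ cball d 0 1, ∀ ε : ℝ, 0 < ε → ∃ δ > 0, ∀ r, 0 < r → r < δ →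
      ENNReal.ofReal (r ^ α) * a u ≤
        ENNReal.ofReal (1 + ε) * μ (cball d (x * dil r u) (r * (1 + ε)))) :
    federerDensity d α μ x = ⨆ u ∈ cball d 0 1, a u := by
  have hdiv : ∀ {m b : ℝ≥0∞} {r : ℝ}, 0 < r →
      (m / ENNReal.ofReal (r ^ α) ≤ b ↔ m ≤ ENNReal.ofReal (r ^ α) * b) := fun {m b r} hr => by
    rw [ENNReal.div_le_iff (by simpa using pow_pos hr α) ENNReal.ofReal_ne_top, mul_comm]
  apply le_antisymm
  · refine le_of_forall_le_pow_mul (α + 1) fun ε hε => ?_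
    obtain ⟨δ, hδ, H⟩ := hub ε hε
    refine (iInf_le _ ⟨δ, hδ⟩).trans (sSup_le ?_)
    rintro b ⟨y, r, hr, hrδ, hx, rfl⟩
    rw [density_quotient hn hd α y hr, hdiv hr]
    refine (H r y hr hrδ hx).trans (le_of_eq ?_)
    ring
  · refine iSup₂_le fun u hu => le_iInf fun ε₀ => ?_
    refine le_of_forall_le_pow_mul (α + 1) fun ε hε => ?_
    obtain ⟨δ, hδ, H⟩ := hlb u hu ε hε
    obtain ⟨ε₀, hε₀⟩ := ε₀
    -- The competing ball has radius `r (1 + ε)`, which must stay below `ε₀`. The enlarged radius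
    -- costs `(1 + ε) ^ α` and the hypothesis one more factor.
    set r := min (δ / 2) (ε₀ / (2 * (1 + ε))) with hr
    have hr0 : 0 < r := by positivity
    have hr1 : r < δ := (min_le_left _ _).trans_lt (by linarith)
    have hr2 : r * (1 + ε) < ε₀ := by
      have : r * (2 * (1 + ε)) ≤ ε₀ :=
        (le_div_iff₀ (by positivity)).1 (min_le_right (δ / 2) (ε₀ / (2 * (1 + ε))))
      linarith
    have hr3 : 0 < r * (1 + ε) := by positivity
    have hu : d 0 u ≤ 1 := hu
    have hmem : x ∈ cball d (x * dil r u) (r * (1 + ε)) := by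
      change d (x * dil r u) x ≤ _
      rw [hd.symm, hd.mul_right, hd.dil_zero hr0, hd.symm u]
      exact mul_le_mul_of_nonneg_left (by linarith) hr0.le
    have h1 := H r hr0 hr1
    set M := μ (cball d (x * dil r u) (r * (1 + ε))) with hM
    have h2 : M / ENNReal.ofReal ((r * (1 + ε)) ^ α) ≤
        sSup {b | ∃ (y : Heis n) (r : ℝ), 0 < r ∧ r < ε₀ ∧ x ∈ cball d y r ∧
          b = 2 ^ (α : ℝ) * μ (cball d y r) / diam d (cball d y r) ^ (α : ℝ)} :=
      le_sSup ⟨_, _, hr3, hr2, hmem, (density_quotient hn hd α _ hr3 _).symm⟩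
    rw [hdiv hr3] at h2
    set Θ := sSup {b | ∃ (y : Heis n) (r : ℝ), 0 < r ∧ r < ε₀ ∧ x ∈ cball d y r ∧
          b = 2 ^ (α : ℝ) * μ (cball d y r) / diam d (cball d y r) ^ (α : ℝ)}
    have h3 := h1.trans (mul_le_mul_right h2 (ENNReal.ofReal (1 + ε)))
    have h4 : ENNReal.ofReal (1 + ε) * (ENNReal.ofReal ((r * (1 + ε)) ^ α) * Θ) =
        ENNReal.ofReal (r ^ α) * (ENNReal.ofReal ((1 + ε) ^ (α + 1)) * Θ) := by
      rw [← mul_assoc, ← mul_assoc, ← ENNReal.ofReal_mul (by positivity),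
        ← ENNReal.ofReal_mul (by positivity)]
      congr 2
      rw [mul_pow]
      ring
    rw [h4] at h3
    exact (ENNReal.mul_le_mul_iff_right (by simpa using pow_pos hr0 α) ENNReal.ofReal_ne_top).1 h3

/-- The spherical factor is attained. -/
lemma exists_sphericalFactor_eq (hn : 0 < n) (hd : IsHomDist d) (P : Submodule ℝ (Heis n))
    (hfin : ∀ A : Set (Heis n), IsCompact A →
      hausE n (Module.finrank ℝ P) (P ∩ A) ≠ ∞) :
    ∃ u ∈ cball d 0 1, sphericalFactor d P = hausE n (Module.finrank ℝ P) (P ∩ cball d u 1) := by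
  set m := hausE n (Module.finrank ℝ P)
  -- For `u'` near `u`, the unit ball at `u'` lies in a slightly larger ball at `u`; these decrease
  -- to the unit ball at `u`, and their measures converge because they are finite.
  have husc : UpperSemicontinuousOn (fun u => m (P ∩ cball d u 1)) (cball d 0 1) := by
    intro u _ b hb
    have hanti : Antitone fun j : ℕ => (P : Set (Heis n)) ∩ cball d u (1 + 1 / ((j : ℝ) + 1)) := by
      intro i j hij
      refine inter_subset_inter_right _ fun y hy => le_trans (show d u y ≤ _ from hy) ?_
      gcongr
    have hInter : ⋂ j : ℕ, ((P : Set (Heis n)) ∩ cball d u (1 + 1 / ((j : ℝ) + 1))) =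
        (P : Set (Heis n)) ∩ cball d u 1 := by
      rw [← inter_iInter]
      congr 1
      ext y
      simp only [mem_iInter]
      constructor
      · intro hy
        have ht : Tendsto (fun j : ℕ => 1 + 1 / ((j : ℝ) + 1)) atTop (𝓝 (1 + 0)) :=
          tendsto_one_div_add_atTop_nhds_zero_nat.const_add 1
        rw [add_zero] at ht
        exact ge_of_tendsto' ht fun j => hy j
      · intro hy j
        have : (0 : ℝ) ≤ 1 / ((j : ℝ) + 1) := by positivity
        exact le_trans (show d u y ≤ 1 from hy) (by linarith)
    have hmeas : ∀ j : ℕ, NullMeasurableSet ((P : Set (Heis n)) ∩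
        cball d u (1 + 1 / ((j : ℝ) + 1))) m := fun j =>
      (P.closed_of_finiteDimensional.inter
        (hd.isClosed_cball hn u _)).measurableSet.nullMeasurableSet
    have ht := tendsto_measure_iInter_atTop hmeas hanti
      ⟨0, hfin _ (hd.isCompact_cball hn u _)⟩
    rw [hInter] at ht
    obtain ⟨j, hj⟩ := (ht.eventually (gt_mem_nhds hb)).exists
    refine mem_nhdsWithin_of_mem_nhds ?_
    filter_upwards [(hd.nhds_basis hn u).mem_of_mem
      (show (0 : ℝ) < 1 / ((j : ℝ) + 1) by positivity)] with u' hu'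
    refine (measure_mono (inter_subset_inter_right _ fun y hy => ?_)).trans_lt hj
    have hu' : d u u' < 1 / ((j : ℝ) + 1) := hu'
    have hy : d u' y ≤ 1 := hy
    have := hd.triangle u u' y
    change d u y ≤ _
    linarith
  have h0 : (0 : Heis n) ∈ cball d 0 1 := by
    change d 0 0 ≤ 1
    rw [hd.self]; norm_num
  obtain ⟨u, hu, hmax⟩ := husc.exists_isMaxOn ⟨0, h0⟩ (hd.isCompact_cball hn 0 1)
  refine ⟨u, hu, le_antisymm (iSup₂_le fun y hy => isMaxOn_iff.1 hmax y hy) ?_⟩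
  exact le_iSup₂_of_le u hu le_rfl

end Density

/-! ### The blow-up -/

lemma exists_linearIsometry_range {ι : Type*} [Fintype ι] (P : Submodule ℝ (Heis n))
    (hP : Module.finrank ℝ P = Fintype.card ι) :
    ∃ T : EuclideanSpace ℝ ι →ₗᵢ[ℝ] Heis n, range T = P := by
  let b : OrthonormalBasis ι ℝ P := (stdOrthonormalBasis ℝ P).reindex
    (Fintype.equivOfCardEq (by rw [Fintype.card_fin, hP]))
  refine ⟨P.subtypeₗᵢ.comp b.repr.symm.toLinearIsometry, ?_⟩
  ext y
  constructor
  · rintro ⟨x, rfl⟩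
    exact (b.repr.symm x).2
  · intro hy
    exact ⟨b.repr ⟨y, hy⟩, by simp⟩

lemma wedgeNorm_pos {ι : Type*} [Fintype ι] [DecidableEq ι] {u : ι → Heis n}
    (hu : LinearIndependent ℝ u) : 0 < wedgeNorm u := by
  rw [wedgeNorm_eq_gram, Real.sqrt_pos]
  exact (Matrix.posDef_gram_iff_linearIndependent.2 hu).det_pos

lemma linearIndependent_sumElim {ι κ : Type*} {W V : Subgroup (Heis n)} {Q : Heis n →ₗ[ℝ] Heis n}
    (hQ : IsSplit W V Q) {v : κ → Heis n} {u : ι → Heis n} (hv : Orthonormal ℝ v)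
    (hvV : (Submodule.span ℝ (Set.range v) : Set (Heis n)) = V) (hu : Orthonormal ℝ u)
    (huW : (Submodule.span ℝ (Set.range u) : Set (Heis n)) = W) :
    LinearIndependent ℝ (Sum.elim v u) := by
  refine LinearIndependent.sum_type hv.linearIndependent hu.linearIndependent ?_
  rw [Submodule.disjoint_def]
  intro x hx hx'
  rw [← SetLike.mem_coe, hvV, SetLike.mem_coe] at hx
  rw [← SetLike.mem_coe, huW, SetLike.mem_coe] at hx'
  rw [← hQ.Q_V hx, hQ.Q_W hx']

/-- The measure `∫_{Φ⁻¹(B)} J(Φ) dm` carried by a continuous graph. -/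
lemma exists_graph_measure {U : Set (Heis n)} (hU : MeasurableSet U) {Φ : Heis n → Heis n}
    (hΦ : ContinuousOn Φ U) (m : Measure (Heis n)) (c : ℝ≥0∞) (J : Heis n → ℝ≥0∞) :
    ∃ μ : Measure (Heis n), ∀ B, MeasurableSet B →
      MeasurableSet (U ∩ Φ ⁻¹' B) ∧ μ B = c * ∫⁻ u in U ∩ Φ ⁻¹' B, J u ∂m := by
  classical
  -- The value `0` outside `U` is harmless, since the measure is restricted to `U` before being
  -- pushed forward.
  have hm : Measurable (U.piecewise Φ fun _ => 0) :=
    hΦ.measurable_piecewise continuousOn_const hU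
  refine ⟨c • ((m.restrict U).withDensity J).map (U.piecewise Φ fun _ => 0), fun B hB => ?_⟩
  have hpre : (U.piecewise Φ fun _ => 0) ⁻¹' B ∩ U = U ∩ Φ ⁻¹' B := by
    ext u
    constructor
    · rintro ⟨h1, h2⟩
      rw [mem_preimage, piecewise_eq_of_mem _ _ _ h2] at h1
      exact ⟨h2, h1⟩
    · rintro ⟨h1, h2⟩
      exact ⟨by rwa [mem_preimage, piecewise_eq_of_mem _ _ _ h1], h1⟩
  refine ⟨by rw [← hpre]; exact (hm hB).inter hU, ?_⟩
  rw [Measure.smul_apply, smul_eq_mul, Measure.map_apply hm hB, withDensity_apply _ (hm hB),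
    Measure.restrict_restrict (hm hB), hpre]

section BlowUp

variable {k : ℕ} {W V : Subgroup (Heis n)} {Q : Heis n →ₗ[ℝ] Heis n} {d : Heis n → Heis n → ℝ}
  {f : Heis n → EuclideanSpace ℝ (Fin k)} {x : Heis n} {L : Heis n →ₗ[ℝ] EuclideanSpace ℝ (Fin k)}
  {B : EuclideanSpace ℝ (Fin k) →ₗ[ℝ] Heis n} {U : Set (Heis n)} {φ : Heis n → Heis n}
  {u₀ : Heis n} {ι : Type*} [Fintype ι] {p : ℕ} {a : EuclideanSpace ℝ ι}

lemma continuous_linGraph : Continuous (linGraph B L) :=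
  continuous_id.mul (LinearMap.continuous_of_finiteDimensional (-(B ∘ₗ L)))

/-- The lower and upper bounds for the measures of small balls that give the density of the
graph measure `μ`; `D` is the Jacobian factor of the tangent graph map. -/
lemma federerDensity_graph (hn : 0 < n) (hd : IsHomDist d) (hQ : IsSplit W V Q)
    (h : IsStrictPansu d f x L) (hB : ∀ y, B y ∈ V) (hBL : ∀ u ∈ V, B (L u) = u)
    (hU : ∃ O : Set (Heis n), IsOpen O ∧ U = O ∩ W)
    (hφV : ∀ u ∈ U, φ u ∈ V) (hφ : ContinuousOn φ U) (hf : ∀ u ∈ U, f (graphMap φ u) = f x)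
    (hu₀ : u₀ ∈ U) (hx : x = graphMap φ u₀) (hp : Fintype.card ι = p)
    (T T' : EuclideanSpace ℝ ι →ₗᵢ[ℝ] Heis n) (hT : range T = W) (ha : T a = e n)
    {a' : EuclideanSpace ℝ ι} (ha' : T' a' = e n)
    {D : ℝ≥0∞} (hD : ∀ A, MeasurableSet A →
      hausE n p (range T' ∩ A) = D * hausE n p (W ∩ linGraph B L ⁻¹' A))
    {c : ℝ≥0∞} {J : Heis n → ℝ} (hJ : ContinuousAt J x) (hJx : 0 < J x)
    (hcD : c * ENNReal.ofReal (J x) = D) {μ : Measure (Heis n)}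
    (hμ : ∀ A, MeasurableSet A → MeasurableSet (U ∩ graphMap φ ⁻¹' A) ∧
      μ A = c * ∫⁻ u in U ∩ graphMap φ ⁻¹' A, ENNReal.ofReal (J (graphMap φ u)) ∂(hausE n p)) :
    federerDensity d ((p + 1 : ℕ) : ℝ) μ x =
      ⨆ u ∈ cball d 0 1, hausE n p (range T' ∩ cball d u 1) := by
  have hUW : U ⊆ W := by
    obtain ⟨O, -, rfl⟩ := hU
    exact inter_subset_right
  have hJε : ∀ ε : ℝ, 0 < ε → ∃ δ > 0, ∀ q, d x q < δ →
      J q ≤ (1 + ε) * J x ∧ J x ≤ (1 + ε) * J q := fun ε hε => by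
    have h1 : ∀ᶠ q in 𝓝 x, J q < (1 + ε) * J x ∧ J x < (1 + ε) * J q := by
      refine (hJ.eventually (gt_mem_nhds ?_)).and
        ((hJ.const_mul (1 + ε)).eventually (lt_mem_nhds ?_)) <;> nlinarith
    obtain ⟨δ, hδ, H⟩ := (hd.nhds_basis hn x).eventually_iff.1 h1
    exact ⟨δ, hδ, fun q hq => ⟨(H hq).1.le, (H hq).2.le⟩⟩
  have hτ : ∀ A : Set (Heis n), MeasurableSet A →
      hausE n p (W ∩ (fun u => x⁻¹ * u * Q x) ⁻¹' (linGraph B L ⁻¹' A)) =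
        hausE n p (W ∩ linGraph B L ⁻¹' A) := fun A hA =>
    hausE_preimage_translation hp hQ T hT ha x (continuous_linGraph.measurable hA)
  have hballm : ∀ y r, MeasurableSet (cball d y r) := fun y r =>
    (hd.isClosed_cball hn y r).measurableSet
  refine federerDensity_eq hn hd ?_ ?_
  · intro ε hε
    obtain ⟨δ₁, hδ₁, H₁⟩ := hJε ε hε
    obtain ⟨δ₂, hδ₂, H₂⟩ := exists_linGraph_mem hn hd hQ h hB hBL hφV hf hε
    refine ⟨min (δ₁ / 2) δ₂, by positivity, fun r y hr hrδ hyx => ?_⟩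
    rw [lt_min_iff] at hrδ
    obtain ⟨hE, hμE⟩ := hμ _ (hballm y r)
    set E := U ∩ graphMap φ ⁻¹' cball d y r with hEdef
    have hμle : μ (cball d y r) ≤ ENNReal.ofReal (1 + ε) * (D * hausE n p E) := by
      rw [hμE]
      have h1 : ∫⁻ u in E, ENNReal.ofReal (J (graphMap φ u)) ∂(hausE n p) ≤
          ∫⁻ _ in E, ENNReal.ofReal ((1 + ε) * J x) ∂(hausE n p) := by
        refine setLIntegral_mono' hE fun u hu => ENNReal.ofReal_le_ofReal (H₁ _ ?_).1
        have h2 : d y (graphMap φ u) ≤ r := hu.2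
        have h3 := hd.triangle x y (graphMap φ u)
        rw [hd.symm x y] at h3
        linarith
      rw [setLIntegral_const, ENNReal.ofReal_mul (by positivity)] at h1
      refine (mul_le_mul_right h1 c).trans (le_of_eq ?_)
      rw [← hcD]; ring
    set R := r * (1 + ε) with hR
    have hR0 : 0 < R := by positivity
    -- Rescaling by `R` moves the centre to a point `η` of the unit ball, so the ball of radius `R`
    -- is compared with one entering the supremum.
    set η := dil R⁻¹ (x⁻¹ * y) with hη
    have hηm : η ∈ cball d 0 1 := by
      change d 0 η ≤ 1
      rw [hd.symm, hη, hd.dil_zero (inv_pos.2 hR0), ← hd.eq_inv_mul, hd.symm, inv_mul_le_iff₀ hR0]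
      nlinarith
    have hC : cball d (x⁻¹ * y) R = cball d (dil R η) (R * 1) := by
      rw [hη, dil_dil_inv hR0, mul_one]
    have hEle : hausE n p E ≤ hausE n p (W ∩ linGraph B L ⁻¹' cball d (x⁻¹ * y) R) := by
      rw [← hτ _ (hballm _ _)]
      exact measure_mono fun u hu => ⟨hUW hu.1, H₂ r hrδ.2 y hyx u hu.1 hu.2⟩
    have h4 : D * hausE n p E ≤ ENNReal.ofReal (R ^ (p + 1)) *
        ⨆ u ∈ cball d 0 1, hausE n p (range T' ∩ cball d u 1) := by
      refine (mul_le_mul_right hEle D).trans ?_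
      rw [← hD _ (hballm _ _), hC, hausE_inter_cball_dil hd hp T' ha' hR0]
      refine mul_le_mul_right ?_ _
      exact le_iSup₂_of_le η hηm le_rfl
    refine hμle.trans ((mul_le_mul_right h4 _).trans (le_of_eq ?_))
    rw [← mul_assoc, ← mul_assoc, ← ENNReal.ofReal_mul (by positivity),
      ← ENNReal.ofReal_mul (by positivity), hR, mul_pow]
    congr 2
    ring
  · intro u hu ε hε
    have hu : d 0 u ≤ 1 := hu
    obtain ⟨δ₁, hδ₁, H₁⟩ := hJε ε hε
    obtain ⟨δ₂, hδ₂, H₂⟩ := exists_mem_cball hn hd hQ h hB hBL hU hφV hφ hf hu₀ hx hε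
    refine ⟨min (δ₁ / (2 * (1 + ε))) δ₂, by positivity, fun r hr hrδ => ?_⟩
    rw [lt_min_iff, lt_div_iff₀ (by positivity)] at hrδ
    set y := x * dil r u with hy
    have hxy : x⁻¹ * y = dil r u := by rw [hy]; simp
    have hyx : d y x ≤ r := by
      rw [hd.eq_inv_mul', hxy, hd.dil_zero hr, hd.symm]
      nlinarith
    obtain ⟨hE, hμE⟩ := hμ _ (hballm y (r * (1 + ε)))
    set E := U ∩ graphMap φ ⁻¹' cball d y (r * (1 + ε)) with hEdef
    have h1 : ENNReal.ofReal (r ^ (p + 1)) * hausE n p (range T' ∩ cball d u 1) ≤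
        D * hausE n p E := by
      rw [← hausE_inter_cball_dil hd hp T' ha' hr, mul_one, hD _ (hballm _ _), ← hτ _ (hballm _ _)]
      refine mul_le_mul_right (measure_mono fun q hq => ?_) D
      refine H₂ r hrδ.2 y hyx q hq.1 ?_
      rw [hxy]
      exact hq.2
    refine h1.trans ?_
    rw [hμE, ← hcD]
    have h2 : ∫⁻ _ in E, ENNReal.ofReal (J x) ∂(hausE n p) ≤
        ∫⁻ u in E, ENNReal.ofReal (1 + ε) * ENNReal.ofReal (J (graphMap φ u)) ∂(hausE n p) := by
      refine setLIntegral_mono' hE fun q hq => ?_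
      rw [← ENNReal.ofReal_mul (by positivity)]
      refine ENNReal.ofReal_le_ofReal (H₁ _ ?_).2
      have h2 : d y (graphMap φ q) ≤ r * (1 + ε) := hq.2
      have h3 := hd.triangle x y (graphMap φ q)
      rw [hd.symm x y] at h3
      nlinarith
    rw [setLIntegral_const, lintegral_const_mul' _ _ ENNReal.ofReal_ne_top] at h2
    rw [mul_assoc]
    refine (mul_le_mul_right h2 c).trans (le_of_eq ?_)
    ring

end BlowUp

end Heis

/-! ### The upper blow-up theorem. -/

open Heis in
theorem theorem3p2 {n k : ℕ} (hk : 1 ≤ k) (hkn : k ≤ n)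
    (d : Heis n → Heis n → ℝ) (hd : IsHomDist d)
    (W V : Subgroup (Heis n)) (hWV : IsSemidirect W V)
    (Ω : Set (Heis n)) (hΩ : IsOpen Ω)
    (f : Heis n → EuclideanSpace ℝ (Fin k)) (hf : IsC1h Ω f)
    (x₀ : Heis n) (hx₀ : x₀ ∈ Ω)
    (S : Set (Heis n)) (hS : S = {x | x ∈ Ω ∧ f x = f x₀})
    (hJ : ∀ x ∈ S, 0 < jacV d V f x)
    (v : Fin k → Heis n) (hv : Orthonormal ℝ v)
    (hvV : (Submodule.span ℝ (Set.range v) : Set (Heis n)) = V)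
    (w : Fin (2 * n - k) → Heis n)
    (hw : Orthonormal ℝ (Sum.elim w fun _ : Unit => e n))
    (hwW : (Submodule.span ℝ (Set.range (Sum.elim w fun _ : Unit => e n)) : Set (Heis n)) = W) :
    -- near each of its points, the level set is a parametrized surface
    (∀ x ∈ S, ∃ Ω' : Set (Heis n), IsOpen Ω' ∧ x ∈ Ω' ∧ Ω' ⊆ Ω ∧
      IsParametrizedHRegular d k W V (S ∩ Ω')) ∧
    -- the whole level set is one, exactly when it meets every coset `u V` at most once
    (IsParametrizedHRegular d k W V S ↔ ∀ x ∈ S, ∀ y ∈ S, x⁻¹ * y ∈ V → x = y) ∧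
    -- the upper blow-up, for the whole level set (`Ω' = Ω`) or any part of it that is a graph
    (∀ Ω' : Set (Heis n), IsOpen Ω' → Ω' ⊆ Ω →
      ∀ (U : Set (Heis n)) (φ : Heis n → Heis n), IsParametrization d W V (S ∩ Ω') U φ →
        ∃ μ : Measure (Heis n),
          (∀ B : Set (Heis n), MeasurableSet B →
            μ B = ENNReal.ofReal (wedgeNorm (Sum.elim v (Sum.elim w fun _ : Unit => e n))) *
              ∫⁻ u in U ∩ graphMap φ ⁻¹' B,
                ENNReal.ofReal (jacH d f (graphMap φ u) / jacV d V f (graphMap φ u))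
                  ∂(hausE n (2 * n + 1 - k))) ∧
          ∀ x ∈ S ∩ Ω', ∃ P : Submodule ℝ (Heis n),
            (P : Set (Heis n)) = tanCone S x ∧ Module.finrank ℝ P = 2 * n + 1 - k ∧
            federerDensity d ((2 * n + 2 - k : ℕ) : ℝ) μ x = sphericalFactor d P ∧
            sphericalFactor d P ≠ ∞ ∧
            ∃ u ∈ cball d 0 1,
              sphericalFactor d P = hausE n (2 * n + 1 - k) (P ∩ cball d u 1)) := by
  have hn : 0 < n := by omega
  obtain ⟨Q, hQ⟩ := exists_isSplit hWV _ _ hwW hvV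
  have hSΩ : ∀ x ∈ S, x ∈ Ω := fun x hx => by rw [hS] at hx; exact hx.1
  have hSf : ∀ x ∈ S, f x = f x₀ := fun x hx => by rw [hS] at hx; exact hx.2
  have hst : ∀ x ∈ S, IsStrictPansu d f x (horDiff f x) := fun x hx =>
    hf.isStrictPansu hn hd hΩ (hSΩ x hx)
  have hinter : ∀ Ω' ⊆ Ω, S ∩ Ω' = {x | x ∈ Ω' ∧ f x = f x₀} := fun Ω' hΩ' => by
    rw [hS]
    ext x
    exact ⟨fun hx => ⟨hx.2, hx.1.2⟩, fun hx => ⟨⟨hΩ' hx.1, hx.2⟩, hx.1⟩⟩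
  refine ⟨fun x hx => ?_, ⟨?_, isParametrizedHRegular_of_injective hk hkn hd hWV hQ hΩ hf hv hvV hS
    hJ⟩, ?_⟩
  · obtain ⟨B, hB, -, hBL⟩ := exists_inverse_of_jacV_pos hd (hst x hx) hv hvV (hJ x hx)
    obtain ⟨δ, hδ, H⟩ := (hst x hx).exists_injective hn hd (fun y => hQ.horizontal _ (hB y)) hBL
    -- With radius `δ / 2`, any two points of `Ω'` are at distance less than `δ`, as local
    -- injectivity requires.
    set Ω' := Ω ∩ {y | d x y < δ / 2} with hΩ'
    have hsub : Ω' ⊆ Ω := inter_subset_left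
    have hopen : IsOpen Ω' := hΩ.inter (hd.isOpen_ball hn x _)
    refine ⟨Ω', hopen, ⟨hSΩ x hx, ?_⟩, hsub, ?_⟩
    · change d x x < δ / 2
      rw [hd.self]; positivity
    · refine isParametrizedHRegular_of_injective hk hkn hd hWV hQ hopen (hf.mono hsub) hv hvV
        (hinter Ω' hsub) (fun y hy => hJ y hy.1) fun y hy y' hy' hyV => ?_
      have h1 : d x y < δ / 2 := hy.2.2
      have h2 : d x y' < δ / 2 := hy'.2.2
      refine H y y' (by linarith) ?_ ((hSf y hy.1).trans (hSf y' hy'.1).symm) hyV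
      rw [← hd.eq_inv_mul]
      have h3 := hd.triangle y x y'
      rw [hd.symm y x] at h3
      linarith
  · rintro ⟨-, -, U, φ, ⟨⟨O, -, rfl⟩, hφV, -, hgraph⟩⟩ x hx y hy hxy
    rw [hgraph] at hx hy
    obtain ⟨u, hu, rfl⟩ := hx
    obtain ⟨u', hu', rfl⟩ := hy
    -- Two graph points in the same coset of `V` have base points that differ by an element of `W ⊓
    -- V`, which is trivial.
    have h1 : u⁻¹ * u' ∈ V := by
      have := V.mul_mem (V.mul_mem (hφV u hu) hxy) (V.inv_mem (hφV u' hu'))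
      have e1 : φ u * ((graphMap φ u)⁻¹ * graphMap φ u') * (φ u')⁻¹ = u⁻¹ * u' := by
        simp only [graphMap]; group
      rwa [e1] at this
    have h2 : u⁻¹ * u' ∈ W ⊓ V := ⟨W.mul_mem (W.inv_mem hu.2) hu'.2, h1⟩
    rw [hWV.inf_eq, Subgroup.mem_bot, inv_mul_eq_one] at h2
    rw [h2]
  · intro Ω' hΩ' hsub U φ hφ
    have hUW : U ⊆ W := by
      obtain ⟨O, -, hO⟩ := hφ.isOpen
      rw [hO]
      exact inter_subset_right
    have hΦS : ∀ u ∈ U, graphMap φ u ∈ S := fun u hu => by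
      have : graphMap φ u ∈ S ∩ Ω' := by rw [hφ.graph_eq]; exact ⟨u, hu, rfl⟩
      exact this.1
    have hcont : ContinuousOn φ U := continuousOn_of_graph_eq hn hd hQ hΩ' (hf.mono hsub) hv hvV
      (hinter Ω' hsub) (fun x hx => hJ x hx.1) hUW hφ.mapsTo hφ.graph_eq
    have hUm : MeasurableSet U := by
      obtain ⟨O, hO, rfl⟩ := hφ.isOpen
      rw [← hwW]
      exact hO.measurableSet.inter (Submodule.closed_of_finiteDimensional _).measurableSet
    set p := 2 * n + 1 - k with hp
    set u := Sum.elim w fun _ : Unit => e n with hu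
    obtain ⟨μ, hμ⟩ := exists_graph_measure hUm (continuousOn_id.mul hcont : ContinuousOn (graphMap φ) U)
      (hausE n p) (ENNReal.ofReal (wedgeNorm (Sum.elim v u)))
      fun u => ENNReal.ofReal (jacH d f (graphMap φ u) / jacV d V f (graphMap φ u))
    refine ⟨μ, fun B hB => (hμ B hB).2, fun x hx => ?_⟩
    have hxS := hx.1
    have hxU := hx
    rw [hφ.graph_eq] at hxU
    obtain ⟨u₀, hu₀, hxu₀⟩ := hxU
    obtain ⟨B, hB, hLB, hBL⟩ := exists_inverse_of_jacV_pos hd (hst x hxS) hv hvV (hJ x hxS)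
    set L := horDiff f x with hL
    have hfin : Module.finrank ℝ (LinearMap.ker L) = p := finrank_ker hLB
    have hcard : Fintype.card (Fin (2 * n - k) ⊕ Unit) = p := by
      simp only [Fintype.card_sum, Fintype.card_fin, Fintype.card_unit]; omega
    obtain ⟨T, hTu, hT⟩ := exists_linearIsometry hw
    rw [hwW] at hT
    obtain ⟨T', hT'⟩ := exists_linearIsometry_range (ι := Fin (2 * n - k) ⊕ Unit) (LinearMap.ker L)
      (by rw [hfin, hcard])
    obtain ⟨a', ha'⟩ : e n ∈ range T' := by rw [hT']; exact (hst x hxS).1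
    have ha : T (EuclideanSpace.single (Sum.inr ()) 1) = e n := by rw [hTu]; rfl
    have hjV := hJ x hxS
    have hjH := jacH_pos hd (hst x hxS) fun y => ⟨B y, hLB y⟩
    set Δ := Matrix.det (Matrix.of fun i j : Fin (2 * n - k) ⊕ Unit =>
      inner ℝ (T' (EuclideanSpace.single i 1)) (u j - B (L (u j)))) with hΔ
    have hpo : Orthonormal ℝ fun i : Fin (2 * n - k) ⊕ Unit => T' (EuclideanSpace.single i 1) := by
      have := (EuclideanSpace.basisFun (Fin (2 * n - k) ⊕ Unit) ℝ).orthonormal.comp_linearIsometry T'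
      simpa [Function.comp_def] using this
    -- Dividing by `J_V`, the constant and the weight of `μ` at `x` multiply to `|Δ|`, the factor by
    -- which `linGraph` changes the measure. The left side is positive, so `Δ ≠ 0`.
    have hid : jacH d f x * wedgeNorm (Sum.elim v u) = jacV d V f x * |Δ| := by
      refine jacH_mul_wedgeNorm hd (hst x hxS) hv hvV hB hLB ?_ u _ hpo fun i => ?_
      · simp only [Fintype.card_sum, Fintype.card_fin, Fintype.card_unit]; omega
      · have : T' (EuclideanSpace.single i 1) ∈ range T' := mem_range_self _
        rw [hT'] at this
        exact this
    have hwpos := wedgeNorm_pos (linearIndependent_sumElim hQ hv hvV hw hwW)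
    have hΔ0 : Δ ≠ 0 := by
      intro h0
      rw [h0, abs_zero, mul_zero] at hid
      exact (mul_pos hjH hwpos).ne' hid
    have hD : ∀ A, MeasurableSet A → hausE n p (range T' ∩ A) =
        ENNReal.ofReal |Δ| * hausE n p (W ∩ linGraph B L ⁻¹' A) := fun A hA => by
      rw [← hT]
      refine hausE_eq_det_mul hcard T T' ha (-(B ∘ₗ L)) ?_ (fun y => ?_) ?_ hΔ0 hA
      · rw [LinearMap.neg_apply, LinearMap.comp_apply, (hst x hxS).1, map_zero, neg_zero]
      · rw [hT', SetLike.mem_coe, LinearMap.mem_ker, map_add, LinearMap.neg_apply,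
          LinearMap.comp_apply, map_neg, hLB, add_neg_cancel]
      · simp only [hTu, LinearMap.neg_apply, LinearMap.comp_apply, ← sub_eq_add_neg, hΔ]
    have hdens := federerDensity_graph hn hd hQ (hst x hxS) hB hBL hφ.isOpen hφ.mapsTo hcont
      (fun q hq => (hSf _ (hΦS q hq)).trans (hSf x hxS).symm) hu₀ hxu₀.symm hcard T T' hT ha ha' hD
      (c := ENNReal.ofReal (wedgeNorm (Sum.elim v u))) (J := fun y => jacH d f y / jacV d V f y)
      (((hf.continuousOn_jacH hn hd hΩ).continuousAt (hΩ.mem_nhds (hSΩ x hxS))).div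
        ((hf.continuousOn_jacV hn hd hΩ hv hvV).continuousAt (hΩ.mem_nhds (hSΩ x hxS))) hjV.ne')
      (div_pos hjH hjV) (by
        rw [← ENNReal.ofReal_mul hwpos.le]
        congr 1
        field_simp
        linarith) hμ
    have hattain := exists_sphericalFactor_eq hn hd (LinearMap.ker L) fun A hA => by
      rw [hfin, ← hT']
      exact (hausE_inter_lt_top hcard T' hA).ne
    rw [hfin] at hattain
    refine ⟨LinearMap.ker L, (tanCone_eq_ker hn hd hQ (hst x hxS) hB hLB hBL hφ.isOpen hφ.mapsTo
      hcont (fun y hy => (hSf y hy).trans (hSf x hxS).symm) hΦS hu₀ hxu₀.symm).symm, hfin, ?_, ?_,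
      hattain⟩
    · have hα : 2 * n + 2 - k = p + 1 := by omega
      rw [hα, hdens, sphericalFactor, hfin, hT']
    · obtain ⟨q, -, hq⟩ := hattain
      rw [hq, ← hT']
      exact (hausE_inter_lt_top hcard T' (hd.isCompact_cball hn q 1)).ne
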